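/- **Setting.** Let $N\ge 2$, let $\Omega\subset\mathbb R^N$ be open and bounded, and let $X=(X_1,\dots,X_m)$, $X_j=\sum_{k=1}^N c_{jk}\partial_{x_k}$, be locally Lipschitz vector fields on $\mathbb R^N$; for $u\in C^1$ put $Xu=(X_1u,\dots,X_mu)$. An absolutely continuous path $\gamma$ on $[0,T]$ is $X$-subunit if for almost every $t$ one has $\dot\gamma(t)=\sum_j\theta_j(t)X_j(\gamma(t))$ with $\sum_j\theta_j(t)^2\le1$. Let $d_X(x,y)$ be the infimum of the $T>0$ for which some $X$-subunit path $\gamma:[0,T]\to\mathbb R^N$ joins $x$ to $y$, and let $B_r=B_r(x)=\{y\in\Omega: d_X(x,y)<r\}$ for $x\in\Omega$. Assume: * any two points of $\Omega$ are joined by an $X$-subunit path in $\Omega$; * $d_X(x,y)\to0$ as $|y-x|\to0$, for $x,y\in\Omega$; * for some $Q>2$, $0<|B_{2r}|\le 2^Q|B_r|$ for all $x\in\Omega$, $r>0$; * there are $C_P,\nu>0$ with $\frac1{|B_r|}\int_{B_r}|u-u_r|\,dx\le C_P\,r\,\frac1{|B_{\nu r}|}\int_{B_{\nu r}}|Xu|\,dx$,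 where $u_r=\frac1{|B_r|}\int_{B_r}u\,dx$, for all $x\in\Omega$, $r>0$ and all $u\in C^1(\mathbb R^N)$. Let $A$ be a bounded measurable function on $\Omega$ with values in the real $m\times m$ matrices (not necessarily symmetric) such that, for some $0<\alpha<\beta$, $\alpha|\eta|^2\le A(x)\eta\cdot\eta\le\beta|\eta|^2$ for almost every $x\in\Omega$ and all $\eta\in\mathbb R^m$. For $1\le p\le 2$, $u\in W^{1,p}_0(\Omega,X)$ with $X$-gradient $Xu$ means that $u,Xu\in L^p(\Omega)$ and there are $\varphi_k\in C_c^\infty(\Omega)$ with $\varphi_k\to u$ and $X\varphi_k\to Xu$ in $L^p(\Omega)$. Consider $$X^*(A(x)Xu)=f\ \text{ in }\Omega,\qquad u=0\ \text{ on }\partial\Omega.\tag{P}$$ For $f\in L^{2Q/(Q+2)}(\Omega)$ a *weak solution* of (P) is a $u\in W^{1,2}_0(\Omega,X)$ with $\int_\Omega A\,Xu\cdot Xv=\int_\Omega fv$ for all $v\in W^{1,2}_0(\Omega,X)$. For $f\in L^1(\Omega)$ a *distributional solution* of (P) is a $u\in W^{1,1}_0(\Omega,X)$ with $\int_\Omega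 A\,Xu\cdot X\varphi=\int_\Omega f\varphi$ for all $\varphi\in C^1_c(\Omega)$. An *approximating sequence* for $f\in L^1(\Omega)$ is a sequence $(f_n)$ in $L^{2Q/(Q+2)}(\Omega)$ with $f_n\to f$ in $L^1(\Omega)$. A *solution of (P) found by approximation* is a $w\in L^1(\Omega)$ that is the $L^1(\Omega)$-limit of weak solutions of (P) with data $f_n$, for some approximating sequence $(f_n)$ for $f$. Let $T_n(s)=\max(-n,\min(s,n))$, and let $\|w\|_{M^p(\Omega)}=\sup_{t>0}t\,|\{x\in\Omega:|w(x)|\ge t\}|^{1/p}$. **Theorem.** Let $f\in L^1(\Omega)$. For every datum $g\in L^{2Q/(Q+2)}(\Omega)$, problem (P) has a weak solution, unique up to null sets (together with its $X$-gradient); and $(T_n(f))_n$ is an approximating sequence for $f$. There is a distributional solution $u$ of (P), with $u\in W^{1,q}_0(\Omega,X)$ for all $1\le q<\frac Q{Q-1}$, such that the weak solutions $u_n$ with data $T_n(f)$, and likewise the weak solutions $u_n$ with data $f_n$ for every other approximating sequence $(f_n)$ for $f$, satisfy $$u_n\to u \text{ in } M^{\frac Q{Q-2}}(\Omega)\text{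 and in }L^s(\Omega)\ \bigl(1\le s<\tfrac{Q}{Q-2}\bigr),\qquad Xu_n\to Xu\text{ in }L^q(\Omega)\ \bigl(1\le q<\tfrac Q{Q-1}\bigr).$$ In particular the limit does not depend on the approximating sequence: $u$ is a solution found by approximation, and every solution of (P) found by approximation equals $u$ almost everywhere. -/

import Mathlib

open Set Filter Topology MeasureTheory
open scoped ENNReal ContDiff

noncomputable section

/-- A family of `m` vector fields on `ℝ^N`: `c j x = (c_{j1}(x), …, c_{jN}(x))`. -/
abbrev VFields (m N : ℕ) : Type :=
  Fin m → EuclideanSpace ℝ (Fin N) → EuclideanSpace ℝ (Fin N)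

/-- The `X`-gradient `(X_1 u, …, X_m u)` of a differentiable function,
`X_j u (x) = ∑ k, c_{jk}(x) ∂_k u(x)`. -/
def xGrad {m N : ℕ} (c : VFields m N) (u : EuclideanSpace ℝ (Fin N) → ℝ)
    (x : EuclideanSpace ℝ (Fin N)) : EuclideanSpace ℝ (Fin m) :=
  WithLp.toLp 2 (fun j => fderiv ℝ u x (c j x))

/-! ### Control distance -/

/-- `γ : [0,T] → V` is absolutely continuous and `X`-subunit: for almost every `t`,
`γ'(t) = ∑ j, θ_j(t) X_j(γ(t))` with `∑ j, θ_j(t)^2 ≤ 1`. -/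
def IsSubunit {m N : ℕ} (c : VFields m N) (V : Set (EuclideanSpace ℝ (Fin N))) (T : ℝ)
    (γ : ℝ → EuclideanSpace ℝ (Fin N)) : Prop :=
  (∀ t ∈ Icc 0 T, γ t ∈ V) ∧
  AbsolutelyContinuousOnInterval γ 0 T ∧
  ∀ᵐ t ∂(volume.restrict (Ioo 0 T)), ∃ θ : Fin m → ℝ,
    ∑ j, θ j ^ 2 ≤ 1 ∧ HasDerivAt γ (∑ j, θ j • c j (γ t)) t

/-- Any two points of `Ω` are joined by an `X`-subunit path in `Ω`. -/
def XConnected {m N : ℕ} (c : VFields m N) (Ω : Set (EuclideanSpace ℝ (Fin N))) : Prop :=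
  ∀ x ∈ Ω, ∀ y ∈ Ω, ∃ T > 0, ∃ γ, IsSubunit c Ω T γ ∧ γ 0 = x ∧ γ T = y

/-- The control (Carnot–Carathéodory) distance: the infimum of the times `T > 0` in which an
`X`-subunit path in `ℝ^N` leads from `x` to `y` (`∞` if there is none). -/
def ccDist {m N : ℕ} (c : VFields m N) (x y : EuclideanSpace ℝ (Fin N)) : ℝ≥0∞ :=
  ⨅ (T : ℝ) (_ : 0 < T) (_ : ∃ γ, IsSubunit c univ T γ ∧ γ 0 = x ∧ γ T = y), ENNReal.ofReal T

/-- The balls of the metric space `(Ω, d_X)`. -/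
def ccBall {m N : ℕ} (c : VFields m N) (Ω : Set (EuclideanSpace ℝ (Fin N)))
    (x : EuclideanSpace ℝ (Fin N)) (r : ℝ) : Set (EuclideanSpace ℝ (Fin N)) :=
  {y ∈ Ω | ccDist c x y < ENNReal.ofReal r}

/-- `|y - x| → 0` implies `d_X(x,y) → 0`. -/
def CCContinuous {m N : ℕ} (c : VFields m N) (Ω : Set (EuclideanSpace ℝ (Fin N))) : Prop :=
  ∀ x ∈ Ω, Tendsto (fun y => ccDist c x y) (𝓝[Ω] x) (𝓝 0)

/-- `(Ω, d_X, Lebesgue)` is doubling with constant `2^Q`. -/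
def CCDoubling {m N : ℕ} (c : VFields m N) (Ω : Set (EuclideanSpace ℝ (Fin N)))
    (Q : ℝ) : Prop :=
  ∀ x ∈ Ω, ∀ r : ℝ, 0 < r →
    0 < volume (ccBall c Ω x (2 * r)) ∧
    volume (ccBall c Ω x (2 * r)) ≤ ENNReal.ofReal ((2 : ℝ) ^ Q) * volume (ccBall c Ω x r)

/-- The Poincaré inequality on the `d_X`-balls. -/
def CCPoincare {m N : ℕ} (c : VFields m N) (Ω : Set (EuclideanSpace ℝ (Fin N))) : Prop :=
  ∃ CP > (0 : ℝ), ∃ ν > (0 : ℝ), ∀ x ∈ Ω, ∀ r : ℝ, 0 < r →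
    ∀ u : EuclideanSpace ℝ (Fin N) → ℝ, ContDiff ℝ 1 u →
      ⨍ y in ccBall c Ω x r, |u y - ⨍ z in ccBall c Ω x r, u z|
        ≤ CP * r * ⨍ y in ccBall c Ω x (ν * r), ‖xGrad c u y‖

/-! ### The coefficient matrix -/

/-- `A(x) η · ξ`. -/
def aForm {m N : ℕ} (A : EuclideanSpace ℝ (Fin N) → Matrix (Fin m) (Fin m) ℝ)
    (x : EuclideanSpace ℝ (Fin N)) (η ξ : EuclideanSpace ℝ (Fin m)) : ℝ :=
  ∑ i, (∑ j, A x i j * η j) * ξ i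

/-- `A` is measurable and bounded on `Ω`, and
`α |η|^2 ≤ A(x) η · η ≤ β |η|^2` for almost every `x ∈ Ω` and all `η`. -/
structure IsElliptic {m N : ℕ} (Ω : Set (EuclideanSpace ℝ (Fin N))) (α β : ℝ)
    (A : EuclideanSpace ℝ (Fin N) → Matrix (Fin m) (Fin m) ℝ) : Prop where
  measurable : ∀ i j, AEMeasurable (fun x => A x i j) (volume.restrict Ω)
  bounded : ∃ M : ℝ, ∀ᵐ x ∂(volume.restrict Ω), ∀ i j, |A x i j| ≤ M
  elliptic : ∀ᵐ x ∂(volume.restrict Ω), ∀ η : EuclideanSpace ℝ (Fin m),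
    α * ‖η‖ ^ 2 ≤ aForm A x η η ∧ aForm A x η η ≤ β * ‖η‖ ^ 2

/-! ### Sobolev spaces and solutions -/

/-- `φ ∈ C^k_c(Ω)`. -/
def IsTest {N : ℕ} (k : ℕ∞) (Ω : Set (EuclideanSpace ℝ (Fin N)))
    (φ : EuclideanSpace ℝ (Fin N) → ℝ) : Prop :=
  ContDiff ℝ k φ ∧ HasCompactSupport φ ∧ tsupport φ ⊆ Ω

/-- `u ∈ W^{1,p}_0(Ω,X)` with `X`-gradient `Xu = G`: there are `φ_k ∈ C^∞_c(Ω)` with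
`φ_k → u` and `Xφ_k → G` in `L^p(Ω)`. -/
def MemW0 {m N : ℕ} (c : VFields m N) (Ω : Set (EuclideanSpace ℝ (Fin N))) (p : ℝ≥0∞)
    (u : EuclideanSpace ℝ (Fin N) → ℝ)
    (G : EuclideanSpace ℝ (Fin N) → EuclideanSpace ℝ (Fin m)) : Prop :=
  MemLp u p (volume.restrict Ω) ∧ MemLp G p (volume.restrict Ω) ∧
  ∃ φ : ℕ → EuclideanSpace ℝ (Fin N) → ℝ, (∀ k, IsTest ⊤ Ω (φ k)) ∧
    Tendsto (fun k => eLpNorm (fun x => φ k x - u x) p (volume.restrict Ω)) atTop (𝓝 0) ∧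
    Tendsto (fun k => eLpNorm (fun x => xGrad c (φ k) x - G x) p (volume.restrict Ω))
      atTop (𝓝 0)

/-- `u`, with `Xu = G`, is a weak solution of `X^*(A Xu) = g` in `Ω`, `u = 0` on `∂Ω`. -/
def IsWeakSol {m N : ℕ} (c : VFields m N) (Ω : Set (EuclideanSpace ℝ (Fin N)))
    (A : EuclideanSpace ℝ (Fin N) → Matrix (Fin m) (Fin m) ℝ)
    (g u : EuclideanSpace ℝ (Fin N) → ℝ)
    (G : EuclideanSpace ℝ (Fin N) → EuclideanSpace ℝ (Fin m)) : Prop :=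
  MemW0 c Ω 2 u G ∧ ∀ v H, MemW0 c Ω 2 v H →
    IntegrableOn (fun x => aForm A x (G x) (H x)) Ω ∧
    IntegrableOn (fun x => g x * v x) Ω ∧
    ∫ x in Ω, aForm A x (G x) (H x) = ∫ x in Ω, g x * v x

/-- `u`, with `Xu = G`, is a distributional solution of `X^*(A Xu) = f` in `Ω`,
`u = 0` on `∂Ω`. -/
def IsDistribSol {m N : ℕ} (c : VFields m N) (Ω : Set (EuclideanSpace ℝ (Fin N)))
    (A : EuclideanSpace ℝ (Fin N) → Matrix (Fin m) (Fin m) ℝ)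
    (f u : EuclideanSpace ℝ (Fin N) → ℝ)
    (G : EuclideanSpace ℝ (Fin N) → EuclideanSpace ℝ (Fin m)) : Prop :=
  MemW0 c Ω 1 u G ∧ ∀ φ, IsTest 1 Ω φ →
    IntegrableOn (fun x => aForm A x (G x) (xGrad c φ x)) Ω ∧
    IntegrableOn (fun x => f x * φ x) Ω ∧
    ∫ x in Ω, aForm A x (G x) (xGrad c φ x) = ∫ x in Ω, f x * φ x

/-! ### Approximation -/

/-- The truncation `T_k` at height `k`. -/
def trunc (k s : ℝ) : ℝ := max (-k) (min s k)

/-- `g_n ∈ L^{2Q/(Q+2)}(Ω)` and `g_n → f` in `L^1(Ω)`. -/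
def IsApproxSeq {N : ℕ} (Ω : Set (EuclideanSpace ℝ (Fin N))) (Q : ℝ)
    (f : EuclideanSpace ℝ (Fin N) → ℝ) (g : ℕ → EuclideanSpace ℝ (Fin N) → ℝ) : Prop :=
  (∀ n, MemLp (g n) (ENNReal.ofReal (2 * Q / (Q + 2))) (volume.restrict Ω)) ∧
  Tendsto (fun n => eLpNorm (fun x => g n x - f x) 1 (volume.restrict Ω)) atTop (𝓝 0)

/-- The Marcinkiewicz norm: the `p`-th root of the least `C` with
`|{x ∈ Ω : |u x| ≥ t}| ≤ C / t^p` for all `t > 0`. -/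
def marNorm {N : ℕ} (Ω : Set (EuclideanSpace ℝ (Fin N))) (p : ℝ)
    (u : EuclideanSpace ℝ (Fin N) → ℝ) : ℝ≥0∞ :=
  ⨆ (t : ℝ) (_ : 0 < t), ENNReal.ofReal t * (volume.restrict Ω {x | t ≤ |u x|}) ^ (1 / p)

/-- `v_n → u` in the Marcinkiewicz space of exponent `Q/(Q-2)` and in `L^s(Ω)` for
`1 ≤ s < Q/(Q-2)`, and `Xv_n → Xu` in `L^q(Ω)` for `1 ≤ q < Q/(Q-1)`, where `Xv_n = V_n` and
`Xu = G`. -/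
structure ApproxConv {m N : ℕ} (Ω : Set (EuclideanSpace ℝ (Fin N))) (Q : ℝ)
    (v : ℕ → EuclideanSpace ℝ (Fin N) → ℝ)
    (V : ℕ → EuclideanSpace ℝ (Fin N) → EuclideanSpace ℝ (Fin m))
    (u : EuclideanSpace ℝ (Fin N) → ℝ)
    (G : EuclideanSpace ℝ (Fin N) → EuclideanSpace ℝ (Fin m)) : Prop where
  mar : Tendsto (fun n => marNorm Ω (Q / (Q - 2)) (fun x => v n x - u x)) atTop (𝓝 0)
  lebesgue : ∀ s : ℝ, 1 ≤ s → s < Q / (Q - 2) →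
    Tendsto (fun n => eLpNorm (fun x => v n x - u x) (ENNReal.ofReal s) (volume.restrict Ω))
      atTop (𝓝 0)
  gradient : ∀ q : ℝ, 1 ≤ q → q < Q / (Q - 1) →
    Tendsto (fun n => eLpNorm (fun x => V n x - G x) (ENNReal.ofReal q) (volume.restrict Ω))
      atTop (𝓝 0)

/-- `w` is a solution found by approximation: the `L^1(Ω)`-limit of weak solutions whose data
lie in `L^{2Q/(Q+2)}(Ω)` and converge to `f` in `L^1(Ω)`. -/
def IsSolByApprox {m N : ℕ} (c : VFields m N) (Ω : Set (EuclideanSpace ℝ (Fin N))) (Q : ℝ)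
    (A : EuclideanSpace ℝ (Fin N) → Matrix (Fin m) (Fin m) ℝ)
    (f w : EuclideanSpace ℝ (Fin N) → ℝ) : Prop :=
  ∃ (g v : ℕ → EuclideanSpace ℝ (Fin N) → ℝ)
    (V : ℕ → EuclideanSpace ℝ (Fin N) → EuclideanSpace ℝ (Fin m)),
    IsApproxSeq Ω Q f g ∧ (∀ n, IsWeakSol c Ω A (g n) (v n) (V n)) ∧
    MemLp w 1 (volume.restrict Ω) ∧
    Tendsto (fun n => eLpNorm (fun x => v n x - w x) 1 (volume.restrict Ω)) atTop (𝓝 0)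

end

noncomputable section

section
/-! ### Absolutely continuous paths -/

/-! The problem is linear, so the theorem reduces to one a priori estimate. Let `v` be a weak
solution with datum `g`. Testing the equation with a bounded increasing function of `v` of height
about `k` bounds the energy of `v` below the level `k` by a multiple of `k ‖g‖₁ / α`. Through the
Sobolev inequality with exponent `2Q/(Q-2)` and Chebyshev's inequality this becomes a weak-type
bound of exponent `Q/(Q-2)` for `v`; splitting at the best level `k` then gives one of exponent
`Q/(Q-1)` for `Xv`. In both, the constant is linear in `‖g‖₁` (`exists_weak_type_bounds`). The
truncation used is `k arctan (s/k)`, so that the chain rule is needed for smooth functions only.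

The difference of two weak solutions solves the problem with the difference of the data. Hence data
that converge in `L¹` have solutions that form a Cauchy sequence, and two approximating sequences
lead to the same limit (`exists_approxConv`). On a set of finite measure the weak-type bounds give
strong bounds for every smaller exponent. Weak solutions exist by Lax–Milgram, and the equation
passes to the limit because a fixed `C¹_c` test function is bounded together with its `X`-gradient.

The harder half is the Sobolev inequality for test functions (`exists_sobolev`). Doubling makes `Ω`
itself a control ball and bounds the volume of balls below by a multiple of `r^Q`. Telescoping the
Poincaré inequality down to a point, Hedberg's splitting and the `L²` maximal theorem control a
function minus its mean.

The mean of a test function remains to be bounded by `∫ |Xφ|` (`CCPoincare.exists_abs_mean_le`),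
without any regularity of `∂Ω`. If this fails, some test functions tend to `1` in `L¹(Ω)` while
their `X`-gradients tend to `0`; integration by parts then shows that no `X_j` has flux out of `Ω`,
even after multiplication by a Lipschitz weight. Consider the potential of the complement of `Ω` in
a large ball, for the kernel `(ε² + |z|²)^{-N}`. The missing flux bounds its `X`-gradient by a
multiple of the potential itself, uniformly in `ε`. So the logarithm of the potential has bounded
oscillation on `Ω`, and the potential stays bounded on the closure of `Ω` as `ε → 0`. But at a
boundary point that is extremal in some direction the complement contains touching balls of radius
`ε`, and there the potential grows like `ε^{-N}` (`not_tendsto_one_of_isTest`). -/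

theorem disjoint_uIoc_iff (a b c d : ℝ) :
    Disjoint (uIoc a b) (uIoc c d) ↔
      min (max a b) (max c d) ≤ max (min a b) (min c d) := by
  simp only [uIoc, Ioc_disjoint_Ioc]

/-- A family of intervals for the composition is tested through its image under `g`. A monotone or
antitone map preserves the min-max inequality that expresses disjointness in `disjoint_uIoc_iff`,
and a 1-Lipschitz map does not increase total length. -/
theorem AbsolutelyContinuousOnInterval.comp_of_lipschitz {X : Type*} [PseudoMetricSpace X]
    {f : ℝ → X} {g : ℝ → ℝ} {a b c d : ℝ} (hf : AbsolutelyContinuousOnInterval f a b)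
    (hg : LipschitzWith 1 g) (hm : Monotone g ∨ Antitone g)
    (hmaps : MapsTo g (uIcc c d) (uIcc a b)) :
    AbsolutelyContinuousOnInterval (fun t => f (g t)) c d := by
  rw [absolutelyContinuousOnInterval_iff] at hf ⊢
  intro ε hε
  obtain ⟨δ, hδ, H⟩ := hf ε hε
  refine ⟨δ, hδ, fun E hE hEδ => ?_⟩
  refine H (E.1, fun i => (g (E.2 i).1, g (E.2 i).2)) ⟨fun i hi => ?_, ?_⟩ ?_
  · exact ⟨hmaps (hE.1 i hi).1, hmaps (hE.1 i hi).2⟩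
  · intro i hi j hj hij
    have := hE.2 hi hj hij
    simp only [Function.onFun, disjoint_uIoc_iff] at this ⊢
    rcases hm with hm | hm
    · rw [← hm.map_max, ← hm.map_max, ← hm.map_min, ← hm.map_min, ← hm.map_min, ← hm.map_max]
      exact hm this
    · rw [← hm.map_min, ← hm.map_min, ← hm.map_max, ← hm.map_max, ← hm.map_max, ← hm.map_min]
      exact hm this
  · refine lt_of_le_of_lt (Finset.sum_le_sum fun i _ => ?_) hEδ
    simpa using hg.dist_le_mul (E.2 i).1 (E.2 i).2

theorem AbsolutelyContinuousOnInterval.inner_const {F : Type*} [NormedAddCommGroup F]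
    [InnerProductSpace ℝ F] {f : ℝ → F} {a b : ℝ} (e : F)
    (hf : AbsolutelyContinuousOnInterval f a b) :
    AbsolutelyContinuousOnInterval (fun t => inner ℝ e (f t)) a b := by
  apply squeeze_zero (fun t ↦ ?_) (fun t ↦ ?_) (by simpa using Filter.Tendsto.const_mul ‖e‖ hf)
  · exact Finset.sum_nonneg (fun i hi ↦ by positivity)
  · rw [Finset.mul_sum]
    refine Finset.sum_le_sum fun i _ => ?_
    rw [Real.dist_eq, ← inner_sub_right, dist_eq_norm]
    exact abs_real_inner_le_norm _ _

/-- Pairing with the fixed vector `e = f T - f 0` reduces the bound to the fundamental theorem of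
calculus for a scalar function: `‖e‖²` is the integral of a derivative of size at most `‖e‖ M`. -/
theorem AbsolutelyContinuousOnInterval.norm_sub_le {F : Type*} [NormedAddCommGroup F]
    [InnerProductSpace ℝ F] {f : ℝ → F} {T M : ℝ} (hT : 0 ≤ T)
    (hf : AbsolutelyContinuousOnInterval f 0 T)
    (hd : ∀ᵐ t ∂(volume : Measure ℝ), t ∈ Ioo 0 T → ∃ w, ‖w‖ ≤ M ∧ HasDerivAt f w t) :
    ‖f T - f 0‖ ≤ M * T := by
  set e := f T - f 0 with he
  have h1 := (hf.inner_const e).integral_deriv_eq_sub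
  rw [← inner_sub_right, ← he, real_inner_self_eq_norm_sq] at h1
  have hne : ∀ᵐ t ∂(volume : Measure ℝ), t ≠ T := by
    simp [ae_iff, measure_singleton]
  have h2 : ‖∫ t in (0:ℝ)..T, deriv (fun t => inner ℝ e (f t)) t‖ ≤ ‖e‖ * M * |T - 0| := by
    apply intervalIntegral.norm_integral_le_of_norm_le_const_ae
    filter_upwards [hd, hne] with t ht htT htI
    rw [uIoc_of_le hT] at htI
    obtain ⟨w, hw, hder⟩ := ht ⟨htI.1, lt_of_le_of_ne htI.2 htT⟩
    have : HasDerivAt (fun t => inner ℝ e (f t)) (inner ℝ e w) t := by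
      have := (hasDerivAt_const t e).inner ℝ hder
      simpa using this
    rw [this.deriv]
    exact (norm_inner_le_norm _ _).trans (by gcongr)
  rw [h1, sub_zero, abs_of_nonneg hT, Real.norm_of_nonneg (sq_nonneg _)] at h2
  -- If `e = 0`, what remains is `0 ≤ M T`. A negative `M` would leave no point of `(0, T)` with a
  -- derivative of norm at most `M`, whereas almost every point has one.
  rcases (norm_nonneg e).eq_or_lt with h0 | h0
  · rw [← h0]
    by_contra hcon
    push Not at hcon
    have hTpos : 0 < T := by
      rcases hT.eq_or_lt with h | h
      · rw [← h] at hcon; simp at hcon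
      · exact h
    have hM : M < 0 := by
      by_contra hM; push Not at hM
      have := mul_nonneg hM hT; linarith
    have : ∀ᵐ t ∂(volume : Measure ℝ), t ∉ Ioo 0 T := by
      filter_upwards [hd] with t ht htI
      obtain ⟨w, hw, -⟩ := ht htI
      linarith [norm_nonneg w]
    rw [ae_iff] at this
    simp only [not_not] at this
    have h3 : volume (Ioo (0:ℝ) T) = 0 := this
    simp at h3; linarith
  · nlinarith

/-! ### Subunit paths and the control distance -/

variable {m N : ℕ} {c : VFields m N} {Ω V : Set (EuclideanSpace ℝ (Fin N))}

theorem IsSubunit.reverse {T : ℝ} {γ : ℝ → EuclideanSpace ℝ (Fin N)} (hT : 0 < T)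
    (h : IsSubunit c V T γ) : IsSubunit c V T (fun t => γ (T - t)) := by
  obtain ⟨h1, h2, h3⟩ := h
  have hmaps : MapsTo (fun t : ℝ => T - t) (Icc 0 T) (Icc 0 T) := fun t ht =>
    ⟨by linarith [ht.2], by linarith [ht.1]⟩
  refine ⟨fun t ht => h1 _ (hmaps ht), ?_, ?_⟩
  · apply h2.comp_of_lipschitz (g := fun t => T - t)
    · refine LipschitzWith.of_dist_le_mul fun x y => ?_
      rw [Real.dist_eq, Real.dist_eq, show T - x - (T - y) = -(x - y) by ring, abs_neg]
      simp
    · right; intro a b hab; exact sub_le_sub_left hab T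
    · rwa [uIcc_of_le hT.le]
  · rw [ae_restrict_iff' measurableSet_Ioo] at h3 ⊢
    have := (Measure.measurePreserving_sub_left (volume : Measure ℝ) T).quasiMeasurePreserving.ae h3
    filter_upwards [this] with t ht htI
    obtain ⟨θ, hθ, hd⟩ := ht ⟨by linarith [htI.2], by linarith [htI.1]⟩
    refine ⟨fun j => -θ j, by simpa using hθ, ?_⟩
    have := hd.scomp t ((hasDerivAt_id t).const_sub T)
    simpa [Function.comp_def, Finset.sum_neg_distrib] using this

theorem IsSubunit.concat {S T : ℝ} {γ η : ℝ → EuclideanSpace ℝ (Fin N)} (hS : 0 < S) (hT : 0 < T)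
    (hγ : IsSubunit c V S γ) (hη : IsSubunit c V T η) (hj : γ S = η 0) :
    ∃ ζ, IsSubunit c V (S + T) ζ ∧ ζ 0 = γ 0 ∧ ζ (S + T) = η T := by
  obtain ⟨h1, h2, h3⟩ := hγ
  obtain ⟨k1, k2, k3⟩ := hη
  -- Each path is frozen outside its own time interval. The concatenation becomes a sum of functions
  -- that are absolutely continuous on the whole interval, so nothing has to be glued.
  set ζ : ℝ → EuclideanSpace ℝ (Fin N) := fun t => γ (min t S) + (η (max (t - S) 0) - η 0) with hζ
  have e1 : ∀ t ≤ S, ζ t = γ t := fun t ht => by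
    simp [hζ, min_eq_left ht, max_eq_right (sub_nonpos.2 ht)]
  have e2 : ∀ t, S ≤ t → ζ t = η (t - S) := fun t ht => by
    simp [hζ, min_eq_right ht, max_eq_left (sub_nonneg.2 ht), hj]
  refine ⟨ζ, ⟨fun t ht => ?_, ?_, ?_⟩, e1 0 hS.le, by rw [e2 _ (by linarith)]; simp⟩
  · rcases le_total t S with h | h
    · rw [e1 t h]; exact h1 t ⟨ht.1, h⟩
    · rw [e2 t h]; exact k1 _ ⟨by linarith, by linarith [ht.2]⟩
  · have a1 : AbsolutelyContinuousOnInterval (fun t => γ (min t S)) 0 (S + T) := by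
      apply h2.comp_of_lipschitz (g := fun t => min t S)
      · exact LipschitzWith.id.min_const S
      · left; intro a b hab; exact min_le_min_right _ hab
      · rw [uIcc_of_le hS.le, uIcc_of_le (by linarith)]
        exact fun t ht => ⟨le_min ht.1 hS.le, min_le_right _ _⟩
    have a2 : AbsolutelyContinuousOnInterval (fun t => η (max (t - S) 0)) 0 (S + T) := by
      apply k2.comp_of_lipschitz (g := fun t => max (t - S) 0)
      · refine LipschitzWith.max_const ?_ 0
        refine LipschitzWith.of_dist_le_mul fun x y => ?_
        simp [Real.dist_eq]
      · left; intro a b hab; exact max_le_max_right _ (by linarith)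
      · rw [uIcc_of_le hT.le, uIcc_of_le (by linarith)]
        exact fun t ht => ⟨le_max_right _ _, max_le (by linarith [ht.2]) hT.le⟩
    have a3 : AbsolutelyContinuousOnInterval (fun _ : ℝ => η 0) 0 (S + T) :=
      ((LipschitzWith.const (η 0)).lipschitzOnWith (s := uIcc 0 (S + T))).absolutelyContinuousOnInterval
    exact a1.add (a2.sub a3)
  · rw [ae_restrict_iff' measurableSet_Ioo] at h3 k3 ⊢
    have k4 := (measurePreserving_sub_right (volume : Measure ℝ) S).quasiMeasurePreserving.ae k3
    have hne : ∀ᵐ t ∂(volume : Measure ℝ), t ≠ S := by simp [ae_iff, measure_singleton]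
    filter_upwards [h3, k4, hne] with t ht1 ht2 htS htI
    rcases lt_or_gt_of_ne htS with h | h
    · obtain ⟨θ, hθ, hd⟩ := ht1 ⟨htI.1, h⟩
      refine ⟨θ, hθ, ?_⟩
      rw [e1 t h.le]
      refine hd.congr_of_eventuallyEq ?_
      filter_upwards [Iio_mem_nhds h] with s hs using e1 s (le_of_lt hs)
    · obtain ⟨θ, hθ, hd⟩ := ht2 ⟨by linarith, by linarith [htI.2]⟩
      refine ⟨θ, hθ, ?_⟩
      rw [e2 t h.le]
      have := hd.scomp t ((hasDerivAt_id t).sub_const S)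
      rw [one_smul] at this
      refine this.congr_of_eventuallyEq ?_
      filter_upwards [Ioi_mem_nhds h] with s hs using e2 s (le_of_lt hs)

theorem ccDist_lt_iff {x y : EuclideanSpace ℝ (Fin N)} {r : ℝ≥0∞} :
    ccDist c x y < r ↔ ∃ T : ℝ, 0 < T ∧ ENNReal.ofReal T < r ∧
      ∃ γ, IsSubunit c univ T γ ∧ γ 0 = x ∧ γ T = y := by
  simp only [ccDist, iInf_lt_iff]
  constructor
  · rintro ⟨T, hT, h, h'⟩; exact ⟨T, hT, h', h⟩
  · rintro ⟨T, hT, h', h⟩; exact ⟨T, hT, h, h'⟩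

theorem ccDist_comm (x y : EuclideanSpace ℝ (Fin N)) : ccDist c x y = ccDist c y x := by
  have key : ∀ x y : EuclideanSpace ℝ (Fin N), ccDist c x y ≤ ccDist c y x := by
    intro x y
    refine le_of_forall_gt fun r hr => ?_
    obtain ⟨T, hT, hTr, γ, hγ, h0, h1⟩ := ccDist_lt_iff.1 hr
    exact ccDist_lt_iff.2 ⟨T, hT, hTr, _, hγ.reverse hT, by simpa using h1, by simpa using h0⟩
  exact le_antisymm (key x y) (key y x)

theorem ccDist_triangle (x y z : EuclideanSpace ℝ (Fin N)) :
    ccDist c x z ≤ ccDist c x y + ccDist c y z := by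
  rcases eq_or_ne (ccDist c x y) ⊤ with h | hxy
  · simp [h]
  rcases eq_or_ne (ccDist c y z) ⊤ with h | hyz
  · simp [h]
  refine ENNReal.le_of_forall_pos_le_add fun ε hε _ => ?_
  have hε2 : (ε / 2 : ℝ≥0∞) ≠ 0 := by simpa using hε.ne'
  obtain ⟨S, hS, hSr, γ, hγ, h0, h1⟩ := ccDist_lt_iff.1 (ENNReal.lt_add_right hxy hε2)
  obtain ⟨T, hT, hTr, η, hη, k0, k1⟩ := ccDist_lt_iff.1 (ENNReal.lt_add_right hyz hε2)
  obtain ⟨ζ, hζ, z0, z1⟩ := hγ.concat hS hT hη (h1.trans k0.symm)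
  have : ccDist c x z ≤ ENNReal.ofReal (S + T) :=
    iInf_le_of_le (S + T) (iInf_le_of_le (by linarith)
      (iInf_le _ ⟨ζ, hζ, z0.trans h0, z1.trans k1⟩))
  refine this.trans ?_
  rw [ENNReal.ofReal_add hS.le hT.le]
  calc _ ≤ (ccDist c x y + ε / 2) + (ccDist c y z + ε / 2) := add_le_add hSr.le hTr.le
    _ = ccDist c x y + ccDist c y z + (ε / 2 + ε / 2) := by ring
    _ = _ := by rw [ENNReal.add_halves]

theorem ccDist_ne_top (hconn : XConnected c Ω) {x y : EuclideanSpace ℝ (Fin N)} (hx : x ∈ Ω)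
    (hy : y ∈ Ω) : ccDist c x y ≠ ⊤ := by
  obtain ⟨T, hT, γ, ⟨-, h2, h3⟩, h0, h1⟩ := hconn x hx y hy
  refine ne_top_of_le_ne_top (ENNReal.ofReal_ne_top (r := T)) ?_
  exact iInf_le_of_le T (iInf_le_of_le hT (iInf_le _ ⟨γ, ⟨fun _ _ => mem_univ _, h2, h3⟩, h0, h1⟩))

/-- The point `x` belongs to `Ω`, so the limit within `Ω` at `x` also constrains the value at `x`
itself. -/
theorem ccDist_self (hcont : CCContinuous c Ω) {x : EuclideanSpace ℝ (Fin N)} (hx : x ∈ Ω) :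
    ccDist c x x = 0 :=
  tendsto_nhds_unique (tendsto_pure_nhds _ x) ((hcont x hx).mono_left (pure_le_nhdsWithin hx))

theorem mem_ccBall_self (hcont : CCContinuous c Ω) {x : EuclideanSpace ℝ (Fin N)} (hx : x ∈ Ω)
    {r : ℝ} (hr : 0 < r) : x ∈ ccBall c Ω x r :=
  ⟨hx, by rw [ccDist_self hcont hx]; simpa using hr⟩

theorem ccBall_subset {x : EuclideanSpace ℝ (Fin N)} {r : ℝ} : ccBall c Ω x r ⊆ Ω :=
  fun _ h => h.1

theorem ccBall_mono {x : EuclideanSpace ℝ (Fin N)} {r s : ℝ} (h : r ≤ s) :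
    ccBall c Ω x r ⊆ ccBall c Ω x s :=
  fun _ hy => ⟨hy.1, hy.2.trans_le (ENNReal.ofReal_le_ofReal h)⟩

theorem mem_ccBall_comm {x y : EuclideanSpace ℝ (Fin N)} {r : ℝ} (hx : x ∈ Ω)
    (hy : y ∈ ccBall c Ω x r) : x ∈ ccBall c Ω y r :=
  ⟨hx, by rw [ccDist_comm]; exact hy.2⟩

theorem mem_ccBall_trans {x y z : EuclideanSpace ℝ (Fin N)} {r s : ℝ} (hr : 0 ≤ r) (hs : 0 ≤ s)
    (hy : y ∈ ccBall c Ω x r) (hz : z ∈ ccBall c Ω y s) : z ∈ ccBall c Ω x (r + s) :=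
  ⟨hz.1, (ccDist_triangle x y z).trans_lt (by
    rw [ENNReal.ofReal_add hr hs]; exact ENNReal.add_lt_add hy.2 hz.2)⟩

theorem isOpen_ccBall (hΩ : IsOpen Ω) (hcont : CCContinuous c Ω) (x : EuclideanSpace ℝ (Fin N))
    (r : ℝ) : IsOpen (ccBall c Ω x r) := by
  rw [isOpen_iff_mem_nhds]
  intro y hy
  have h1 := hcont y hy.1
  rw [hΩ.nhdsWithin_eq hy.1] at h1
  have hpos : 0 < ENNReal.ofReal r - ccDist c x y := tsub_pos_of_lt hy.2
  filter_upwards [h1 (gt_mem_nhds hpos), hΩ.mem_nhds hy.1] with z hz hzΩ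
  refine ⟨hzΩ, (ccDist_triangle x y z).trans_lt ?_⟩
  rw [add_comm]
  exact lt_tsub_iff_right.1 hz

/-- While a subunit path stays in the closed Euclidean ball of radius `ε`, its speed is at most the
bound `M` of `∑ ‖c j‖` there, so leaving the ball takes time at least `ε / (M + 1)`. This is the
converse of `CCContinuous`, and it makes averages over shrinking control balls converge to point
values. -/
theorem exists_ccDist_lt_imp_dist_lt (hc : ∀ j, Continuous (c j)) (x : EuclideanSpace ℝ (Fin N))
    {ε : ℝ} (hε : 0 < ε) :
    ∃ r > 0, ∀ y, ccDist c x y < ENNReal.ofReal r → dist y x < ε := by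
  have hcont : Continuous fun y => ∑ j, ‖c j y‖ :=
    continuous_finsetSum _ fun j _ => (hc j).norm
  obtain ⟨M, hM⟩ := (isCompact_closedBall x ε).exists_bound_of_continuousOn hcont.continuousOn
  have hM0 : 0 ≤ M := (norm_nonneg _).trans (hM x (Metric.mem_closedBall_self hε.le))
  refine ⟨ε / (M + 1), by positivity, fun y hy => ?_⟩
  obtain ⟨T, hT, hTr, γ, ⟨-, h2, h3⟩, h0, h1⟩ := ccDist_lt_iff.1 hy
  have hTr' : T < ε / (M + 1) := (ENNReal.ofReal_lt_ofReal_iff (by positivity)).1 hTr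
  by_contra hcon
  push Not at hcon
  have hγc : ContinuousOn γ (Icc 0 T) := by
    simpa [uIcc_of_le hT.le] using h2.continuousOn
  have hS : IsCompact (Icc 0 T ∩ (fun t => dist (γ t) x) ⁻¹' (Ici ε)) := by
    refine isCompact_Icc.of_isClosed_subset ?_ inter_subset_left
    exact ((continuous_id.dist (continuous_const (y := x))).comp_continuousOn
      hγc).preimage_isClosed_of_isClosed isClosed_Icc isClosed_Ici
  -- `t₀` is the first time at distance at least `ε`; before it the speed bound `M` is available.
  obtain ⟨t₀, ⟨ht₀, ht₀'⟩, hmin⟩ := hS.exists_isLeast ⟨T, ⟨hT.le, le_rfl⟩, by simpa [h1] using hcon⟩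
  have hlt : ∀ t ∈ Ioo 0 t₀, γ t ∈ Metric.closedBall x ε := by
    intro t ht
    by_contra hne
    have : t₀ ≤ t := hmin ⟨⟨ht.1.le, ht.2.le.trans ht₀.2⟩, by
      simp only [Metric.mem_closedBall, not_le] at hne
      exact hne.le⟩
    linarith [ht.2]
  have := (h2.mono (c := 0) (d := t₀) (by
    rw [uIcc_of_le ht₀.1, uIcc_of_le hT.le]; exact Icc_subset_Icc_right ht₀.2)).norm_sub_le
    (M := M) ht₀.1 (by
      rw [ae_restrict_iff' measurableSet_Ioo] at h3
      filter_upwards [h3] with t ht htI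
      obtain ⟨θ, hθ, hd⟩ := ht ⟨htI.1, htI.2.trans_le ht₀.2⟩
      refine ⟨_, ?_, hd⟩
      refine (norm_sum_le _ _).trans (le_trans ?_ ((le_abs_self _).trans (hM _ (hlt t htI))))
      refine Finset.sum_le_sum fun j _ => ?_
      rw [norm_smul]
      refine mul_le_of_le_one_left (norm_nonneg _) ?_
      rw [Real.norm_eq_abs, ← sq_le_one_iff_abs_le_one]
      exact (Finset.single_le_sum (fun i _ => sq_nonneg (θ i)) (Finset.mem_univ j)).trans hθ)
  rw [h0, ← dist_eq_norm] at this
  have h5 : ε ≤ dist (γ t₀) x := ht₀'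
  have h6 : M * t₀ ≤ M * T := by gcongr; exact ht₀.2
  rw [lt_div_iff₀ (by positivity)] at hTr'
  nlinarith

end

section
variable {m N : ℕ} {c : VFields m N} {Ω : Set (EuclideanSpace ℝ (Fin N))} {Q : ℝ}

/-! ### Doubling -/

theorem Continuous.integrableOn_of_isBounded {F : Type*} [NormedAddCommGroup F]
    {f : EuclideanSpace ℝ (Fin N) → F} (hf : Continuous f)
    {s : Set (EuclideanSpace ℝ (Fin N))} (hs : Bornology.IsBounded s) : IntegrableOn f s :=
  (hf.continuousOn.integrableOn_compact hs.isCompact_closure).mono_set subset_closure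

theorem continuous_xGrad (hc : ∀ j, Continuous (c j)) {u : EuclideanSpace ℝ (Fin N) → ℝ}
    (hu : ContDiff ℝ 1 u) : Continuous (xGrad c u) := by
  refine (PiLp.continuous_toLp 2 _).comp (continuous_pi fun j => ?_)
  exact (hu.continuous_fderiv one_ne_zero).clm_apply (hc j)

theorem volume_ccBall_ne_top (hΩb : Bornology.IsBounded Ω) (x : EuclideanSpace ℝ (Fin N)) (r : ℝ) :
    volume (ccBall c Ω x r) ≠ ⊤ :=
  ((measure_mono ccBall_subset).trans_lt hΩb.measure_lt_top).ne

theorem CCDoubling.volume_pos (hd : CCDoubling c Ω Q) {x : EuclideanSpace ℝ (Fin N)} (hx : x ∈ Ω)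
    {r : ℝ} (hr : 0 < r) : 0 < volume (ccBall c Ω x r) := by
  have := (hd x hx (r / 2) (by positivity)).1
  rwa [mul_div_cancel₀ _ (two_ne_zero)] at this

theorem CCDoubling.real_pos (hd : CCDoubling c Ω Q) (hΩb : Bornology.IsBounded Ω)
    {x : EuclideanSpace ℝ (Fin N)} (hx : x ∈ Ω)
    {r : ℝ} (hr : 0 < r) : 0 < volume.real (ccBall c Ω x r) :=
  ENNReal.toReal_pos (hd.volume_pos hx hr).ne' (volume_ccBall_ne_top hΩb x r)

theorem CCDoubling.real_le (hd : CCDoubling c Ω Q) (hΩb : Bornology.IsBounded Ω)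
    {x : EuclideanSpace ℝ (Fin N)} (hx : x ∈ Ω) {r : ℝ} (hr : 0 < r) :
    volume.real (ccBall c Ω x (2 * r)) ≤ 2 ^ Q * volume.real (ccBall c Ω x r) := by
  have := ENNReal.toReal_mono
    (ENNReal.mul_ne_top ENNReal.ofReal_ne_top (volume_ccBall_ne_top hΩb x r)) (hd x hx r hr).2
  rwa [ENNReal.toReal_mul, ENNReal.toReal_ofReal (by positivity)] at this

theorem CCDoubling.real_pow_le (hd : CCDoubling c Ω Q) (hΩb : Bornology.IsBounded Ω)
    {x : EuclideanSpace ℝ (Fin N)} (hx : x ∈ Ω) {r : ℝ} (hr : 0 < r) (k : ℕ) :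
    volume.real (ccBall c Ω x (2 ^ k * r)) ≤ (2 ^ Q) ^ k * volume.real (ccBall c Ω x r) := by
  induction k with
  | zero => simp
  | succ k ih =>
    rw [pow_succ', mul_assoc, pow_succ' ((2 : ℝ) ^ Q), mul_assoc]
    refine (hd.real_le hΩb hx (by positivity)).trans ?_
    gcongr

/-- Finite volume and doubling force a finite diameter. A ball around `x₀` that carries almost all
of the volume of `Ω` is disjoint from a suitable ball around a distant point `y`; two doublings of
the latter swallow the former, although the ball around `y` only had the small remaining volume. -/
theorem CCDoubling.exists_ccBall_eq (hΩb : Bornology.IsBounded Ω)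
    (hconn : XConnected c Ω) (hcont : CCContinuous c Ω) (hΩ : IsOpen Ω) (hd : CCDoubling c Ω Q) :
    ∃ R > 0, ∀ x ∈ Ω, ∀ r, R ≤ r → ccBall c Ω x r = Ω := by
  rcases Ω.eq_empty_or_nonempty with h | ⟨x₀, hx₀⟩
  · exact ⟨1, one_pos, by simp [h]⟩
  set K : ℝ := (2 ^ Q) ^ 2 with hK
  have hKpos : 0 < K := by positivity
  have hVpos : 0 < volume.real Ω :=
    (hd.real_pos hΩb hx₀ one_pos).trans_le (measureReal_mono ccBall_subset hΩb.measure_lt_top.ne)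
  have hU : ⋃ n : ℕ, ccBall c Ω x₀ n = Ω := by
    refine subset_antisymm (iUnion_subset fun _ => ccBall_subset) fun y hy => ?_
    have hlt := ccDist_ne_top hconn hx₀ hy
    obtain ⟨n, hn⟩ := exists_nat_gt (ccDist c x₀ y).toReal
    refine mem_iUnion.2 ⟨n, hy, ?_⟩
    rw [← ENNReal.ofReal_toReal hlt]
    exact (ENNReal.ofReal_lt_ofReal_iff (ENNReal.toReal_nonneg.trans_lt hn)).2 hn
  have hlim : Tendsto (fun n : ℕ => volume.real (ccBall c Ω x₀ n)) atTop (𝓝 (volume.real Ω)) := by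
    have := tendsto_measure_iUnion_atTop (μ := volume) (s := fun n : ℕ => ccBall c Ω x₀ n)
      (fun a b hab => ccBall_mono (by exact_mod_cast hab))
    rw [hU] at this
    exact (ENNReal.tendsto_toReal hΩb.measure_lt_top.ne).comp this
  -- The volume left over is so small that two doublings, which cost the factor `K`, cannot raise it
  -- to the volume of the ball of radius `n`.
  have hev : ∀ᶠ n : ℕ in atTop, K * (volume.real Ω - volume.real (ccBall c Ω x₀ n)) <
      volume.real (ccBall c Ω x₀ n) := by
    refine Tendsto.eventually_lt ((hlim.const_sub (volume.real Ω)).const_mul K) hlim ?_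
    simpa using hVpos
  obtain ⟨n, hn, hn1⟩ := (hev.and (eventually_ge_atTop 1)).exists
  have hn0 : (0 : ℝ) < n := by exact_mod_cast hn1
  set W := volume.real (ccBall c Ω x₀ n)
  have key : ∀ y ∈ Ω, y ∈ ccBall c Ω x₀ (2 * n) := by
    intro y hy
    by_contra hcon
    set s := (ccDist c x₀ y).toReal with hs
    have hds : ccDist c x₀ y = ENNReal.ofReal s :=
      (ENNReal.ofReal_toReal (ccDist_ne_top hconn hx₀ hy)).symm
    have hs2 : 2 * (n : ℝ) ≤ s := by
      by_contra h
      push Not at h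
      refine hcon ⟨hy, ?_⟩
      rw [hds]; exact (ENNReal.ofReal_lt_ofReal_iff (by positivity)).2 h
    have hspos : 0 < s := by linarith
    have hdisj : Disjoint (ccBall c Ω x₀ n) (ccBall c Ω y (s / 2)) := by
      rw [Set.disjoint_left]
      intro z hz hz'
      have := (mem_ccBall_trans hn0.le (by positivity) hz (mem_ccBall_comm hy hz')).2
      rw [hds] at this
      have := (ENNReal.ofReal_lt_ofReal_iff (by positivity)).1 this
      linarith
    have h1 : volume.real (ccBall c Ω y (s / 2)) ≤ volume.real Ω - W := by
      have := measureReal_union hdisj (isOpen_ccBall hΩ hcont y (s / 2)).measurableSet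
        (volume_ccBall_ne_top hΩb _ _) (volume_ccBall_ne_top hΩb _ _)
      have h2 := measureReal_mono (μ := volume)
        (union_subset (ccBall_subset (c := c) (Ω := Ω) (x := x₀) (r := n))
        (ccBall_subset (c := c) (Ω := Ω) (x := y) (r := s / 2))) hΩb.measure_lt_top.ne
      linarith
    -- The radius is `2 s`, which exceeds `s + n` because `s ≥ 2 n`.
    have h2 : W ≤ volume.real (ccBall c Ω y (2 ^ 2 * (s / 2))) := by
      refine measureReal_mono (fun z hz => ?_) (volume_ccBall_ne_top hΩb _ _)
      refine ⟨hz.1, (ccDist_triangle y x₀ z).trans_lt ?_⟩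
      rw [ccDist_comm y, hds]
      calc ENNReal.ofReal s + ccDist c x₀ z < ENNReal.ofReal s + ENNReal.ofReal n :=
            ENNReal.add_lt_add_left ENNReal.ofReal_ne_top hz.2
        _ = ENNReal.ofReal (s + n) := (ENNReal.ofReal_add hspos.le hn0.le).symm
        _ ≤ _ := ENNReal.ofReal_le_ofReal (by linarith)
    have h3 := hd.real_pow_le hΩb hy (half_pos hspos) 2
    have h4 : K * volume.real (ccBall c Ω y (s / 2)) ≤ K * (volume.real Ω - W) := by gcongr
    linarith
  refine ⟨2 * n + 2 * n, by positivity, fun x hx r hr =>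
    subset_antisymm ccBall_subset fun y hy => ccBall_mono hr ?_⟩
  exact mem_ccBall_trans (by positivity) (by positivity) (mem_ccBall_comm hx₀ (key x hx)) (key y hy)

/-- Double the radius from `r` until it passes `R`, where the ball is all of `Ω`. With `2 ^ n ≤ R /
r < 2 ^ (n + 1)` this takes `n + 1` doublings, whose total cost is at most `(2 R / r) ^ Q`. -/
theorem CCDoubling.exists_lower_bound (hΩb : Bornology.IsBounded Ω) (hd : CCDoubling c Ω Q)
    (hQ : 0 ≤ Q) {R : ℝ} (hR : 0 < R) (hball : ∀ x ∈ Ω, ∀ r, R ≤ r → ccBall c Ω x r = Ω) :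
    ∃ a > 0, ∀ x ∈ Ω, ∀ r, 0 < r → r ≤ R → a * r ^ Q ≤ volume.real (ccBall c Ω x r) := by
  rcases Ω.eq_empty_or_nonempty with h | ⟨x₀, hx₀⟩
  · exact ⟨1, one_pos, by simp [h]⟩
  have hVpos : 0 < volume.real Ω := by
    rw [← hball x₀ hx₀ R le_rfl]; exact hd.real_pos hΩb hx₀ hR
  refine ⟨volume.real Ω / (2 * R) ^ Q, by positivity, fun x hx r hr hrR => ?_⟩
  obtain ⟨n, hn1, hn2⟩ := exists_nat_pow_near ((one_le_div hr).2 hrR) (one_lt_two (α := ℝ))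
  have h1 := hd.real_pow_le hΩb hx hr (n + 1)
  rw [hball x hx _ ((div_lt_iff₀ hr).1 hn2).le] at h1
  have h2 : ((2 : ℝ) ^ Q) ^ (n + 1) ≤ (2 * R / r) ^ Q := by
    rw [← Real.rpow_mul_natCast zero_le_two, mul_comm, Real.rpow_mul zero_le_two,
      Real.rpow_natCast]
    refine Real.rpow_le_rpow (by positivity) ?_ hQ
    rw [pow_succ', mul_div_assoc]; gcongr
  rw [div_mul_eq_mul_div, div_le_iff₀ (by positivity)]
  have h3 : volume.real Ω ≤ (2 * R / r) ^ Q * volume.real (ccBall c Ω x r) :=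
    h1.trans (by gcongr)
  rw [Real.div_rpow (by positivity) hr.le, div_mul_eq_mul_div, le_div_iff₀ (by positivity)] at h3
  linarith

/-! ### Telescoping the Poincaré inequality -/

theorem abs_setAverage_sub_le {s : Set (EuclideanSpace ℝ (Fin N))}
    {u : EuclideanSpace ℝ (Fin N) → ℝ}
    (hs : 0 < volume.real s) (hs' : volume s ≠ ⊤) (hu : IntegrableOn u s) (a : ℝ) :
    |(⨍ y in s, u y) - a| ≤ ⨍ y in s, |u y - a| := by
  have h1 : (⨍ y in s, u y) - a = ⨍ y in s, (u y - a) := by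
    rw [setAverage_eq, setAverage_eq, integral_sub hu (integrableOn_const hs')]
    simp only [smul_eq_mul, setIntegral_const]
    field_simp
  rw [h1, setAverage_eq, setAverage_eq, smul_eq_mul, smul_eq_mul, abs_mul, abs_of_pos (inv_pos.2 hs)]
  gcongr
  exact abs_integral_le_integral_abs

/-- Telescoping of the Poincaré inequality along balls shrinking to a point. -/
theorem CCPoincare.exists_chain (hΩ : IsOpen Ω) (hΩb : Bornology.IsBounded Ω)
    (hc : ∀ j, Continuous (c j)) (hcont : CCContinuous c Ω) (hd : CCDoubling c Ω Q)
    (hp : CCPoincare c Ω) {R : ℝ} (hR : 0 < R)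
    (hball : ∀ x ∈ Ω, ∀ r, R ≤ r → ccBall c Ω x r = Ω) :
    ∃ D > 0, ∃ ν > 0, ∀ u : EuclideanSpace ℝ (Fin N) → ℝ, ContDiff ℝ 1 u → ∀ x ∈ Ω,
      ∀ F : ℕ → ℝ, Summable F →
      (∀ i, (R / 2 ^ i) * ⨍ y in ccBall c Ω x (ν * (R / 2 ^ i)), ‖xGrad c u y‖ ≤ F i) →
      |u x - ⨍ y in Ω, u y| ≤ D * ∑' i, F i := by
  obtain ⟨CP, hCP, ν, hν, H⟩ := hp
  refine ⟨2 ^ Q * CP, by positivity, ν, hν, fun u hu x hx F hF hle => ?_⟩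
  set r : ℕ → ℝ := fun i => R / 2 ^ i with hr
  have hrpos : ∀ i, 0 < r i := fun i => by positivity
  have hint : ∀ s, IntegrableOn u (ccBall c Ω x s) := fun s =>
    (hu.continuous.integrableOn_of_isBounded hΩb).mono_set ccBall_subset
  have hFnn : ∀ i, 0 ≤ F i := fun i => by
    refine le_trans (mul_nonneg (hrpos i).le ?_) (hle i)
    rw [setAverage_eq, smul_eq_mul]
    exact mul_nonneg (inv_nonneg.2 measureReal_nonneg) (integral_nonneg fun _ => norm_nonneg _)
  -- The mean over the half-radius ball is compared with the mean over the larger ball: the average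
  -- of `|u - a|` grows at most by `2 ^ Q` on passing to the larger ball, where the Poincaré
  -- inequality applies.
  have hstep : ∀ i, |(⨍ y in ccBall c Ω x (r (i + 1)), u y) - ⨍ y in ccBall c Ω x (r i), u y| ≤
      2 ^ Q * CP * F i := by
    intro i
    set a := ⨍ y in ccBall c Ω x (r i), u y with ha
    refine (abs_setAverage_sub_le (hd.real_pos hΩb hx (hrpos _)) (volume_ccBall_ne_top hΩb _ _)
      (hint _) a).trans ?_
    have h2r : 2 * r (i + 1) = r i := by simp only [hr]; rw [pow_succ]; field_simp
    have h1 := hd.real_le hΩb hx (hrpos (i + 1))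
    rw [h2r] at h1
    have h2 : ⨍ y in ccBall c Ω x (r (i + 1)), |u y - a| ≤
        2 ^ Q * ⨍ y in ccBall c Ω x (r i), |u y - a| := by
      rw [setAverage_eq, setAverage_eq, smul_eq_mul, smul_eq_mul, ← mul_assoc]
      have h3 : ∫ y in ccBall c Ω x (r (i + 1)), |u y - a| ≤ ∫ y in ccBall c Ω x (r i), |u y - a| := by
        refine setIntegral_mono_set ?_ (ae_of_all _ fun _ => abs_nonneg _) ?_
        · exact ((hint _).sub (integrableOn_const (volume_ccBall_ne_top hΩb _ _))).abs
        · exact (ccBall_mono (by rw [← h2r]; linarith [hrpos (i + 1)])).eventuallyLE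
      have h4 : (volume.real (ccBall c Ω x (r (i + 1))))⁻¹ ≤
          2 ^ Q * (volume.real (ccBall c Ω x (r i)))⁻¹ := by
        have p1 := hd.real_pos hΩb hx (hrpos (i + 1))
        have p2 := hd.real_pos hΩb hx (hrpos i)
        rw [← div_eq_mul_inv, inv_eq_one_div, div_le_div_iff₀ p1 p2]
        linarith
      exact mul_le_mul h4 h3 (integral_nonneg fun _ => abs_nonneg _) (by positivity)
    refine h2.trans ?_
    rw [mul_assoc]
    gcongr
    refine (H x hx (r i) (hrpos i) u hu).trans ?_
    rw [mul_assoc]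
    gcongr
    exact hle i
  have hn : ∀ n, |(⨍ y in ccBall c Ω x (r n), u y) - ⨍ y in Ω, u y| ≤ 2 ^ Q * CP * ∑' i, F i := by
    intro n
    have h0 : ccBall c Ω x (r 0) = Ω := hball x hx _ (by simp [hr])
    have : |(⨍ y in ccBall c Ω x (r n), u y) - ⨍ y in Ω, u y| ≤
        2 ^ Q * CP * ∑ i ∈ Finset.range n, F i := by
      induction n with
      | zero => rw [h0]; simp
      | succ n ih =>
        rw [Finset.sum_range_succ, mul_add]
        calc _ ≤ |(⨍ y in ccBall c Ω x (r (n + 1)), u y) - ⨍ y in ccBall c Ω x (r n), u y|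
              + |(⨍ y in ccBall c Ω x (r n), u y) - ⨍ y in Ω, u y| := abs_sub_le _ _ _
          _ ≤ _ := by linarith [hstep n]
    refine this.trans ?_
    gcongr
    exact hF.sum_le_tsum _ fun i _ => hFnn i
  -- Control balls with radii tending to `0` shrink to `x` in the Euclidean sense too, so continuity
  -- of `u` identifies the limit of the averages.
  have hlim : Tendsto (fun n => ⨍ y in ccBall c Ω x (r n), u y) atTop (𝓝 (u x)) := by
    rw [Metric.tendsto_nhds]
    intro ε hε
    obtain ⟨δ, hδ, hδ'⟩ := Metric.continuous_iff.1 hu.continuous x (ε / 2) (half_pos hε)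
    obtain ⟨s, hs, hs'⟩ := exists_ccDist_lt_imp_dist_lt hc x hδ
    have hr0 : Tendsto r atTop (𝓝 0) := by
      simp only [hr, div_eq_mul_inv, ← inv_pow]
      simpa using (tendsto_pow_atTop_nhds_zero_of_lt_one (r := (2 : ℝ)⁻¹) (by norm_num)
        (by norm_num)).const_mul R
    filter_upwards [hr0.eventually (gt_mem_nhds hs)] with n hn
    rw [Real.dist_eq]
    refine (abs_setAverage_sub_le (hd.real_pos hΩb hx (hrpos _)) (volume_ccBall_ne_top hΩb _ _)
      (hint _) (u x)).trans_lt ?_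
    have hp := hd.real_pos hΩb hx (hrpos n)
    have : ∫ y in ccBall c Ω x (r n), |u y - u x| ≤ ∫ y in ccBall c Ω x (r n), ε / 2 := by
      refine setIntegral_mono_on ?_ (integrableOn_const (volume_ccBall_ne_top hΩb _ _))
        (isOpen_ccBall hΩ hcont _ _).measurableSet fun y hy => ?_
      · exact ((hint _).sub (integrableOn_const (volume_ccBall_ne_top hΩb _ _))).abs
      · exact (hδ' y (hs' y (hy.2.trans_le (ENNReal.ofReal_le_ofReal hn.le)))).le
    rw [setIntegral_const, smul_eq_mul] at this
    rw [setAverage_eq, smul_eq_mul]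
    calc _ ≤ (volume.real (ccBall c Ω x (r n)))⁻¹ * (volume.real (ccBall c Ω x (r n)) * (ε / 2)) := by
          gcongr
      _ = ε / 2 := by field_simp
      _ < ε := half_lt_self hε
  exact le_of_tendsto ((hlim.sub_const _).abs) (Eventually.of_forall hn)
end

section
variable {m N : ℕ} {c : VFields m N} {Ω : Set (EuclideanSpace ℝ (Fin N))} {Q : ℝ}

/-! ### The maximal function -/

/-- The uncentred maximal function over control balls of radius at most `R`. -/
def ccMaximal {m N : ℕ} (c : VFields m N) (Ω : Set (EuclideanSpace ℝ (Fin N))) (R : ℝ)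
    (g : EuclideanSpace ℝ (Fin N) → ℝ≥0∞) (x : EuclideanSpace ℝ (Fin N)) : ℝ≥0∞ :=
  ⨆ (z ∈ Ω) (r ∈ Ioc 0 R) (_ : x ∈ ccBall c Ω z r),
    (∫⁻ y in ccBall c Ω z r, g y) / volume (ccBall c Ω z r)

theorem lt_ccMaximal_iff {R : ℝ} {g : EuclideanSpace ℝ (Fin N) → ℝ≥0∞}
    {x : EuclideanSpace ℝ (Fin N)} {t : ℝ≥0∞} :
    t < ccMaximal c Ω R g x ↔ ∃ z ∈ Ω, ∃ r ∈ Ioc 0 R, x ∈ ccBall c Ω z r ∧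
      t < (∫⁻ y in ccBall c Ω z r, g y) / volume (ccBall c Ω z r) := by
  simp only [ccMaximal, lt_iSup_iff, exists_prop]

theorem le_ccMaximal (hcont : CCContinuous c Ω) {R r : ℝ} (g : EuclideanSpace ℝ (Fin N) → ℝ≥0∞)
    {x : EuclideanSpace ℝ (Fin N)} (hx : x ∈ Ω) (hr : r ∈ Ioc 0 R) :
    (∫⁻ y in ccBall c Ω x r, g y) / volume (ccBall c Ω x r) ≤ ccMaximal c Ω R g x :=
  le_iSup₂_of_le x hx (le_iSup₂_of_le r hr
    (le_iSup_of_le (mem_ccBall_self hcont hx hr.1) le_rfl))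

theorem measurable_ccMaximal (hΩ : IsOpen Ω) (hcont : CCContinuous c Ω) (R : ℝ)
    (g : EuclideanSpace ℝ (Fin N) → ℝ≥0∞) : Measurable (ccMaximal c Ω R g) := by
  refine measurable_of_Ioi fun t => IsOpen.measurableSet ?_
  rw [isOpen_iff_mem_nhds]
  intro x hx
  obtain ⟨z, hz, r, hr, hxz, hlt⟩ := lt_ccMaximal_iff.1 (show t < ccMaximal c Ω R g x from hx)
  filter_upwards [(isOpen_ccBall hΩ hcont z r).mem_nhds hxz] with y hy
  exact lt_ccMaximal_iff.2 ⟨z, hz, r, hr, hy, hlt⟩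

/-- Needed only to know that the maximal function of a bounded function is finite; the bound `K`
does not enter later constants. -/
theorem ccMaximal_le_of_le {R : ℝ} (hΩ : IsOpen Ω) (hcont : CCContinuous c Ω)
    {g : EuclideanSpace ℝ (Fin N) → ℝ≥0∞}
    {K : ℝ≥0∞} (hg : ∀ y ∈ Ω, g y ≤ K) (x : EuclideanSpace ℝ (Fin N)) :
    ccMaximal c Ω R g x ≤ K := by
  refine iSup₂_le fun z _ => iSup₂_le fun r _ => iSup_le fun _ => ?_
  refine ENNReal.div_le_of_le_mul ?_
  calc _ ≤ ∫⁻ _ in ccBall c Ω z r, K :=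
        setLIntegral_mono' (isOpen_ccBall hΩ hcont z r).measurableSet fun y hy => hg y hy.1
    _ = _ := by simp

/-- Vitali's covering lemma. Every ball on which the average exceeds `t` meets a selected ball of at
least half its radius, so it lies in the concentric ball of five times the selected radius. Eight
times, that is three doublings, is used instead. The selected balls are disjoint, hence their
integrals add up to at most the integral over `Ω`. -/
theorem CCDoubling.weak_type_ccMaximal (hd : CCDoubling c Ω Q) (hΩ : IsOpen Ω)
    (hΩb : Bornology.IsBounded Ω) (hcont : CCContinuous c Ω) (R : ℝ)
    (g : EuclideanSpace ℝ (Fin N) → ℝ≥0∞) {t : ℝ≥0∞} (ht : t ≠ 0) (ht' : t ≠ ⊤) :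
    volume {x | t < ccMaximal c Ω R g x} ≤
      ENNReal.ofReal ((2 ^ Q) ^ 3) / t * ∫⁻ y in Ω, g y := by
  set B : EuclideanSpace ℝ (Fin N) × ℝ → Set (EuclideanSpace ℝ (Fin N)) :=
    fun a => ccBall c Ω a.1 a.2 with hB
  set 𝒜 : Set (EuclideanSpace ℝ (Fin N) × ℝ) :=
    {a | a.1 ∈ Ω ∧ a.2 ∈ Ioc 0 R ∧ t < (∫⁻ y in B a, g y) / volume (B a)} with h𝒜
  have hBopen : ∀ a, IsOpen (B a) := fun a => isOpen_ccBall hΩ hcont _ _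
  have hBne : ∀ a ∈ 𝒜, (B a).Nonempty := fun a ha => ⟨a.1, mem_ccBall_self hcont ha.1 ha.2.1.1⟩
  obtain ⟨u, hu𝒜, hdisj, hcov⟩ := Vitali.exists_disjoint_subfamily_covering_enlargement B 𝒜
    (fun a => a.2) 2 one_lt_two (fun a ha => ha.2.1.1.le) R (fun a ha => ha.2.1.2) hBne
  have hucount : u.Countable := hdisj.countable_of_isOpen (fun a _ => hBopen a)
    (fun a ha => hBne a (hu𝒜 ha))
  have hsub : {x | t < ccMaximal c Ω R g x} ⊆ ⋃ b ∈ u, ccBall c Ω b.1 (2 ^ 3 * b.2) := by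
    intro x hx
    obtain ⟨z, hz, r, hr, hxz, hlt⟩ := lt_ccMaximal_iff.1 hx
    obtain ⟨b, hb, ⟨y, hya, hyb⟩, hle⟩ := hcov (z, r) ⟨hz, hr, hlt⟩
    have hb2 := (hu𝒜 hb).2.1.1
    refine mem_iUnion₂.2 ⟨b, hb, ?_⟩
    have h1 : z ∈ ccBall c Ω b.1 (b.2 + r) :=
      mem_ccBall_trans hb2.le hr.1.le hyb (mem_ccBall_comm hz hya)
    have h2 : x ∈ ccBall c Ω b.1 (b.2 + r + r) :=
      mem_ccBall_trans (by linarith [hr.1]) hr.1.le h1 hxz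
    refine ccBall_mono ?_ h2
    simp only at hle
    linarith
  have hball : ∀ b ∈ u, volume (ccBall c Ω b.1 (2 ^ 3 * b.2)) ≤
      ENNReal.ofReal ((2 ^ Q) ^ 3) / t * ∫⁻ y in B b, g y := by
    intro b hb
    obtain ⟨hb1, hb2, hb3⟩ := hu𝒜 hb
    have h1 := hd.real_pow_le hΩb hb1 hb2.1 3
    have h2 : volume (ccBall c Ω b.1 (2 ^ 3 * b.2)) ≤
        ENNReal.ofReal ((2 ^ Q) ^ 3) * volume (B b) := by
      have := ENNReal.ofReal_le_ofReal h1
      rwa [ENNReal.ofReal_mul (by positivity), ofReal_measureReal (volume_ccBall_ne_top hΩb _ _),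
        ofReal_measureReal (volume_ccBall_ne_top hΩb _ _)] at this
    refine h2.trans ?_
    rw [div_eq_mul_inv, mul_assoc]
    gcongr
    have h3 : t * volume (B b) ≤ ∫⁻ y in B b, g y := by
      have := hb3.le
      rwa [ENNReal.le_div_iff_mul_le (Or.inl (hd.volume_pos hb1 hb2.1).ne')
        (Or.inl (volume_ccBall_ne_top hΩb _ _))] at this
    calc volume (B b) = t⁻¹ * (t * volume (B b)) := by
          rw [← mul_assoc, ENNReal.inv_mul_cancel ht ht', one_mul]
      _ ≤ _ := by gcongr
  calc volume {x | t < ccMaximal c Ω R g x}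
      ≤ volume (⋃ b ∈ u, ccBall c Ω b.1 (2 ^ 3 * b.2)) := measure_mono hsub
    _ ≤ ∑' b : u, volume (ccBall c Ω b.1.1 (2 ^ 3 * b.1.2)) := measure_biUnion_le _ hucount _
    _ ≤ ∑' b : u, ENNReal.ofReal ((2 ^ Q) ^ 3) / t * ∫⁻ y in B b.1, g y :=
        ENNReal.tsum_le_tsum fun b => hball b.1 b.2
    _ = ENNReal.ofReal ((2 ^ Q) ^ 3) / t * ∑' b : u, ∫⁻ y in B b.1, g y := ENNReal.tsum_mul_left
    _ = ENNReal.ofReal ((2 ^ Q) ^ 3) / t * ∫⁻ y in ⋃ b ∈ u, B b, g y := by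
        rw [lintegral_biUnion hucount (fun b _ => (hBopen b).measurableSet) hdisj]
    _ ≤ _ := by
        gcongr
        exact iUnion₂_subset fun b _ => ccBall_subset

/-- Marcinkiewicz interpolation between the weak type of exponent 1 and the trivial bound for
bounded functions. The `8` is the product of three twos: the layer-cake exponent, the weak-type
bound at level `t / 2` instead of `t`, and the integration over `0 < t < 2 w`. -/
theorem CCDoubling.lintegral_ccMaximal_sq_le (hd : CCDoubling c Ω Q) (hΩ : IsOpen Ω)
    (hΩb : Bornology.IsBounded Ω) (hcont : CCContinuous c Ω) (R : ℝ)
    {w : EuclideanSpace ℝ (Fin N) → ℝ} (hw : Measurable w) (hw0 : ∀ x, 0 ≤ w x) {K : ℝ}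
    (hK : ∀ x ∈ Ω, w x ≤ K) :
    ∫⁻ x in Ω, ENNReal.ofReal ((ccMaximal c Ω R (fun y => ENNReal.ofReal (w y)) x).toReal ^ 2) ≤
      ENNReal.ofReal (8 * (2 ^ Q) ^ 3) * ∫⁻ x in Ω, ENNReal.ofReal (w x ^ 2) := by
  set g : EuclideanSpace ℝ (Fin N) → ℝ≥0∞ := fun y => ENNReal.ofReal (w y) with hg
  set C := ENNReal.ofReal ((2 ^ Q) ^ 3) with hC
  have hgm : Measurable g := hw.ennreal_ofReal
  have hMtop : ∀ x, ccMaximal c Ω R g x ≠ ⊤ := fun x =>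
    ((ccMaximal_le_of_le hΩ hcont (K := ENNReal.ofReal K)
      (fun y hy => ENNReal.ofReal_le_ofReal (hK y hy)) x).trans_lt ENNReal.ofReal_lt_top).ne
  have hMm := measurable_ccMaximal hΩ hcont R g
  have hlc := lintegral_rpow_eq_lintegral_meas_lt_mul (volume.restrict Ω)
    (f := fun x => (ccMaximal c Ω R g x).toReal) (ae_of_all _ fun _ => ENNReal.toReal_nonneg)
    hMm.ennreal_toReal.aemeasurable (p := 2) two_pos
  simp only [Real.rpow_two] at hlc
  rw [hlc]
  have hlevel : ∀ t ∈ Ioi (0 : ℝ), (volume.restrict Ω) {a | t < (ccMaximal c Ω R g a).toReal} *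
      ENNReal.ofReal (t ^ ((2 : ℝ) - 1)) ≤
      2 * C * ∫⁻ y in Ω, {y | t < 2 * w y}.indicator g y := by
    intro t ht
    have ht0 : (0 : ℝ) < t := ht
    -- Only the part of `w` above `t / 2` matters at level `t`, since the rest adds at most `t / 2`
    -- to any average.
    set g' := {y | t < 2 * w y}.indicator g with hg'
    have hle : ∀ y, g y ≤ g' y + ENNReal.ofReal (t / 2) := by
      intro y
      by_cases hy : t < 2 * w y
      · rw [hg', indicator_of_mem (show y ∈ {y | t < 2 * w y} from hy)]; exact le_self_add
      · rw [hg', indicator_of_notMem (show y ∉ {y | t < 2 * w y} from hy), zero_add]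
        exact ENNReal.ofReal_le_ofReal (by linarith)
    have hsub : {a | t < (ccMaximal c Ω R g a).toReal} ⊆
        {a | ENNReal.ofReal (t / 2) < ccMaximal c Ω R g' a} := by
      intro a ha
      have h1 : ENNReal.ofReal t < ccMaximal c Ω R g a := by
        rw [← ENNReal.ofReal_toReal (hMtop a)]
        exact (ENNReal.ofReal_lt_ofReal_iff (ht0.trans ha)).2 ha
      obtain ⟨z, hz, r, hr, haz, hlt⟩ := lt_ccMaximal_iff.1 h1
      refine lt_ccMaximal_iff.2 ⟨z, hz, r, hr, haz, ?_⟩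
      have hv0 := (hd.volume_pos hz hr.1).ne'
      have hvt := volume_ccBall_ne_top (c := c) hΩb z r
      have h2 : (∫⁻ y in ccBall c Ω z r, g y) / volume (ccBall c Ω z r) ≤
          (∫⁻ y in ccBall c Ω z r, g' y) / volume (ccBall c Ω z r) + ENNReal.ofReal (t / 2) := by
        rw [ENNReal.div_le_iff hv0 hvt, add_mul, ENNReal.div_mul_cancel hv0 hvt]
        calc _ ≤ ∫⁻ y in ccBall c Ω z r, (g' y + ENNReal.ofReal (t / 2)) := lintegral_mono hle
          _ = _ := by rw [lintegral_add_right _ measurable_const]; simp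
      have h3 := hlt.trans_le h2
      have h5 : ENNReal.ofReal t = ENNReal.ofReal (t / 2) + ENNReal.ofReal (t / 2) := by
        rw [← ENNReal.ofReal_add (by positivity) (by positivity), add_halves]
      rw [h5, ENNReal.add_lt_add_iff_right ENNReal.ofReal_ne_top] at h3
      exact h3
    have ht2 : ENNReal.ofReal (t / 2) ≠ 0 := by simpa using ht0
    have h4 := hd.weak_type_ccMaximal hΩ hΩb hcont R g' ht2 ENNReal.ofReal_ne_top
    calc _ ≤ volume {a | ENNReal.ofReal (t / 2) < ccMaximal c Ω R g' a} * ENNReal.ofReal t := by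
          rw [show (2 : ℝ) - 1 = 1 by norm_num, Real.rpow_one]
          exact mul_le_mul' ((Measure.restrict_apply_le _ _).trans (measure_mono hsub)) le_rfl
      _ ≤ (C / ENNReal.ofReal (t / 2) * ∫⁻ y in Ω, g' y) * ENNReal.ofReal t := by gcongr
      _ = _ := by
          have : ENNReal.ofReal t = 2 * ENNReal.ofReal (t / 2) := by
            rw [← ENNReal.ofReal_ofNat, ← ENNReal.ofReal_mul zero_le_two]; congr 1; ring
          rw [this, div_eq_mul_inv]
          calc _ = 2 * C * (∫⁻ y in Ω, g' y) *
                ((ENNReal.ofReal (t / 2))⁻¹ * ENNReal.ofReal (t / 2)) := by ring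
            _ = _ := by rw [ENNReal.inv_mul_cancel ht2 ENNReal.ofReal_ne_top, mul_one]
  -- By Tonelli, each `w y` is counted over the interval `0 < t < 2 w y`.
  have hswap : ∫⁻ t in Ioi (0 : ℝ), ∫⁻ y in Ω, {y | t < 2 * w y}.indicator g y =
      ∫⁻ y in Ω, 2 * ENNReal.ofReal (w y ^ 2) := by
    rw [lintegral_lintegral_swap]
    · refine lintegral_congr fun y => ?_
      have : ∀ t : ℝ, {y | t < 2 * w y}.indicator g y = (Iio (2 * w y)).indicator (fun _ => g y) t := by
        intro t; simp only [indicator, mem_ofPred_eq, mem_Iio]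
      simp_rw [this]
      rw [lintegral_indicator measurableSet_Iio, setLIntegral_const,
        Measure.restrict_apply measurableSet_Iio, inter_comm, Ioi_inter_Iio, Real.volume_Ioo, hg,
        sub_zero, ← ENNReal.ofReal_mul (hw0 y), ← ENNReal.ofReal_ofNat,
        ← ENNReal.ofReal_mul zero_le_two]
      congr 1; ring
    · have hS : MeasurableSet {p : ℝ × EuclideanSpace ℝ (Fin N) | p.1 < 2 * w p.2} :=
        measurableSet_lt measurable_fst ((hw.comp measurable_snd).const_mul 2)
      have : (Function.uncurry fun (t : ℝ) y => {y | t < 2 * w y}.indicator g y) =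
          {p : ℝ × EuclideanSpace ℝ (Fin N) | p.1 < 2 * w p.2}.indicator (fun p => g p.2) := by
        ext ⟨t, y⟩; simp only [Function.uncurry, indicator, mem_ofPred_eq]
      rw [this]
      exact ((hgm.comp measurable_snd).indicator hS).aemeasurable
  calc _ ≤ ENNReal.ofReal 2 * ∫⁻ t in Ioi (0 : ℝ), 2 * C *
        ∫⁻ y in Ω, {y | t < 2 * w y}.indicator g y := by
        gcongr ENNReal.ofReal 2 * ?_
        exact setLIntegral_mono' measurableSet_Ioi hlevel
    _ = ENNReal.ofReal 2 * (2 * C * (2 * ∫⁻ y in Ω, ENNReal.ofReal (w y ^ 2))) := by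
        rw [lintegral_const_mul' _ _ (ENNReal.mul_ne_top (by simp) ENNReal.ofReal_ne_top), hswap,
          lintegral_const_mul' _ _ (by simp)]
    _ = _ := by
        rw [ENNReal.ofReal_mul (by norm_num : (0 : ℝ) ≤ 8), ← hC, ENNReal.ofReal_ofNat,
          ENNReal.ofReal_ofNat]
        ring
end

section
variable {m N : ℕ} {c : VFields m N} {Ω : Set (EuclideanSpace ℝ (Fin N))} {Q : ℝ}

/-! ### The Sobolev inequality for functions minus their mean -/

/-- Subtraction is truncated, so the exponent is `|n - i|` and the series is a two-sided geometric
one centred at `n`. It sums the terms on both sides of the cut-off radius in Hedberg's argument. -/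
theorem summable_and_tsum_pow_dist_le {q : ℝ} (hq0 : 0 ≤ q) (hq1 : q < 1) (n : ℕ) :
    Summable (fun i : ℕ => q ^ ((n - i) + (i - n))) ∧
      ∑' i : ℕ, q ^ ((n - i) + (i - n)) ≤ 2 / (1 - q) := by
  have hshift : (fun i : ℕ => q ^ ((n - (i + n)) + (i + n - n))) = fun i => q ^ i := by
    ext i; congr 1; omega
  have hs : Summable (fun i : ℕ => q ^ ((n - i) + (i - n))) := by
    rw [← summable_nat_add_iff n]
    rw [hshift]
    exact summable_geometric_of_lt_one hq0 hq1
  refine ⟨hs, ?_⟩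
  rw [← hs.sum_add_tsum_nat_add n, hshift, tsum_geometric_of_lt_one hq0 hq1]
  have h1 : ∑ i ∈ Finset.range n, q ^ ((n - i) + (i - n)) ≤ ∑ i ∈ Finset.range n, q ^ i := by
    rw [← Finset.sum_range_reflect]
    refine Finset.sum_le_sum fun i hi => ?_
    refine pow_le_pow_of_le_one hq0 hq1.le ?_
    have := Finset.mem_range.1 hi
    omega
  have h2 : ∑ i ∈ Finset.range n, q ^ i ≤ (1 - q)⁻¹ := by
    rw [← tsum_geometric_of_lt_one hq0 hq1]
    exact (summable_geometric_of_lt_one hq0 hq1).sum_le_tsum _ fun i _ => pow_nonneg hq0 i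
  rw [div_eq_mul_inv]
  linarith

/-- The variance of `w` over `s` is nonnegative. -/
theorem sq_setAverage_mul_le {s : Set (EuclideanSpace ℝ (Fin N))}
    {w : EuclideanSpace ℝ (Fin N) → ℝ} (hs' : volume s ≠ ⊤)
    (hw : IntegrableOn w s) (hw2 : IntegrableOn (fun y => w y ^ 2) s) :
    (⨍ y in s, w y) ^ 2 * volume.real s ≤ ∫ y in s, w y ^ 2 := by
  rcases (measureReal_nonneg (μ := volume) (s := s)).eq_or_lt with h | h
  · rw [← h, mul_zero]; exact integral_nonneg fun _ => sq_nonneg _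
  set a := ⨍ y in s, w y with ha
  have h1 : ∫ y in s, w y = a * volume.real s := by
    rw [ha, setAverage_eq, smul_eq_mul]; field_simp
  have h2 : 0 ≤ ∫ y in s, (w y - a) ^ 2 := integral_nonneg fun _ => sq_nonneg _
  have h3 : ∫ y in s, (w y - a) ^ 2 = (∫ y in s, w y ^ 2) - a ^ 2 * volume.real s := by
    have : ∀ y, (w y - a) ^ 2 = w y ^ 2 - (2 * a * w y - a ^ 2) := fun y => by ring
    simp_rw [this]
    have i1 : Integrable (fun y => 2 * a * w y) (volume.restrict s) := hw.const_mul _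
    have i2 : Integrable (fun _ => a ^ 2) (volume.restrict s) := integrableOn_const hs'
    have i3 : Integrable (fun y => 2 * a * w y - a ^ 2) (volume.restrict s) := i1.sub i2
    rw [integral_sub hw2 i3, integral_sub i1 i2, integral_const_mul, h1,
      setIntegral_const, smul_eq_mul]
    ring
  linarith

/-- Hedberg's pointwise estimate. -/
theorem CCPoincare.exists_hedberg (hΩ : IsOpen Ω) (hΩb : Bornology.IsBounded Ω)
    (hc : ∀ j, Continuous (c j)) (hcont : CCContinuous c Ω) (hd : CCDoubling c Ω Q) (hQ : 2 < Q)
    (hp : CCPoincare c Ω) {R : ℝ} (hR : 0 < R)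
    (hball : ∀ x ∈ Ω, ∀ r, R ≤ r → ccBall c Ω x r = Ω) :
    ∃ C > 0, ∀ u : EuclideanSpace ℝ (Fin N) → ℝ, ContDiff ℝ 1 u → ∀ x ∈ Ω, ∀ A S : ℝ,
      0 ≤ A → 0 < S → (∀ r ∈ Ioc 0 R, ⨍ y in ccBall c Ω x r, ‖xGrad c u y‖ ≤ A) →
      ∫ y in Ω, ‖xGrad c u y‖ ^ 2 ≤ S ^ 2 →
      |u x - ⨍ y in Ω, u y| ≤ C * (A ^ (1 - 2 / Q) * S ^ (2 / Q)) := by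
  obtain ⟨D, hD, ν, hν, hchain⟩ := hp.exists_chain hΩ hΩb hc hcont hd hR hball
  obtain ⟨a, ha, hlow⟩ := hd.exists_lower_bound hΩb (by linarith) hR hball
  -- By Cauchy–Schwarz and the lower bound for volumes, `r` times an average is at most a multiple
  -- of `S r r^{-Q/2} = S r^{-κ}`.
  set κ : ℝ := Q / 2 - 1 with hκ
  have hκ0 : 0 < κ := by rw [hκ]; linarith
  -- The lower volume bound holds for radii up to `R` only, so an enlargement `ν > 1` is not used
  -- there.
  set ν₀ := min ν 1 with hν₀
  have hν₀pos : 0 < ν₀ := lt_min hν one_pos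
  set b : ℝ := √(a * ν₀ ^ Q) with hb
  have hbpos : 0 < b := Real.sqrt_pos.2 (by positivity)
  set q : ℝ := (2 : ℝ) ^ (-κ) with hq
  have hq0 : 0 ≤ q := by positivity
  have hq1 : q < 1 := Real.rpow_lt_one_of_one_lt_of_neg one_lt_two (by linarith)
  set r : ℕ → ℝ := fun i => R / 2 ^ i with hr
  have hrpos : ∀ i, 0 < r i := fun i => by positivity
  have hrR : ∀ i, r i ≤ R := fun i => div_le_self hR.le (one_le_pow₀ one_le_two)
  set C₁ := D * (b⁻¹ * (2 / (1 - q)) + 4) with hC₁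
  have h1q : 0 < 1 - q := by linarith
  have hC₁pos : 0 < C₁ := by positivity
  refine ⟨C₁ * 3, by positivity, fun u hu x hx A S hA hS hAvg hS2 => ?_⟩
  set w : EuclideanSpace ℝ (Fin N) → ℝ := fun y => ‖xGrad c u y‖ with hw
  have hwc : Continuous w := (continuous_xGrad hc hu).norm
  have hwi : ∀ s, IntegrableOn w (ccBall c Ω x s) := fun s =>
    (hwc.integrableOn_of_isBounded hΩb).mono_set ccBall_subset
  have hw2 : IntegrableOn (fun y => w y ^ 2) Ω := (hwc.pow 2).integrableOn_of_isBounded hΩb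
  have hAvg' : ∀ s, 0 < s → ⨍ y in ccBall c Ω x s, w y ≤ A := by
    intro s hs
    rcases le_total s R with h | h
    · exact hAvg s ⟨hs, h⟩
    · rw [hball x hx s h, ← hball x hx R le_rfl]; exact hAvg R ⟨hR, le_rfl⟩
  have havgnn : ∀ s, 0 ≤ ⨍ y in ccBall c Ω x s, w y := fun s => by
    rw [setAverage_eq, smul_eq_mul]
    exact mul_nonneg (inv_nonneg.2 measureReal_nonneg) (integral_nonneg fun _ => norm_nonneg _)
  have hone : ∀ i, r i * ⨍ y in ccBall c Ω x (ν * r i), w y ≤ r i * A := fun i =>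
    mul_le_mul_of_nonneg_left (hAvg' _ (by have := hrpos i; positivity)) (hrpos i).le
  have htwo : ∀ i, r i * ⨍ y in ccBall c Ω x (ν * r i), w y ≤ b⁻¹ * S * r i ^ (-κ) := by
    intro i
    set v := ⨍ y in ccBall c Ω x (ν * r i), w y with hv
    have hri := hrpos i
    have h1 : v ^ 2 * volume.real (ccBall c Ω x (ν * r i)) ≤ S ^ 2 := by
      refine (sq_setAverage_mul_le (volume_ccBall_ne_top hΩb _ _) (hwi _)
        (hw2.mono_set ccBall_subset)).trans (le_trans ?_ hS2)
      exact setIntegral_mono_set hw2 (ae_of_all _ fun _ => sq_nonneg _)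
        (ccBall_subset (c := c)).eventuallyLE
    have h2 : a * (ν₀ * r i) ^ Q ≤ volume.real (ccBall c Ω x (ν * r i)) := by
      refine (hlow x hx (ν₀ * r i) (by positivity) ?_).trans
        (measureReal_mono (ccBall_mono ?_) (volume_ccBall_ne_top hΩb _ _))
      · exact (mul_le_of_le_one_left hri.le (min_le_right _ _)).trans (hrR i)
      · gcongr; exact min_le_left _ _
    have h3 : (v * (b * r i ^ (Q / 2))) ^ 2 ≤ S ^ 2 := by
      refine le_trans (le_of_eq ?_) ((mul_le_mul_of_nonneg_left h2 (sq_nonneg v)).trans h1)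
      have e : (r i ^ (Q / 2)) ^ 2 = r i ^ Q := by
        rw [← Real.rpow_mul_natCast hri.le]; norm_num
      rw [mul_pow, mul_pow, hb, Real.sq_sqrt (by positivity), Real.mul_rpow hν₀pos.le hri.le, e]
      ring
    have h4 : v * (b * r i ^ (Q / 2)) ≤ S := le_of_sq_le_sq h3 hS.le
    have h5 : r i ^ (Q / 2) = r i * r i ^ κ := by
      rw [hκ, Real.rpow_sub_one hri.ne']; field_simp
    rw [Real.rpow_neg hri.le]
    rw [h5] at h4
    have hrk : 0 < r i ^ κ := by positivity
    calc r i * v = b⁻¹ * (v * (b * (r i * r i ^ κ))) * (r i ^ κ)⁻¹ := by field_simp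
      _ ≤ _ := by gcongr
  -- Terms with radius above `r n` are bounded through the energy `S`, the others through the
  -- averages `A`. Both bounds decay geometrically away from `n`, so the sum is comparable with its
  -- two bounds at `i = n`.
  have hsplit : ∀ n, |u x - ⨍ y in Ω, u y| ≤ C₁ * (S * r n ^ (-κ) + r n * A) := by
    intro n
    obtain ⟨s1, t1⟩ := summable_and_tsum_pow_dist_le hq0 hq1 n
    obtain ⟨s2, t2⟩ := summable_and_tsum_pow_dist_le (q := 2⁻¹) (by norm_num) (by norm_num) n
    have hrn := hrpos n
    refine (hchain u hu x hx (fun i => b⁻¹ * S * r n ^ (-κ) * q ^ ((n - i) + (i - n)) +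
      r n * A * 2⁻¹ ^ ((n - i) + (i - n))) ((s1.mul_left _).add (s2.mul_left _)) ?_).trans ?_
    · intro i
      rcases lt_or_ge i n with h | h
      · refine (htwo i).trans (le_trans (le_of_eq ?_) (le_add_of_nonneg_right (by positivity)))
        have e : r i = r n * 2 ^ (n - i) := by
          simp only [hr]
          rw [div_mul_eq_mul_div, div_eq_div_iff (by positivity) (by positivity), mul_assoc,
            ← pow_add]
          congr 2; omega
        rw [e, Real.mul_rpow hrn.le (by positivity), Nat.sub_eq_zero_of_le h.le, add_zero, hq,
          ← Real.rpow_natCast, ← Real.rpow_natCast, ← Real.rpow_mul zero_le_two,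
          ← Real.rpow_mul zero_le_two, mul_comm (-κ)]
        ring
      · refine (hone i).trans (le_trans (le_of_eq ?_) (le_add_of_nonneg_left (by positivity)))
        have e : r i = r n * 2⁻¹ ^ (i - n) := by
          simp only [hr]
          rw [inv_pow, ← div_eq_mul_inv, div_div, ← pow_add]
          congr 2; omega
        rw [e, Nat.sub_eq_zero_of_le h, zero_add]; ring
    · rw [(s1.mul_left _).tsum_add (s2.mul_left _), tsum_mul_left, tsum_mul_left, hC₁,
        mul_assoc D (b⁻¹ * (2 / (1 - q)) + 4)]
      refine mul_le_mul_of_nonneg_left ?_ hD.le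
      have e4 : (2 : ℝ) / (1 - 2⁻¹) = 4 := by norm_num
      rw [e4] at t2
      have p1 : 0 ≤ S * r n ^ (-κ) := by positivity
      have p2 : 0 ≤ r n * A := by positivity
      have p3 : 0 ≤ b⁻¹ * (2 / (1 - q)) := by positivity
      calc _ ≤ b⁻¹ * S * r n ^ (-κ) * (2 / (1 - q)) + r n * A * 4 := by gcongr
        _ ≤ _ := by nlinarith
  have hQ0 : 0 < Q := by linarith
  have h0 : |u x - ⨍ y in Ω, u y| ≤ C₁ * (R * A) := by
    refine (hchain u hu x hx (fun i => R * A * 2⁻¹ ^ i)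
      ((summable_geometric_of_lt_one (by norm_num) (by norm_num)).mul_left _) fun i => ?_).trans ?_
    · refine (hone i).trans (le_of_eq ?_)
      simp only [hr, inv_pow]; ring
    · rw [tsum_mul_left, tsum_geometric_of_lt_one (by norm_num) (by norm_num), hC₁]
      have p2 : 0 ≤ R * A := by positivity
      have p3 : 0 ≤ b⁻¹ * (2 / (1 - q)) := by positivity
      rw [mul_assoc D (b⁻¹ * (2 / (1 - q)) + 4)]
      refine mul_le_mul_of_nonneg_left ?_ hD.le
      norm_num
      nlinarith
  have hpow : ∀ z : ℝ, 0 ≤ z → z ^ (1 - 2 / Q) * z ^ (2 / Q) = z := fun z hz => by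
    have : 0 < 1 - 2 / Q := by rw [sub_pos, div_lt_one hQ0]; exact hQ
    rw [← Real.rpow_add_of_nonneg hz this.le (by positivity)]; simp
  -- The radius that balances the two bounds is at most `R` unless `A R^{Q/2} ≤ S`; in that case the
  -- bound through `A` alone is good enough.
  rcases le_or_gt (A * R ^ (Q / 2)) S with h | h
  · refine h0.trans ?_
    have h1 : (A * R ^ (Q / 2)) ^ (2 / Q) ≤ S ^ (2 / Q) :=
      Real.rpow_le_rpow (by positivity) h (by positivity)
    rw [Real.mul_rpow hA (by positivity), ← Real.rpow_mul hR.le,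
      show Q / 2 * (2 / Q) = 1 by field_simp, Real.rpow_one] at h1
    have h2 : R * A ≤ A ^ (1 - 2 / Q) * S ^ (2 / Q) := by
      calc R * A = A ^ (1 - 2 / Q) * (A ^ (2 / Q) * R) := by
            rw [← mul_assoc, hpow A hA]; ring
        _ ≤ _ := by gcongr
    have h3 : 0 ≤ A ^ (1 - 2 / Q) * S ^ (2 / Q) := by positivity
    calc C₁ * (R * A) ≤ C₁ * (A ^ (1 - 2 / Q) * S ^ (2 / Q)) := by gcongr
      _ ≤ _ := by nlinarith
  · have hApos : 0 < A := by
      rcases hA.eq_or_lt with h' | h'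
      · rw [← h', zero_mul] at h; linarith
      · exact h'
    -- The balancing radius, for which `S δ^{-κ} = δ A`. A dyadic radius between `δ` and `2 δ`
    -- replaces it, at the price of the factor `3` in the final constant.
    set δ := (S / A) ^ (2 / Q) with hδ
    have hδpos : 0 < δ := by positivity
    have hδR : δ ≤ R := by
      have : S / A ≤ R ^ (Q / 2) := by rw [div_le_iff₀ hApos]; linarith
      refine (Real.rpow_le_rpow (by positivity) this (by positivity)).trans (le_of_eq ?_)
      rw [← Real.rpow_mul hR.le, show Q / 2 * (2 / Q) = 1 by field_simp, Real.rpow_one]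
    obtain ⟨n, hn1, hn2⟩ := exists_nat_pow_near ((one_le_div hδpos).2 hδR) (one_lt_two (α := ℝ))
    have hrn1 : δ ≤ r n := by
      simp only [hr]; rw [le_div_iff₀ (by positivity)]; rw [le_div_iff₀ hδpos] at hn1; linarith
    have hrn2 : r n ≤ 2 * δ := by
      simp only [hr]; rw [div_le_iff₀ (by positivity)]
      rw [div_lt_iff₀ hδpos, pow_succ] at hn2; linarith
    refine (hsplit n).trans ?_
    have e1 : δ * A = A ^ (1 - 2 / Q) * S ^ (2 / Q) := by
      rw [hδ, Real.div_rpow hS.le hA]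
      nth_rewrite 2 [← hpow A hA]
      field_simp
    have e2 : S * δ ^ (-κ) = A ^ (1 - 2 / Q) * S ^ (2 / Q) := by
      rw [hδ, ← Real.rpow_mul (by positivity), show 2 / Q * (-κ) = -(1 - 2 / Q) by
        rw [hκ]; field_simp, Real.rpow_neg (by positivity), Real.div_rpow hS.le hA]
      nth_rewrite 1 [← hpow S hS.le]
      field_simp
    have h1 : r n ^ (-κ) ≤ δ ^ (-κ) :=
      Real.rpow_le_rpow_of_nonpos hδpos hrn1 (by linarith)
    have h2 : S * r n ^ (-κ) ≤ A ^ (1 - 2 / Q) * S ^ (2 / Q) := by rw [← e2]; gcongr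
    have h3 : r n * A ≤ 2 * (A ^ (1 - 2 / Q) * S ^ (2 / Q)) := by rw [← e1]; nlinarith
    have h4 : 0 ≤ A ^ (1 - 2 / Q) * S ^ (2 / Q) := by positivity
    calc C₁ * (S * r n ^ (-κ) + r n * A) ≤ C₁ * (A ^ (1 - 2 / Q) * S ^ (2 / Q) +
          2 * (A ^ (1 - 2 / Q) * S ^ (2 / Q))) := by gcongr
      _ = _ := by ring

/-- Sobolev's inequality for the oscillation around the mean. -/
theorem CCPoincare.exists_sobolev_sub_mean (hΩ : IsOpen Ω) (hΩb : Bornology.IsBounded Ω)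
    (hc : ∀ j, Continuous (c j)) (hcont : CCContinuous c Ω) (hd : CCDoubling c Ω Q) (hQ : 2 < Q)
    (hp : CCPoincare c Ω) {R : ℝ} (hR : 0 < R)
    (hball : ∀ x ∈ Ω, ∀ r, R ≤ r → ccBall c Ω x r = Ω) :
    ∃ C > 0, ∀ u : EuclideanSpace ℝ (Fin N) → ℝ, ContDiff ℝ 1 u → ∀ S : ℝ, 0 < S →
      ∫ y in Ω, ‖xGrad c u y‖ ^ 2 ≤ S ^ 2 →
      ∫⁻ x in Ω, ENNReal.ofReal (|u x - ⨍ y in Ω, u y| ^ (2 * Q / (Q - 2))) ≤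
        ENNReal.ofReal (C * S ^ (2 * Q / (Q - 2))) := by
  obtain ⟨C, hC, H⟩ := hp.exists_hedberg hΩ hΩb hc hcont hd hQ hR hball
  set p := 2 * Q / (Q - 2) with hp'
  have hQ2 : 0 < Q - 2 := by linarith
  have hQ0 : 0 < Q := by linarith
  have hppos : 0 < p := by positivity
  refine ⟨C ^ p * (8 * (2 ^ Q) ^ 3), by positivity, fun u hu S hS hS2 => ?_⟩
  set w : EuclideanSpace ℝ (Fin N) → ℝ := fun y => ‖xGrad c u y‖ with hw
  have hwc : Continuous w := (continuous_xGrad hc hu).norm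
  have hwi : ∀ x s, IntegrableOn w (ccBall c Ω x s) := fun x s =>
    (hwc.integrableOn_of_isBounded hΩb).mono_set ccBall_subset
  obtain ⟨K, hK⟩ := hΩb.isCompact_closure.exists_bound_of_continuousOn hwc.continuousOn
  have hK' : ∀ x ∈ Ω, w x ≤ K := fun x hx =>
    (le_abs_self _).trans (hK x (subset_closure hx))
  set g : EuclideanSpace ℝ (Fin N) → ℝ≥0∞ := fun y => ENNReal.ofReal (w y) with hg
  set A : EuclideanSpace ℝ (Fin N) → ℝ := fun x => (ccMaximal c Ω R g x).toReal with hA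
  have hMtop : ∀ x, ccMaximal c Ω R g x ≠ ⊤ := fun x =>
    ((ccMaximal_le_of_le hΩ hcont (K := ENNReal.ofReal K)
      (fun y hy => ENNReal.ofReal_le_ofReal (hK' y hy)) x).trans_lt ENNReal.ofReal_lt_top).ne
  -- The exponent `p` is the one with `(1 - 2/Q) p = 2`: the maximal function appears squared, and
  -- its `L²` bound applies.
  have hpt : ∀ x ∈ Ω, |u x - ⨍ y in Ω, u y| ^ p ≤ C ^ p * S ^ (p - 2) * A x ^ 2 := by
    intro x hx
    have hA0 : 0 ≤ A x := ENNReal.toReal_nonneg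
    have h1 := H u hu x hx (A x) S hA0 hS (fun r hr => by
      rw [← ENNReal.ofReal_le_ofReal_iff hA0, hA, ENNReal.ofReal_toReal (hMtop x),
        ofReal_setAverage (hwi x r) (ae_of_all _ fun _ => norm_nonneg _)]
      exact le_ccMaximal hcont g hx hr) hS2
    refine (Real.rpow_le_rpow (abs_nonneg _) h1 hppos.le).trans (le_of_eq ?_)
    rw [Real.mul_rpow hC.le (by positivity), Real.mul_rpow (by positivity) (by positivity),
      ← Real.rpow_mul hA0, ← Real.rpow_mul hS.le,
      show (1 - 2 / Q) * p = 2 by rw [hp']; field_simp,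
      show 2 / Q * p = p - 2 by rw [hp']; field_simp; ring, Real.rpow_two]
    ring
  have hmax := hd.lintegral_ccMaximal_sq_le hΩ hΩb hcont R hwc.measurable
    (fun _ => norm_nonneg _) hK'
  have hSp : S ^ (p - 2) * S ^ 2 = S ^ p := by
    rw [← Real.rpow_two, ← Real.rpow_add hS]; congr 1; ring
  have hw2 : ∫⁻ x in Ω, ENNReal.ofReal (w x ^ 2) ≤ ENNReal.ofReal (S ^ 2) := by
    have hi : IntegrableOn (fun x => w x ^ 2) Ω := (hwc.pow 2).integrableOn_of_isBounded hΩb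
    rw [← ofReal_integral_eq_lintegral_ofReal hi
      (ae_of_all _ fun _ => sq_nonneg _)]
    exact ENNReal.ofReal_le_ofReal hS2
  calc _ ≤ ∫⁻ x in Ω, ENNReal.ofReal (C ^ p * S ^ (p - 2)) * ENNReal.ofReal (A x ^ 2) := by
        refine setLIntegral_mono' hΩ.measurableSet fun x hx => ?_
        rw [← ENNReal.ofReal_mul (by positivity)]
        exact ENNReal.ofReal_le_ofReal (hpt x hx)
    _ = ENNReal.ofReal (C ^ p * S ^ (p - 2)) * ∫⁻ x in Ω, ENNReal.ofReal (A x ^ 2) :=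
        lintegral_const_mul' _ _ ENNReal.ofReal_ne_top
    _ ≤ ENNReal.ofReal (C ^ p * S ^ (p - 2)) *
        (ENNReal.ofReal (8 * (2 ^ Q) ^ 3) * ENNReal.ofReal (S ^ 2)) := by
        gcongr
        exact hmax.trans (by gcongr)
    _ = _ := by
        rw [← ENNReal.ofReal_mul (by positivity), ← ENNReal.ofReal_mul (by positivity), ← hSp]
        congr 1; ring

end

section
variable {m N : ℕ} {c : VFields m N} {Ω : Set (EuclideanSpace ℝ (Fin N))} {Q : ℝ}

/-! ### Lipschitz vector fields with compact support -/

/-- Compactness is applied to `s ×ˢ s` rather than to `s`, because local constants say nothing about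
distant pairs. Near the diagonal the local Lipschitz bound works; off it the difference quotient is
continuous, hence locally bounded. -/
theorem LocallyLipschitz.exists_lipschitzOnWith {α β : Type*} [MetricSpace α]
    [PseudoMetricSpace β] {f : α → β} (hf : LocallyLipschitz f) {s : Set α} (hs : IsCompact s) :
    ∃ K, LipschitzOnWith K f s := by
  suffices h : ∃ C : ℝ, 0 ≤ C ∧ ∀ p ∈ s ×ˢ s, dist (f p.1) (f p.2) ≤ C * dist p.1 p.2 by
    obtain ⟨C, hC, h⟩ := h
    exact ⟨⟨C, hC⟩, LipschitzOnWith.of_dist_le_mul fun x hx y hy => h (x, y) ⟨hx, hy⟩⟩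
  refine (hs.prod hs).induction_on (p := fun S => ∃ C : ℝ, 0 ≤ C ∧ ∀ p ∈ S,
    dist (f p.1) (f p.2) ≤ C * dist p.1 p.2) ⟨0, le_rfl, by simp⟩ ?_ ?_ ?_
  · rintro S T hST ⟨C, hC, h⟩
    exact ⟨C, hC, fun p hp => h p (hST hp)⟩
  · rintro S T ⟨C, hC, h⟩ ⟨D, hD, h'⟩
    refine ⟨max C D, le_max_of_le_left hC, ?_⟩
    rintro p (hp | hp)
    · exact (h p hp).trans (by gcongr; exact le_max_left _ _)
    · exact (h' p hp).trans (by gcongr; exact le_max_right _ _)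
  · rintro ⟨x, y⟩ -
    rcases eq_or_ne x y with rfl | hxy
    · obtain ⟨K, t, ht, hK⟩ := hf x
      refine ⟨t ×ˢ t, mem_nhdsWithin_of_mem_nhds (prod_mem_nhds ht ht), K, K.2, ?_⟩
      exact fun p hp => hK.dist_le_mul _ hp.1 _ hp.2
    · have hc : ContinuousAt (fun p : α × α => dist (f p.1) (f p.2) / dist p.1 p.2) (x, y) := by
        refine ContinuousAt.div ?_ ?_ (dist_ne_zero.2 hxy)
        · exact ((hf.continuous.comp continuous_fst).dist
            (hf.continuous.comp continuous_snd)).continuousAt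
        · exact (continuous_fst.dist continuous_snd).continuousAt
      have hd : ∀ᶠ p : α × α in 𝓝 (x, y), 0 < dist p.1 p.2 :=
        (continuous_fst.dist continuous_snd).continuousAt.eventually
          (lt_mem_nhds (dist_pos.2 hxy))
      set C := dist (f x) (f y) / dist x y + 1
      have hC : 0 ≤ C := by positivity
      have hlt : ∀ᶠ p : α × α in 𝓝 (x, y), dist (f p.1) (f p.2) / dist p.1 p.2 < C :=
        hc.eventually (gt_mem_nhds (lt_add_one _))
      refine ⟨_, mem_nhdsWithin_of_mem_nhds (hd.and hlt), C, hC, ?_⟩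
      rintro p ⟨hp1, hp2⟩
      exact ((div_lt_iff₀ hp1).1 hp2).le

/-- A function that is Lipschitz on a ball agrees there with a Lipschitz function of compact
support. -/
theorem LipschitzOnWith.exists_eq_zero_outside {f : EuclideanSpace ℝ (Fin N) → ℝ} {K : NNReal}
    {r : ℝ} (hf : LipschitzOnWith K f (Metric.closedBall 0 r)) :
    ∃ (L : NNReal) (g : EuclideanSpace ℝ (Fin N) → ℝ), LipschitzWith L g ∧
      (∀ x ∈ Metric.closedBall 0 r, g x = f x) ∧
      ∀ x ∉ Metric.closedBall (0 : EuclideanSpace ℝ (Fin N)) (r + 1), g x = 0 := by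
  obtain ⟨g₀, hg₀, heq⟩ := hf.extend_real
  obtain ⟨M, hM⟩ := (isCompact_closedBall (0 : EuclideanSpace ℝ (Fin N)) r).exists_bound_of_continuousOn
    hf.continuousOn
  -- A Lipschitz tent that is at least `|M|` on the ball of radius `r` and vanishes outside radius
  -- `r + 1`. Clamping the extension between `-τ` and `τ` cuts it off without changing it on the
  -- inner ball.
  set τ : EuclideanSpace ℝ (Fin N) → ℝ := fun x => max (|M| * (r + 1 - ‖x‖)) 0 with hτ
  have hτL : LipschitzWith ⟨|M|, abs_nonneg M⟩ τ := by
    refine LipschitzWith.max_const ?_ 0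
    refine LipschitzWith.of_dist_le_mul fun x y => ?_
    rw [Real.dist_eq, ← mul_sub, abs_mul, abs_abs]
    change _ ≤ |M| * dist x y
    gcongr
    rw [show r + 1 - ‖x‖ - (r + 1 - ‖y‖) = -(‖x‖ - ‖y‖) by ring, abs_neg, dist_eq_norm]
    exact abs_norm_sub_norm_le _ _
  refine ⟨_, fun x => max (-τ x) (min (g₀ x) (τ x)), hτL.neg.max (hg₀.min hτL), ?_, ?_⟩
  · intro x hx
    have h1 := hM x hx
    rw [Real.norm_eq_abs, heq hx] at h1
    have h2 : |g₀ x| ≤ τ x := by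
      refine le_max_of_le_left ?_
      rw [mem_closedBall_zero_iff] at hx
      nlinarith [le_abs_self M, abs_nonneg M]
    beta_reduce
    rw [heq hx, min_eq_left (abs_le.1 h2).2, max_eq_right (abs_le.1 h2).1]
  · intro x hx
    rw [mem_closedBall_zero_iff, not_le] at hx
    have : τ x = 0 := max_eq_right (mul_nonpos_of_nonneg_of_nonpos (abs_nonneg _) (by linarith))
    simp only [this, neg_zero]
    exact max_eq_left (min_le_right _ _)

theorem LipschitzWith.mul_of_bounded {α : Type*} [PseudoMetricSpace α] {f g : α → ℝ}
    {K L A B : NNReal} (hf : LipschitzWith K f) (hg : LipschitzWith L g) (hA : ∀ x, |f x| ≤ A)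
    (hB : ∀ x, |g x| ≤ B) : LipschitzWith (A * L + B * K) (fun x => f x * g x) := by
  refine LipschitzWith.of_dist_le_mul fun x y => ?_
  rw [Real.dist_eq, show f x * g x - f y * g y = f x * (g x - g y) + g y * (f x - f y) by ring]
  refine (abs_add_le _ _).trans ?_
  rw [abs_mul, abs_mul]
  have h1 := hf.dist_le_mul x y
  have h2 := hg.dist_le_mul x y
  rw [Real.dist_eq] at h1 h2
  calc _ ≤ A * (L * dist x y) + B * (K * dist x y) := by
        gcongr
        · exact hA x
        · exact hB y
    _ = _ := by push_cast; ring

/-! ### Divergence integrals and fields without flux out of `Ω` -/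

theorem integral_lineDeriv_eq_zero {f : EuclideanSpace ℝ (Fin N) → ℝ} {K : NNReal}
    (hf : LipschitzWith K f) (hf' : HasCompactSupport f) (v : EuclideanSpace ℝ (Fin N)) :
    ∫ x, lineDeriv ℝ f x v = 0 := by
  have := LipschitzWith.integral_lineDeriv_mul_eq (μ := volume)
    (LipschitzWith.const (α := EuclideanSpace ℝ (Fin N)) (1 : ℝ)) hf hf' (-v)
  simpa [lineDeriv] using this.symm

theorem LipschitzWith.abs_lineDeriv_le {f : EuclideanSpace ℝ (Fin N) → ℝ} {K : NNReal}
    (hf : LipschitzWith K f) (x v : EuclideanSpace ℝ (Fin N)) : |lineDeriv ℝ f x v| ≤ K * ‖v‖ := by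
  have := norm_lineDeriv_le_of_lipschitz ℝ hf (x₀ := x) (v := v)
  simpa using this

theorem LipschitzWith.integrableOn_lineDeriv {f : EuclideanSpace ℝ (Fin N) → ℝ} {K : NNReal}
    (hf : LipschitzWith K f) (v : EuclideanSpace ℝ (Fin N)) {s : Set (EuclideanSpace ℝ (Fin N))}
    (hs : Bornology.IsBounded s) : IntegrableOn (fun x => lineDeriv ℝ f x v) s := by
  refine Measure.integrableOn_of_bounded (M := K * ‖v‖) hs.measure_lt_top.ne ?_ ?_
  · exact (measurable_lineDeriv hf.continuous).aestronglyMeasurable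
  · exact ae_of_all _ fun x => hf.abs_lineDeriv_le x v

theorem sum_coord_mul_apply (ℓ : EuclideanSpace ℝ (Fin N) →L[ℝ] ℝ) (v : EuclideanSpace ℝ (Fin N)) :
    ∑ i, v i * ℓ (EuclideanSpace.single i 1) = ℓ v := by
  conv_rhs => rw [← (EuclideanSpace.basisFun (Fin N) ℝ).sum_repr v]
  simp [map_sum]

theorem norm_xGrad_ge (u : EuclideanSpace ℝ (Fin N) → ℝ) (x : EuclideanSpace ℝ (Fin N)) (j : Fin m) :
    |fderiv ℝ u x (c j x)| ≤ ‖xGrad c u x‖ := by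
  have := PiLp.norm_apply_le (xGrad c u x) j
  simpa [xGrad] using this

/-- If test functions converge in the mean to `1` on `Ω` while their `X`-gradients tend to `0`,
then `X_j` has no flux out of `Ω`. -/
theorem setIntegral_div_eq_zero (hΩ : IsOpen Ω) (hΩb : Bornology.IsBounded Ω)
    {u : ℕ → EuclideanSpace ℝ (Fin N) → ℝ}
    (hu : ∀ k, IsTest ⊤ Ω (u k)) (hu1 : Tendsto (fun k => ∫ x in Ω, |u k x - 1|) atTop (𝓝 0))
    (huX : Tendsto (fun k => ∫ x in Ω, ‖xGrad c (u k) x‖) atTop (𝓝 0)) (hc : ∀ j, Continuous (c j))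
    (j : Fin m) {e : Fin N → EuclideanSpace ℝ (Fin N) → ℝ} (he : ∀ i, ∀ x ∈ Ω, e i x = c j x i)
    {ψ : EuclideanSpace ℝ (Fin N) → ℝ} {B : ℝ} (hψ : ∀ x ∈ Ω, |ψ x| ≤ B) {K : NNReal}
    (hL : ∀ i, LipschitzWith K (fun x => e i x * ψ x)) :
    ∫ x in Ω, ∑ i, lineDeriv ℝ (fun x => e i x * ψ x) x (EuclideanSpace.single i 1) = 0 := by
  set F : Fin N → EuclideanSpace ℝ (Fin N) → ℝ := fun i x => e i x * ψ x with hF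
  set dv : EuclideanSpace ℝ (Fin N) → ℝ :=
    fun x => ∑ i, lineDeriv ℝ (F i) x (EuclideanSpace.single i 1) with hdv
  have hdvb : ∀ x, |dv x| ≤ N * K := fun x => by
    refine (Finset.abs_sum_le_sum_abs _ _).trans ?_
    refine (Finset.sum_le_sum fun i _ => (hL i).abs_lineDeriv_le x _).trans ?_
    simp
  have hdvi : IntegrableOn dv Ω := integrable_finsetSum _ fun i _ =>
    (hL i).integrableOn_lineDeriv _ hΩb
  have hdvm : Measurable dv := Finset.measurable_fun_sum _ fun i _ =>
    measurable_lineDeriv (hL i).continuous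
  have hux : ∀ k, ∀ x ∉ Ω, u k x = 0 := fun k x hx =>
    image_eq_zero_of_notMem_tsupport fun h => hx ((hu k).2.2 h)
  -- Integration by parts: the integral of `div (ψ X_j) u_k` is that of `-ψ X_j u_k`. The extension
  -- `e` agrees with `c j` only on `Ω`, which is enough because `u k` vanishes outside.
  have hparts : ∀ k, |∫ x in Ω, dv x * u k x| ≤ B * ∫ x in Ω, ‖xGrad c (u k) x‖ := by
    intro k
    obtain ⟨hk1, hk2, hk3⟩ := hu k
    obtain ⟨D, hD⟩ := (hk1.of_le
      (by exact_mod_cast le_top : (1 : WithTop ℕ∞) ≤ _)).lipschitzWith_of_hasCompactSupport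
      hk2 one_ne_zero
    have hk1' : Differentiable ℝ (u k) := hk1.differentiable (by simp)
    have hfz : ∀ x ∉ Ω, fderiv ℝ (u k) x = 0 := fun x hx =>
      image_eq_zero_of_notMem_tsupport fun h => hx (hk3 (tsupport_fderiv_subset ℝ h))
    have e0 : ∫ x in Ω, dv x * u k x = ∫ x, dv x * u k x :=
      setIntegral_eq_integral_of_forall_compl_eq_zero fun x hx => by rw [hux k x hx, mul_zero]
    have hint : ∀ i, Integrable (fun x => lineDeriv ℝ (F i) x (EuclideanSpace.single i 1) * u k x) := by
      intro i
      refine (hk1.continuous.integrable_of_hasCompactSupport hk2).bdd_mul (c := K)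
        (measurable_lineDeriv (hL i).continuous).aestronglyMeasurable ?_
      refine ae_of_all _ fun x => ?_
      have := (hL i).abs_lineDeriv_le x (EuclideanSpace.single i 1)
      simpa using this
    have e1 : ∫ x, dv x * u k x = ∑ i, ∫ x, F i x * -(fderiv ℝ (u k) x (EuclideanSpace.single i 1)) := by
      simp only [hdv, Finset.sum_mul]
      rw [integral_finsetSum _ fun i _ => hint i]
      refine Finset.sum_congr rfl fun i _ => ?_
      rw [LipschitzWith.integral_lineDeriv_mul_eq (hL i) hD hk2]
      refine integral_congr_ae (ae_of_all _ fun x => ?_)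
      simp only
      rw [(hk1' x).lineDeriv_eq_fderiv, map_neg, mul_comm]
    have hint2 : ∀ i, Integrable (fun x => F i x * -(fderiv ℝ (u k) x (EuclideanSpace.single i 1))) := by
      intro i
      have hcd : Continuous (fun x => fderiv ℝ (u k) x (EuclideanSpace.single i 1)) :=
        (hk1.continuous_fderiv (by simp)).clm_apply continuous_const
      refine Continuous.integrable_of_hasCompactSupport ((hL i).continuous.mul hcd.neg) ?_
      refine HasCompactSupport.mul_left ?_
      refine HasCompactSupport.intro hk2 fun x hx => ?_
      have : fderiv ℝ (u k) x = 0 :=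
        image_eq_zero_of_notMem_tsupport fun h => hx (tsupport_fderiv_subset ℝ h)
      simp [this]
    have e2 : ∫ x, dv x * u k x = ∫ x in Ω, -(ψ x * fderiv ℝ (u k) x (c j x)) := by
      rw [e1, ← integral_finsetSum _ fun i _ => hint2 i]
      rw [← setIntegral_eq_integral_of_forall_compl_eq_zero (s := Ω)]
      · have : ∀ x ∈ Ω, (∑ i, F i x * -(fderiv ℝ (u k) x (EuclideanSpace.single i 1))) =
            -(ψ x * fderiv ℝ (u k) x (c j x)) := by
          intro x hx
          rw [← sum_coord_mul_apply, Finset.mul_sum, ← Finset.sum_neg_distrib]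
          refine Finset.sum_congr rfl fun i _ => ?_
          simp only [hF]
          rw [he i x hx]; ring
        refine integral_congr_ae ?_
        filter_upwards [ae_restrict_mem hΩ.measurableSet] with x hx using this x hx
      · intro x hx
        simp [hfz x hx]
    rw [e0, e2]
    have hXi : IntegrableOn (fun x => ‖xGrad c (u k) x‖) Ω :=
      ((continuous_xGrad hc (hk1.of_le (by exact_mod_cast le_top))).norm).integrableOn_of_isBounded hΩb
    refine abs_integral_le_integral_abs.trans ?_
    rw [← integral_const_mul]
    refine integral_mono_of_nonneg (ae_of_all _ fun _ => abs_nonneg _) (hXi.const_mul B)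
      (ae_of_all _ fun x => ?_)
    simp only
    rw [abs_neg, abs_mul]
    by_cases hx : x ∈ Ω
    · exact mul_le_mul (hψ x hx) (norm_xGrad_ge _ _ _) (abs_nonneg _) ((abs_nonneg _).trans (hψ x hx))
    · have : xGrad c (u k) x = 0 := by simp [xGrad, hfz x hx]; rfl
      simp [hfz x hx, this]
  -- Write `1 = u_k - (u_k - 1)`: the first part is controlled by the `X`-gradient, the second by
  -- the bounded divergence and the `L¹` distance of `u_k` from `1`.
  have hdiff : ∀ k, |∫ x in Ω, dv x| ≤ B * (∫ x in Ω, ‖xGrad c (u k) x‖) +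
      N * K * ∫ x in Ω, |u k x - 1| := by
    intro k
    have hui : IntegrableOn (u k) Ω := (hu k).1.continuous.integrableOn_of_isBounded hΩb
    have hu1i : IntegrableOn (fun x => u k x - 1) Ω :=
      hui.sub (integrableOn_const hΩb.measure_lt_top.ne)
    have hp1 : Integrable (fun x => dv x * u k x) (volume.restrict Ω) :=
      Integrable.bdd_mul (c := N * K) hui hdvm.aestronglyMeasurable (ae_of_all _ hdvb)
    have hp2 : Integrable (fun x => dv x * (u k x - 1)) (volume.restrict Ω) :=
      Integrable.bdd_mul (c := N * K) hu1i hdvm.aestronglyMeasurable (ae_of_all _ hdvb)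
    have e : ∫ x in Ω, dv x = (∫ x in Ω, dv x * u k x) - ∫ x in Ω, dv x * (u k x - 1) := by
      rw [← integral_sub hp1 hp2]
      congr 1; ext x; ring
    rw [e]
    refine (abs_sub _ _).trans (add_le_add (hparts k) ?_)
    refine abs_integral_le_integral_abs.trans ?_
    rw [← integral_const_mul]
    refine integral_mono hp2.abs (hu1i.abs.const_mul _) fun x => ?_
    simp only
    rw [abs_mul]
    gcongr
    exact hdvb x
  have hlim : Tendsto (fun k => B * (∫ x in Ω, ‖xGrad c (u k) x‖) +
      N * K * ∫ x in Ω, |u k x - 1|) atTop (𝓝 0) := by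
    simpa using (huX.const_mul B).add (hu1.const_mul (N * K : ℝ))
  exact abs_nonpos_iff.1 (ge_of_tendsto' hlim hdiff)
end

section
variable {m N : ℕ} {c : VFields m N} {Ω : Set (EuclideanSpace ℝ (Fin N))} {Q : ℝ}

/-! ### A kernel whose gradient is controlled by itself -/

/-- The kernel `(ε^2 + |z|^2)^{-N}`. -/
def powKernel (N : ℕ) (ε : ℝ) (z : EuclideanSpace ℝ (Fin N)) : ℝ := ((ε ^ 2 + ‖z‖ ^ 2) ^ N)⁻¹

theorem powKernel_pos {ε : ℝ} (hε : 0 < ε) (z : EuclideanSpace ℝ (Fin N)) : 0 < powKernel N ε z := by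
  unfold powKernel; positivity

theorem hasFDerivAt_powKernel {ε : ℝ} (hε : 0 < ε) (z : EuclideanSpace ℝ (Fin N)) :
    HasFDerivAt (powKernel N ε)
      ((-(N / ((ε ^ 2 + ‖z‖ ^ 2) * (ε ^ 2 + ‖z‖ ^ 2) ^ N)) : ℝ) • ((2 : ℝ) • innerSL ℝ z)) z := by
  set s := ε ^ 2 + ‖z‖ ^ 2 with hs
  have hspos : 0 < s := by positivity
  have h1 : HasDerivAt (fun t : ℝ => (t ^ N)⁻¹) (-(N / (s * s ^ N))) s := by
    have := (hasDerivAt_pow N s).inv (pow_pos hspos N).ne'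
    convert! this using 1
    rcases N with _ | n
    · simp
    · simp only [Nat.add_sub_cancel]
      field_simp
      ring
  have h2 : HasFDerivAt (fun z : EuclideanSpace ℝ (Fin N) => ε ^ 2 + ‖z‖ ^ 2)
      ((2 : ℝ) • innerSL ℝ z) z := by
    have := ((hasStrictFDerivAt_norm_sq z).hasFDerivAt).const_add (ε ^ 2)
    convert! this using 1
    ext v; simp [two_smul]
  exact HasDerivAt.comp_hasFDerivAt (h₂ := fun t : ℝ => (t ^ N)⁻¹) z h1 h2

theorem contDiff_powKernel {ε : ℝ} (hε : 0 < ε) : ContDiff ℝ 1 (powKernel N ε) := by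
  unfold powKernel
  refine ContDiff.inv ((contDiff_const.add (contDiff_norm_sq ℝ)).pow N) fun z => ?_
  positivity

theorem norm_fderiv_powKernel {ε : ℝ} (hε : 0 < ε) (z : EuclideanSpace ℝ (Fin N)) :
    ‖fderiv ℝ (powKernel N ε) z‖ = 2 * N * ‖z‖ / (ε ^ 2 + ‖z‖ ^ 2) * powKernel N ε z := by
  have h : 0 ≤ (N : ℝ) / ((ε ^ 2 + ‖z‖ ^ 2) * (ε ^ 2 + ‖z‖ ^ 2) ^ N) := by positivity
  rw [(hasFDerivAt_powKernel hε z).fderiv, norm_smul, norm_smul, innerSL_apply_norm, norm_neg,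
    Real.norm_of_nonneg h, powKernel]
  simp only [Real.norm_ofNat]
  field_simp

/-- The constant does not depend on `ε`. A Lipschitz factor of size `‖z‖` therefore compensates the
gradient of the kernel at every scale, which is what makes the estimate of the potential uniform. -/
theorem norm_fderiv_powKernel_mul_le {ε : ℝ} (hε : 0 < ε) (z : EuclideanSpace ℝ (Fin N)) :
    ‖z‖ * ‖fderiv ℝ (powKernel N ε) z‖ ≤ 2 * N * powKernel N ε z := by
  rw [norm_fderiv_powKernel hε, ← mul_assoc]
  refine mul_le_mul_of_nonneg_right ?_ (powKernel_pos hε z).le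
  rw [← mul_div_assoc, div_le_iff₀ (by positivity)]
  have : 0 ≤ 2 * (N : ℝ) * ε ^ 2 := by positivity
  nlinarith

theorem powKernel_le {ε : ℝ} (hε : 0 < ε) (z : EuclideanSpace ℝ (Fin N)) :
    powKernel N ε z ≤ ((ε ^ 2) ^ N)⁻¹ := by
  unfold powKernel
  gcongr
  exact le_add_of_nonneg_right (sq_nonneg _)

/-- This bound degenerates as `ε → 0`; it only serves as a dominating constant for differentiation
under the integral and as a Lipschitz constant. -/
theorem norm_fderiv_powKernel_le {ε : ℝ} (hε : 0 < ε) (z : EuclideanSpace ℝ (Fin N)) :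
    ‖fderiv ℝ (powKernel N ε) z‖ ≤ N / ε * ((ε ^ 2) ^ N)⁻¹ := by
  rw [norm_fderiv_powKernel hε]
  refine mul_le_mul ?_ (powKernel_le hε z) (powKernel_pos hε z).le (by positivity)
  rw [div_le_div_iff₀ (by positivity) hε]
  have : (0 : ℝ) ≤ N := by positivity
  nlinarith [mul_nonneg this (sq_nonneg (ε - ‖z‖))]

theorem lipschitzWith_powKernel_sub {ε : ℝ} (hε : 0 < ε) (x : EuclideanSpace ℝ (Fin N)) :
    ∃ K, LipschitzWith K (fun y => powKernel N ε (x - y)) := by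
  have h : LipschitzWith (N / ε * ((ε ^ 2) ^ N)⁻¹).toNNReal (powKernel N ε) := by
    refine lipschitzWith_of_nnnorm_fderiv_le ((contDiff_powKernel hε).differentiable one_ne_zero)
      fun z => ?_
    rw [← NNReal.coe_le_coe, Real.coe_toNNReal _ (by positivity)]
    exact norm_fderiv_powKernel_le hε z
  exact ⟨_, h.comp ((LipschitzWith.const x).sub LipschitzWith.id)⟩

/-- The potential of a bounded set with respect to `powKernel`. -/
def setPotential (ε : ℝ) (S : Set (EuclideanSpace ℝ (Fin N))) (x : EuclideanSpace ℝ (Fin N)) : ℝ :=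
  ∫ y in S, powKernel N ε (x - y)

section potential
variable {ε : ℝ} {S : Set (EuclideanSpace ℝ (Fin N))}

theorem integrableOn_powKernel_sub (hε : 0 < ε) (hS : Bornology.IsBounded S)
    (x : EuclideanSpace ℝ (Fin N)) : IntegrableOn (fun y => powKernel N ε (x - y)) S :=
  ((contDiff_powKernel hε).continuous.comp (continuous_sub_left x)).integrableOn_of_isBounded hS

theorem integrableOn_fderiv_powKernel_sub (hε : 0 < ε) (hS : Bornology.IsBounded S)
    (x : EuclideanSpace ℝ (Fin N)) : IntegrableOn (fun y => fderiv ℝ (powKernel N ε) (x - y)) S :=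
  (((contDiff_powKernel hε).continuous_fderiv one_ne_zero).comp
    (continuous_sub_left x)).integrableOn_of_isBounded hS

theorem hasFDerivAt_setPotential (hε : 0 < ε) (hS : Bornology.IsBounded S)
    (x : EuclideanSpace ℝ (Fin N)) :
    HasFDerivAt (setPotential ε S) (∫ y in S, fderiv ℝ (powKernel N ε) (x - y)) x := by
  refine hasFDerivAt_integral_of_dominated_of_fderiv_le (s := univ)
    (bound := fun _ => N / ε * ((ε ^ 2) ^ N)⁻¹) (F := fun x y => powKernel N ε (x - y))
    (F' := fun x y => fderiv ℝ (powKernel N ε) (x - y)) univ_mem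
    (Eventually.of_forall fun z => (integrableOn_powKernel_sub hε hS z).aestronglyMeasurable)
    (integrableOn_powKernel_sub hε hS x) (integrableOn_fderiv_powKernel_sub hε hS x).aestronglyMeasurable
    (ae_of_all _ fun y z _ => norm_fderiv_powKernel_le hε _)
    (integrableOn_const hS.measure_lt_top.ne) (ae_of_all _ fun y z _ => ?_)
  exact (((contDiff_powKernel hε).differentiable one_ne_zero (z - y)).hasFDerivAt).comp z
    ((hasFDerivAt_id z).sub_const y)

theorem contDiff_setPotential (hε : 0 < ε) (hS : Bornology.IsBounded S) :
    ContDiff ℝ 1 (setPotential ε S) := by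
  rw [contDiff_one_iff_fderiv]
  refine ⟨fun x => (hasFDerivAt_setPotential hε hS x).differentiableAt, ?_⟩
  have : fderiv ℝ (setPotential ε S) = fun x => ∫ y in S, fderiv ℝ (powKernel N ε) (x - y) :=
    funext fun x => (hasFDerivAt_setPotential hε hS x).fderiv
  rw [this]
  refine continuous_of_dominated (bound := fun _ => N / ε * ((ε ^ 2) ^ N)⁻¹)
    (fun x => (integrableOn_fderiv_powKernel_sub hε hS x).aestronglyMeasurable)
    (fun x => ae_of_all _ fun y => norm_fderiv_powKernel_le hε _)
    (integrableOn_const hS.measure_lt_top.ne) (ae_of_all _ fun y => ?_)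
  exact ((contDiff_powKernel hε).continuous_fderiv one_ne_zero).comp (continuous_sub_right y)

theorem setPotential_pos (hε : 0 < ε) (hS : Bornology.IsBounded S)
    (hS0 : volume S ≠ 0) (x : EuclideanSpace ℝ (Fin N)) : 0 < setPotential ε S x := by
  unfold setPotential
  rw [integral_pos_iff_support_of_nonneg (fun y => (powKernel_pos hε _).le)
    (integrableOn_powKernel_sub hε hS x)]
  have : (Function.support fun y => powKernel N ε (x - y)) = univ :=
    eq_univ_of_forall fun y => (powKernel_pos hε _).ne'
  rw [this, Measure.restrict_apply_univ]
  exact pos_iff_ne_zero.2 hS0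

end potential

/-- A compactly supported Lipschitz field without flux out of `Ω` differentiates the potential of
the complement of `Ω` at most by a multiple of this potential, uniformly in `ε`. -/
theorem abs_fderiv_setPotential_le (hΩ : IsOpen Ω) {r : ℝ}
    {e : Fin N → EuclideanSpace ℝ (Fin N) → ℝ} {L : NNReal} (hL : ∀ i, LipschitzWith L (e i))
    (he0 : ∀ i, ∀ x ∉ Metric.closedBall (0 : EuclideanSpace ℝ (Fin N)) r, e i x = 0)
    {ε : ℝ} (hε : 0 < ε) {x : EuclideanSpace ℝ (Fin N)}
    (hflux : ∀ K, (∀ i, LipschitzWith K fun y => e i y * powKernel N ε (x - y)) →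
      ∫ y in Ω, ∑ i, lineDeriv ℝ (fun y => e i y * powKernel N ε (x - y)) y
        (EuclideanSpace.single i 1) = 0)
    {v : EuclideanSpace ℝ (Fin N)} (hv : ∀ i, v i = e i x) :
    |fderiv ℝ (setPotential ε (Metric.closedBall 0 r \ Ω)) x v| ≤
      N * (L * (2 * N + 1)) * setPotential ε (Metric.closedBall 0 r \ Ω) x := by
  set S := Metric.closedBall (0 : EuclideanSpace ℝ (Fin N)) r \ Ω with hS
  have hSb : Bornology.IsBounded S := Metric.isBounded_closedBall.subset sdiff_subset
  have hSm : MeasurableSet S := measurableSet_closedBall.diff hΩ.measurableSet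
  set ρ := powKernel N ε with hρ
  have hρd : Differentiable ℝ ρ := (contDiff_powKernel hε).differentiable one_ne_zero
  set ψ : EuclideanSpace ℝ (Fin N) → ℝ := fun y => ρ (x - y) with hψ
  set b : Fin N → EuclideanSpace ℝ (Fin N) := fun i => EuclideanSpace.single i 1 with hb
  have hbn : ∀ i, ‖b i‖ = 1 := fun i => by simp [hb]
  have hecs : ∀ i, HasCompactSupport (e i) := fun i =>
    HasCompactSupport.intro (isCompact_closedBall 0 r) (he0 i)
  obtain ⟨Kψ, hKψ⟩ := lipschitzWith_powKernel_sub hε x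
  have hbd : ∃ A : NNReal, ∀ i y, |e i y| ≤ A := by
    have h1 : ∀ i, ∃ A : ℝ, ∀ y, ‖e i y‖ ≤ A := fun i =>
      (hecs i).exists_bound_of_continuous (hL i).continuous
    choose A hA using h1
    refine ⟨(∑ i, |A i|).toNNReal, fun i y => ?_⟩
    rw [Real.coe_toNNReal _ (Finset.sum_nonneg fun i _ => abs_nonneg _)]
    exact (hA i y).trans ((le_abs_self _).trans
      (Finset.single_le_sum (f := fun i => |A i|) (fun i _ => abs_nonneg _) (Finset.mem_univ i)))
  obtain ⟨A, hA⟩ := hbd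
  have hψB : ∀ y, |ψ y| ≤ (((ε ^ 2) ^ N)⁻¹).toNNReal := fun y => by
    rw [Real.coe_toNNReal _ (by positivity), abs_of_pos (powKernel_pos hε _)]
    exact powKernel_le hε _
  set F : Fin N → EuclideanSpace ℝ (Fin N) → ℝ := fun i y => e i y * ψ y with hF
  obtain ⟨K, hK⟩ : ∃ K, ∀ i, LipschitzWith K (F i) :=
    ⟨_, fun i => (hL i).mul_of_bounded hKψ (hA i) hψB⟩
  have hFcs : ∀ i, HasCompactSupport (F i) := fun i => (hecs i).mul_right
  set dv : EuclideanSpace ℝ (Fin N) → ℝ := fun y => ∑ i, lineDeriv ℝ (F i) y (b i) with hdv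
  have hF0 : ∀ i, ∀ y ∉ Metric.closedBall (0 : EuclideanSpace ℝ (Fin N)) r,
      lineDeriv ℝ (F i) y (b i) = 0 := by
    intro i y hy
    have : F i =ᶠ[𝓝 y] fun _ => 0 := by
      filter_upwards [Metric.isClosed_closedBall.isOpen_compl.mem_nhds hy] with z hz
      simp only [hF]; rw [he0 i z hz, zero_mul]
    rw [this.lineDeriv_eq]
    simp [lineDeriv]
  have hli : ∀ i, Integrable (fun y => lineDeriv ℝ (F i) y (b i)) := by
    intro i
    rw [← integrableOn_iff_integrable_of_support_subset (s := Metric.closedBall 0 r)]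
    · exact (hK i).integrableOn_lineDeriv _ Metric.isBounded_closedBall
    · intro y hy
      by_contra h
      exact hy (hF0 i y h)
  have hdvi : Integrable dv := integrable_finsetSum _ fun i _ => hli i
  -- The divergence has integral zero over the whole space by compact support and over `Ω` by the
  -- flux hypothesis, hence over the remaining part `S` of the ball.
  have hdvS : ∫ y in S, dv y = 0 := by
    have h1 : ∫ y, dv y = 0 := by
      rw [integral_finsetSum _ fun i _ => hli i]
      exact Finset.sum_eq_zero fun i _ => integral_lineDeriv_eq_zero (hK i) (hFcs i) _
    have h2 := integral_add_compl hΩ.measurableSet hdvi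
    rw [h1, hflux K hK, zero_add] at h2
    rw [← h2]
    symm
    refine setIntegral_eq_of_subset_of_forall_sdiff_eq_zero hΩ.measurableSet.compl
      (fun y hy => hy.2) fun y hy => Finset.sum_eq_zero fun i _ => hF0 i y fun h => hy.2 ⟨h, hy.1⟩
  have hae : ∀ᵐ y, ∀ i, LineDifferentiableAt ℝ (e i) y (b i) :=
    ae_all_iff.2 fun i => (hL i).ae_lineDifferentiableAt (b i)
  -- Adding the divergence in `y` of `e(y) ρ(x - y)` costs nothing after integration over `S`, and
  -- it turns the coefficient `v = e(x)` of `∇ρ(x - y)` into the difference `e(x) - e(y)`, which the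
  -- Lipschitz constant controls. Only the harmless term `(div e) ρ` is left over.
  have hprod : ∀ᵐ y, (∑ i, v i * fderiv ℝ ρ (x - y) (b i)) + dv y =
      ∑ i, ((e i x - e i y) * fderiv ℝ ρ (x - y) (b i) + lineDeriv ℝ (e i) y (b i) * ψ y) := by
    filter_upwards [hae] with y hy
    rw [hdv, ← Finset.sum_add_distrib]
    refine Finset.sum_congr rfl fun i _ => ?_
    have h1 := (hy i).hasLineDerivAt
    have h2 : HasFDerivAt ψ (-(fderiv ℝ ρ (x - y))) y := by
      have := ((hρd (x - y)).hasFDerivAt).comp y ((hasFDerivAt_id y).const_sub x)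
      convert! this using 1
      ext v; simp
    have h3 := h2.hasLineDerivAt (b i)
    have h4 : HasLineDerivAt ℝ (F i) (lineDeriv ℝ (e i) y (b i) * ψ y +
        e i y * (-(fderiv ℝ ρ (x - y))) (b i)) y (b i) := by
      have := HasDerivAt.mul h1 h3
      simp only [zero_smul, add_zero] at this
      exact this
    rw [h4.lineDeriv, hv i]
    simp only [neg_apply]
    ring
  have hfd : fderiv ℝ (setPotential ε S) x v = ∫ y in S, ∑ i, v i * fderiv ℝ ρ (x - y) (b i) := by
    rw [(hasFDerivAt_setPotential hε hSb x).fderiv,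
      ContinuousLinearMap.integral_apply (integrableOn_fderiv_powKernel_sub hε hSb x)]
    refine integral_congr_ae (ae_of_all _ fun y => ?_)
    exact (sum_coord_mul_apply _ _).symm
  have hint1 : IntegrableOn (fun y => ∑ i, v i * fderiv ℝ ρ (x - y) (b i)) S := by
    have : (fun y => ∑ i, v i * fderiv ℝ ρ (x - y) (b i)) = fun y => fderiv ℝ ρ (x - y) v :=
      funext fun y => sum_coord_mul_apply _ _
    rw [this]
    exact (ContinuousLinearMap.apply ℝ ℝ v).integrable_comp (integrableOn_fderiv_powKernel_sub hε hSb x)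
  have hfd2 : fderiv ℝ (setPotential ε S) x v =
      ∫ y in S, ((∑ i, v i * fderiv ℝ ρ (x - y) (b i)) + dv y) := by
    rw [integral_add hint1 hdvi.integrableOn, hdvS, add_zero, hfd]
  rw [hfd2, ← Real.norm_eq_abs, setPotential, ← integral_const_mul]
  refine norm_integral_le_of_norm_le ((integrableOn_powKernel_sub hε hSb x).const_mul _) ?_
  filter_upwards [ae_restrict_of_ae hprod] with y hy
  rw [hy]
  refine (norm_sum_le _ _).trans ?_
  have : ∀ i ∈ Finset.univ, ‖(e i x - e i y) * fderiv ℝ ρ (x - y) (b i) +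
      lineDeriv ℝ (e i) y (b i) * ψ y‖ ≤ L * (2 * N + 1) * ψ y := by
    intro i _
    refine (norm_add_le _ _).trans ?_
    rw [norm_mul, norm_mul]
    have h1 : ‖e i x - e i y‖ ≤ L * ‖x - y‖ := (hL i).norm_sub_le x y
    have h2 : ‖fderiv ℝ ρ (x - y) (b i)‖ ≤ ‖fderiv ℝ ρ (x - y)‖ := by
      have := (fderiv ℝ ρ (x - y)).le_opNorm (b i)
      rwa [hbn, mul_one] at this
    have h3 : ‖lineDeriv ℝ (e i) y (b i)‖ ≤ L := by
      have := (hL i).abs_lineDeriv_le y (b i)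
      rwa [hbn, mul_one] at this
    have h4 : ‖ψ y‖ = ψ y := Real.norm_of_nonneg (powKernel_pos hε _).le
    have h5 := norm_fderiv_powKernel_mul_le hε (x - y)
    rw [h4]
    have h6 : 0 ≤ ψ y := (powKernel_pos hε _).le
    calc _ ≤ (L * ‖x - y‖) * ‖fderiv ℝ ρ (x - y)‖ + L * ψ y := by gcongr
      _ = L * (‖x - y‖ * ‖fderiv ℝ ρ (x - y)‖) + L * ψ y := by ring
      _ ≤ L * (2 * N * ψ y) + L * ψ y := by gcongr
      _ = _ := by ring
  refine (Finset.sum_le_sum this).trans (le_of_eq ?_)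
  simp only [Finset.sum_const, Finset.card_univ, Fintype.card_fin, nsmul_eq_mul]
  ring
end

section
variable {m N : ℕ} {c : VFields m N} {Ω : Set (EuclideanSpace ℝ (Fin N))} {Q : ℝ}

/-! ### Constants are not limits of test functions -/

/-- Test functions cannot converge to the constant `1` with vanishing `X`-gradients. -/
theorem not_tendsto_one_of_isTest (hN : 2 ≤ N) (hΩ : IsOpen Ω) (hΩb : Bornology.IsBounded Ω)
    (hne : Ω.Nonempty) (hc : ∀ j, LocallyLipschitz (c j)) (hcont : CCContinuous c Ω)
    (hd : CCDoubling c Ω Q) (hp : CCPoincare c Ω) {R : ℝ} (hR : 0 < R)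
    (hball : ∀ x ∈ Ω, ∀ r, R ≤ r → ccBall c Ω x r = Ω)
    {u : ℕ → EuclideanSpace ℝ (Fin N) → ℝ}
    (hu : ∀ k, IsTest ⊤ Ω (u k)) (hu1 : Tendsto (fun k => ∫ x in Ω, |u k x - 1|) atTop (𝓝 0))
    (huX : Tendsto (fun k => ∫ x in Ω, ‖xGrad c (u k) x‖) atTop (𝓝 0)) : False := by
  have hcc : ∀ j, Continuous (c j) := fun j => (hc j).continuous
  obtain ⟨r₀, hr₀⟩ := hΩb.subset_closedBall (0 : EuclideanSpace ℝ (Fin N))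
  have hext : ∀ (j : Fin m) (i : Fin N), ∃ (L : NNReal) (g : EuclideanSpace ℝ (Fin N) → ℝ),
      LipschitzWith L g ∧ (∀ x ∈ Metric.closedBall 0 r₀, g x = c j x i) ∧
      ∀ x ∉ Metric.closedBall (0 : EuclideanSpace ℝ (Fin N)) (r₀ + 1), g x = 0 := by
    intro j i
    obtain ⟨K, hK⟩ := (hc j).exists_lipschitzOnWith (isCompact_closedBall 0 r₀)
    refine LipschitzOnWith.exists_eq_zero_outside (K := K)
      (LipschitzOnWith.of_dist_le_mul fun x hx y hy => ?_)
    refine le_trans ?_ (hK.dist_le_mul x hx y hy)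
    rw [dist_eq_norm, dist_eq_norm]
    exact PiLp.norm_apply_le (c j x - c j y) i
  choose L₀ e hL₀ heq he0 using hext
  set L : NNReal := ∑ j, ∑ i, L₀ j i with hLdef
  have hL : ∀ j i, LipschitzWith L (e j i) := fun j i => (hL₀ j i).weaken
    ((Finset.single_le_sum (f := fun i => L₀ j i) (fun _ _ => zero_le) (Finset.mem_univ i)).trans
    (Finset.single_le_sum (f := fun j => ∑ i, L₀ j i) (fun _ _ => zero_le) (Finset.mem_univ j)))
  set S := Metric.closedBall (0 : EuclideanSpace ℝ (Fin N)) (r₀ + 1) \ Ω with hS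
  have hSb : Bornology.IsBounded S := Metric.isBounded_closedBall.subset sdiff_subset
  set M : ℝ := m * (N * (L * (2 * N + 1))) with hM
  have hM0 : 0 ≤ M := by positivity
  have hgrad : ∀ ε : ℝ, 0 < ε → ∀ x ∈ Ω,
      ‖xGrad c (setPotential ε S) x‖ ≤ M * setPotential ε S x := by
    intro ε hε x hx
    have h1 : ∀ j, |fderiv ℝ (setPotential ε S) x (c j x)| ≤
        N * (L * (2 * N + 1)) * setPotential ε S x := fun j =>
      abs_fderiv_setPotential_le hΩ (hL j) (he0 j) hε
        (fun K hK => setIntegral_div_eq_zero hΩ hΩb hu hu1 huX hcc j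
          (fun i y hy => heq j i y (hr₀ hy)) (B := ((ε ^ 2) ^ N)⁻¹)
          (fun y _ => by
            rw [abs_of_pos (powKernel_pos hε _)]; exact powKernel_le hε _) hK)
        (fun i => (heq j i x (hr₀ hx)).symm)
    have h2 : ‖xGrad c (setPotential ε S) x‖ ≤ ∑ j, |fderiv ℝ (setPotential ε S) x (c j x)| := by
      rw [← (EuclideanSpace.basisFun (Fin m) ℝ).sum_repr (xGrad c (setPotential ε S) x)]
      refine (norm_sum_le _ _).trans (Finset.sum_le_sum fun j _ => ?_)
      simp [norm_smul, xGrad]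
    refine h2.trans ((Finset.sum_le_sum fun j _ => h1 j).trans (le_of_eq ?_))
    simp only [Finset.sum_const, Finset.card_univ, Fintype.card_fin, nsmul_eq_mul]
    rw [hM]; ring
  -- a boundary point that is extremal in a coordinate direction
  set n : EuclideanSpace ℝ (Fin N) := EuclideanSpace.single ⟨0, by omega⟩ 1 with hn
  have hnn : ‖n‖ = 1 := by simp [hn]
  obtain ⟨y₀, hy₀, hmax⟩ := hΩb.isCompact_closure.exists_isMaxOn hne.closure
    (f := fun y => inner ℝ n y) (by fun_prop)
  have hy₀n : ‖y₀‖ ≤ r₀ := by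
    simpa using closure_minimal hr₀ Metric.isClosed_closedBall hy₀
  -- `Ω` lies in the half-space `⟨n, y⟩ ≤ ⟨n, y₀⟩`, so the open ball that touches its boundary
  -- hyperplane at `y₀` from the other side misses `Ω`. For `ε ≤ 1/2` it stays within the ball of
  -- radius `r₀ + 1`.
  have hsub : ∀ ε : ℝ, 0 < ε → ε ≤ 1 / 2 → Metric.ball (y₀ + ε • n) ε ⊆ S := by
    intro ε hε hε1 y hy
    rw [mem_ball_iff_norm] at hy
    have hεn : ‖ε • n‖ = ε := by rw [norm_smul, hnn, mul_one, Real.norm_of_nonneg hε.le]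
    refine ⟨?_, fun hyΩ => ?_⟩
    · rw [mem_closedBall_zero_iff]
      have : ‖y‖ ≤ ‖y - (y₀ + ε • n)‖ + (‖y₀‖ + ‖ε • n‖) :=
        (norm_le_norm_sub_add y (y₀ + ε • n)).trans (by gcongr; exact norm_add_le _ _)
      linarith
    · have h1 : inner ℝ n y ≤ inner ℝ n y₀ := hmax (subset_closure hyΩ)
      have h2 := abs_real_inner_le_norm n (y - (y₀ + ε • n))
      rw [hnn, one_mul, inner_sub_right, inner_add_right, inner_smul_right,
        real_inner_self_eq_norm_sq, hnn] at h2
      have h3 := (abs_le.1 (h2.trans hy.le)).1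
      have h4 := abs_lt.1 (h2.trans_lt hy)
      linarith [h4.1]
  have hS0 : volume S ≠ 0 := by
    have := measure_mono (μ := volume) (hsub (1 / 2) (by norm_num) le_rfl)
    exact ((Metric.measure_ball_pos volume _ (by norm_num)).trans_le this).ne'
  -- the oscillation of the logarithm of the potential
  obtain ⟨D, hD, ν, hν, hchain⟩ := hp.exists_chain hΩ hΩb hcc hcont hd hR hball
  set C : ℝ := D * (M * R * 2) with hC
  -- The logarithm of the potential has `X`-gradient at most `M`. Telescoping bounds its distance
  -- from its mean by `C`, so two values differ by at most `2 C`, uniformly in `ε`.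
  have hosc : ∀ ε : ℝ, 0 < ε → ∀ x ∈ Ω, ∀ y ∈ Ω,
      setPotential ε S y ≤ Real.exp (2 * C) * setPotential ε S x := by
    intro ε hε
    have hpos := setPotential_pos hε hSb hS0
    have hsm := contDiff_setPotential hε hSb
    set w : EuclideanSpace ℝ (Fin N) → ℝ := fun x => Real.log (setPotential ε S x) with hw
    have hwsm : ContDiff ℝ 1 w := hsm.log fun x => (hpos x).ne'
    have hgw : ∀ x ∈ Ω, ‖xGrad c w x‖ ≤ M := by
      intro x hx
      have : xGrad c w x = (setPotential ε S x)⁻¹ • xGrad c (setPotential ε S) x := by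
        have h1 : fderiv ℝ w x = (setPotential ε S x)⁻¹ • fderiv ℝ (setPotential ε S) x :=
          fderiv.log (hsm.differentiable one_ne_zero x) (hpos x).ne'
        ext j
        simp [xGrad, h1]
      rw [this, norm_smul, Real.norm_of_nonneg (inv_nonneg.2 (hpos x).le), inv_mul_le_iff₀ (hpos x)]
      linarith [hgrad ε hε x hx]
    have hmean : ∀ x ∈ Ω, |w x - ⨍ y in Ω, w y| ≤ C := by
      intro x hx
      refine (hchain w hwsm x hx (fun i => M * R * 2⁻¹ ^ i)
        ((summable_geometric_of_lt_one (by norm_num) (by norm_num)).mul_left _) fun i => ?_).trans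
        (le_of_eq ?_)
      · have hρ : 0 < ν * (R / 2 ^ i) := by positivity
        have hp := hd.real_pos hΩb hx hρ
        have : ⨍ y in ccBall c Ω x (ν * (R / 2 ^ i)), ‖xGrad c w y‖ ≤ M := by
          rw [setAverage_eq, smul_eq_mul, inv_mul_le_iff₀ hp]
          have h1 : ∫ y in ccBall c Ω x (ν * (R / 2 ^ i)), ‖xGrad c w y‖ ≤
              ∫ y in ccBall c Ω x (ν * (R / 2 ^ i)), M := by
            refine setIntegral_mono_on ?_ (integrableOn_const (volume_ccBall_ne_top hΩb _ _))
              (isOpen_ccBall hΩ hcont _ _).measurableSet fun y hy => hgw y hy.1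
            exact ((continuous_xGrad hcc hwsm).norm.integrableOn_of_isBounded hΩb).mono_set
              ccBall_subset
          rwa [setIntegral_const, smul_eq_mul] at h1
        calc _ ≤ R / 2 ^ i * M := by gcongr
          _ = _ := by rw [inv_pow]; ring
      · rw [tsum_mul_left, tsum_geometric_of_lt_one (by norm_num) (by norm_num), hC]
        norm_num
    intro x hx y hy
    have h1 := abs_le.1 (hmean x hx)
    have h2 := abs_le.1 (hmean y hy)
    have h3 : w y ≤ 2 * C + w x := by linarith
    have h4 := Real.exp_le_exp.2 h3
    rwa [Real.exp_add, hw, Real.exp_log (hpos y), Real.exp_log (hpos x)] at h4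
  obtain ⟨x₀, hx₀⟩ := hne
  obtain ⟨δ, hδ, hδ'⟩ := Metric.isOpen_iff.1 hΩ x₀ hx₀
  set H : ℝ := Real.exp (2 * C) * (volume.real S * ((δ ^ 2) ^ N)⁻¹) with hH
  -- At `x₀` the set `S` is at distance at least `δ`, so the potential there is bounded
  -- independently of `ε`. The oscillation bound carries this to all of `Ω`, and continuity to the
  -- boundary point `y₀`.
  have hupper : ∀ ε : ℝ, 0 < ε → setPotential ε S y₀ ≤ H := by
    intro ε hε
    have h1 : setPotential ε S x₀ ≤ volume.real S * ((δ ^ 2) ^ N)⁻¹ := by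
      have h2 : setPotential ε S x₀ ≤ ∫ y in S, ((δ ^ 2) ^ N)⁻¹ := by
        refine setIntegral_mono_on (integrableOn_powKernel_sub hε hSb x₀)
          (integrableOn_const hSb.measure_lt_top.ne)
          (measurableSet_closedBall.diff hΩ.measurableSet) fun y hy => ?_
        have : δ ≤ ‖x₀ - y‖ := by
          by_contra h
          push Not at h
          refine hy.2 (hδ' ?_)
          rwa [mem_ball_iff_norm, norm_sub_rev]
        unfold powKernel
        gcongr
        nlinarith [sq_nonneg ε]
      rwa [setIntegral_const, smul_eq_mul] at h2
    have h3 : ∀ y ∈ closure Ω, setPotential ε S y ≤ H := by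
      refine closure_minimal (fun y hy => ?_)
        (isClosed_le (contDiff_setPotential hε hSb).continuous continuous_const)
      exact (hosc ε hε x₀ hx₀ y hy).trans (by rw [hH]; gcongr)
    exact h3 y₀ hy₀
  set κ := volume.real (Metric.ball (0 : EuclideanSpace ℝ (Fin N)) 1) with hκ
  have hκpos : 0 < κ :=
    ENNReal.toReal_pos (Metric.measure_ball_pos volume _ one_pos).ne' measure_ball_lt_top.ne
  -- On the touching ball `‖y₀ - y‖ ≤ 2 ε`, so the kernel is at least `(5 ε²)^{-N}`. The ball has
  -- volume `κ ε^N`, which leaves a lower bound of order `ε^{-N}`.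
  have hlower : ∀ ε : ℝ, 0 < ε → ε ≤ 1 / 2 → κ * (5 ^ N)⁻¹ ≤ H * ε ^ N := by
    intro ε hε hε1
    have hvol : volume.real (Metric.ball (y₀ + ε • n) ε) = ε ^ N * κ := by
      rw [measureReal_def, Measure.addHaar_ball_of_pos _ _ hε, ENNReal.toReal_mul,
        ENNReal.toReal_ofReal (by positivity), finrank_euclideanSpace_fin]; rfl
    have h1 : ∫ y in Metric.ball (y₀ + ε • n) ε, ((5 * ε ^ 2) ^ N)⁻¹ ≤ setPotential ε S y₀ := by
      refine le_trans ?_ (setIntegral_mono_set (integrableOn_powKernel_sub hε hSb y₀)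
        (ae_of_all _ fun y => (powKernel_pos hε _).le) (hsub ε hε hε1).eventuallyLE)
      refine setIntegral_mono_on (integrableOn_const measure_ball_lt_top.ne)
        ((integrableOn_powKernel_sub hε hSb y₀).mono_set (hsub ε hε hε1)) measurableSet_ball
        fun y hy => ?_
      have hεn : ‖ε • n‖ = ε := by rw [norm_smul, hnn, mul_one, Real.norm_of_nonneg hε.le]
      have h2 : ‖y₀ - y‖ ≤ 2 * ε := by
        rw [mem_ball_iff_norm, norm_sub_rev] at hy
        have : y₀ - y = (y₀ + ε • n - y) - ε • n := by abel
        rw [this]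
        refine (norm_sub_le _ _).trans ?_
        linarith
      unfold powKernel
      gcongr
      nlinarith [norm_nonneg (y₀ - y)]
    rw [setIntegral_const, hvol, smul_eq_mul] at h1
    have h2 := h1.trans (hupper ε hε)
    rw [mul_pow, mul_inv, ← pow_mul, mul_comm 2 N, pow_mul] at h2
    have hεN : 0 < ε ^ N := by positivity
    calc κ * (5 ^ N)⁻¹ = ε ^ N * κ * ((5 ^ N)⁻¹ * ((ε ^ N) ^ 2)⁻¹) * ε ^ N := by
          field_simp
      _ ≤ H * ε ^ N := by gcongr
  have hlim : Tendsto (fun ε : ℝ => H * ε ^ N) (𝓝[>] 0) (𝓝 0) := by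
    have : Tendsto (fun ε : ℝ => H * ε ^ N) (𝓝 0) (𝓝 (H * 0 ^ N)) := by
      apply Continuous.tendsto; fun_prop
    rw [zero_pow (by omega), mul_zero] at this
    exact this.mono_left nhdsWithin_le_nhds
  have : κ * (5 ^ N)⁻¹ ≤ 0 := by
    refine ge_of_tendsto hlim ?_
    filter_upwards [Ioo_mem_nhdsGT (show (0 : ℝ) < 1 / 2 by norm_num)] with ε hε
    exact hlower ε hε.1 hε.2.le
  have h5 : 0 < κ * ((5 : ℝ) ^ N)⁻¹ := by positivity
  linarith
end

section
variable {m N : ℕ} {c : VFields m N} {Ω : Set (EuclideanSpace ℝ (Fin N))} {Q : ℝ}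

/-! ### The Sobolev inequality for test functions -/

theorem IsTest.contDiff_one {k : ℕ∞} (hk : 1 ≤ k) {φ : EuclideanSpace ℝ (Fin N) → ℝ}
    (hφ : IsTest k Ω φ) : ContDiff ℝ 1 φ :=
  hφ.1.of_le (by exact_mod_cast hk)

theorem IsTest.const_mul {k : ℕ∞} {φ : EuclideanSpace ℝ (Fin N) → ℝ} (hφ : IsTest k Ω φ) (a : ℝ) :
    IsTest k Ω (fun x => a * φ x) :=
  ⟨contDiff_const.mul hφ.1, hφ.2.1.mul_left, (tsupport_mul_subset_right).trans hφ.2.2⟩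

theorem xGrad_const_mul {φ : EuclideanSpace ℝ (Fin N) → ℝ} {x : EuclideanSpace ℝ (Fin N)}
    (hφ : DifferentiableAt ℝ φ x) (a : ℝ) :
    xGrad c (fun x => a * φ x) x = a • xGrad c φ x := by
  ext j
  simp [xGrad, fderiv_const_mul hφ]

/-- Counterexamples normalised to mean `1` have `X`-gradients tending to `0` in `L¹`. The Poincaré
inequality on all of `Ω` then makes them converge to `1` in `L¹` directly, with no compactness
theorem, and `not_tendsto_one_of_isTest` excludes this. -/
theorem CCPoincare.exists_abs_mean_le (hN : 2 ≤ N) (hΩ : IsOpen Ω) (hΩb : Bornology.IsBounded Ω)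
    (hc : ∀ j, LocallyLipschitz (c j)) (hcont : CCContinuous c Ω)
    (hd : CCDoubling c Ω Q) (hp : CCPoincare c Ω) {R : ℝ} (hR : 0 < R)
    (hball : ∀ x ∈ Ω, ∀ r, R ≤ r → ccBall c Ω x r = Ω) :
    ∃ C > 0, ∀ φ, IsTest ⊤ Ω φ → |⨍ y in Ω, φ y| ≤ C * ∫ y in Ω, ‖xGrad c φ y‖ := by
  rcases Ω.eq_empty_or_nonempty with h | ⟨x₀, hx₀⟩
  · exact ⟨1, one_pos, by simp [h]⟩
  by_contra! hcon
  choose φ hφ hlt using fun k : ℕ => hcon (k + 1) (by positivity)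
  set a : ℕ → ℝ := fun k => ⨍ y in Ω, φ k y with ha
  have hXnn : ∀ k, 0 ≤ ∫ y in Ω, ‖xGrad c (φ k) y‖ := fun k => integral_nonneg fun _ => norm_nonneg _
  have ha0 : ∀ k, 0 < |a k| := fun k =>
    (mul_nonneg (by positivity) (hXnn k)).trans_lt (hlt k)
  set u : ℕ → EuclideanSpace ℝ (Fin N) → ℝ := fun k x => (a k)⁻¹ * φ k x with hu
  have hut : ∀ k, IsTest ⊤ Ω (u k) := fun k => (hφ k).const_mul _
  have hXu : ∀ k, ∫ x in Ω, ‖xGrad c (u k) x‖ = |a k|⁻¹ * ∫ y in Ω, ‖xGrad c (φ k) y‖ := by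
    intro k
    rw [← integral_const_mul]
    refine integral_congr_ae (ae_of_all _ fun x => ?_)
    simp only [hu]
    rw [xGrad_const_mul (((hφ k).contDiff_one le_top).differentiable one_ne_zero x), norm_smul,
      norm_inv, Real.norm_eq_abs]
  have hXu_le : ∀ k, ∫ x in Ω, ‖xGrad c (u k) x‖ ≤ 1 / ((k : ℝ) + 1) := by
    intro k
    rw [hXu, inv_mul_le_iff₀ (ha0 k), mul_one_div, le_div_iff₀ (by positivity)]
    linarith [hlt k]
  have hX0 : Tendsto (fun k => ∫ x in Ω, ‖xGrad c (u k) x‖) atTop (𝓝 0) :=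
    squeeze_zero (fun k => integral_nonneg fun _ => norm_nonneg _) hXu_le
      tendsto_one_div_add_atTop_nhds_zero_nat
  obtain ⟨CP, hCP, ν, hν, H⟩ := hp
  set r := max R (R / ν) with hr
  have hr0 : 0 < r := lt_max_of_lt_left hR
  have hV : 0 < volume.real Ω := by
    rw [← hball x₀ hx₀ R le_rfl]; exact hd.real_pos hΩb hx₀ hR
  have hmean : ∀ k, ⨍ y in Ω, u k y = 1 := fun k => by
    have hne : a k ≠ 0 := abs_pos.1 (ha0 k)
    rw [setAverage_eq, integral_const_mul, smul_eq_mul]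
    have h1 : (volume.real Ω)⁻¹ * ∫ y in Ω, φ k y = a k := by
      rw [ha]; simp only; rw [setAverage_eq, smul_eq_mul]
    rw [mul_left_comm, h1, inv_mul_cancel₀ hne]
  have hu1 : ∀ k, ∫ x in Ω, |u k x - 1| ≤ CP * r * ∫ x in Ω, ‖xGrad c (u k) x‖ := by
    intro k
    have h1 := H x₀ hx₀ r hr0 (u k) ((hut k).contDiff_one le_top)
    -- The radius `r` is chosen so large that the balls of radius `r` and of radius `ν r` are both
    -- all of `Ω`.
    have h2 : R ≤ ν * r := by
      have : R / ν ≤ r := le_max_right _ _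
      rw [div_le_iff₀ hν] at this; linarith
    rw [hball x₀ hx₀ r (le_max_left _ _), hball x₀ hx₀ (ν * r) h2, hmean k, setAverage_eq,
      setAverage_eq, smul_eq_mul, smul_eq_mul, inv_mul_le_iff₀ hV] at h1
    refine h1.trans (le_of_eq ?_)
    field_simp
  have hu0 : Tendsto (fun k => ∫ x in Ω, |u k x - 1|) atTop (𝓝 0) :=
    squeeze_zero (fun k => integral_nonneg fun _ => abs_nonneg _) hu1
      (by simpa using hX0.const_mul (CP * r))
  exact not_tendsto_one_of_isTest hN hΩ hΩb ⟨x₀, hx₀⟩ hc hcont hd ⟨CP, hCP, ν, hν, H⟩ hR hball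
    hut hu0 hX0

theorem MeasureTheory.MemLp.sq_toReal_eLpNorm_two {α F : Type*} [MeasurableSpace α] {μ : Measure α}
    [NormedAddCommGroup F] {f : α → F} (hf : MemLp f 2 μ) :
    (eLpNorm f 2 μ).toReal ^ 2 = ∫ x, ‖f x‖ ^ 2 ∂μ := by
  have h0 : 0 ≤ ∫ x, ‖f x‖ ^ 2 ∂μ := integral_nonneg fun _ => sq_nonneg _
  rw [hf.eLpNorm_eq_integral_rpow_norm two_ne_zero ENNReal.ofNat_ne_top]
  simp only [ENNReal.toReal_ofNat, Real.rpow_two]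
  rw [ENNReal.toReal_ofReal (by positivity), ← Real.rpow_two, ← Real.rpow_mul h0]
  norm_num

theorem Continuous.memLp_restrict {F : Type*} [NormedAddCommGroup F]
    {f : EuclideanSpace ℝ (Fin N) → F} (hf : Continuous f) (hΩb : Bornology.IsBounded Ω)
    (p : ℝ≥0∞) : MemLp f p (volume.restrict Ω) := by
  obtain ⟨K, hK⟩ := hΩb.isCompact_closure.exists_bound_of_continuousOn hf.continuousOn
  have hm : MemLp f p (volume.restrict (closure Ω)) := by
    have : IsFiniteMeasure (volume.restrict (closure Ω)) :=
      ⟨by simpa using hΩb.isCompact_closure.measure_lt_top⟩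
    refine MemLp.of_bound ?_ K ?_
    · exact (hf.continuousOn.integrableOn_compact hΩb.isCompact_closure).aestronglyMeasurable
    · filter_upwards [ae_restrict_mem isClosed_closure.measurableSet] with x hx using hK x hx
  exact hm.mono_measure (Measure.restrict_mono subset_closure le_rfl)

/-- The Sobolev inequality for test functions. -/
theorem exists_sobolev (hN : 2 ≤ N) (hΩ : IsOpen Ω) (hΩb : Bornology.IsBounded Ω)
    (hc : ∀ j, LocallyLipschitz (c j)) (hconn : XConnected c Ω) (hcont : CCContinuous c Ω)
    (hQ : 2 < Q) (hd : CCDoubling c Ω Q) (hp : CCPoincare c Ω) :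
    ∃ C > 0, ∀ φ, IsTest ⊤ Ω φ →
      eLpNorm φ (ENNReal.ofReal (2 * Q / (Q - 2))) (volume.restrict Ω) ≤
        ENNReal.ofReal C * eLpNorm (xGrad c φ) 2 (volume.restrict Ω) := by
  have hcc : ∀ j, Continuous (c j) := fun j => (hc j).continuous
  obtain ⟨R, hR, hball⟩ := hd.exists_ccBall_eq hΩb hconn hcont hΩ
  obtain ⟨C₁, hC₁, H₁⟩ := hp.exists_abs_mean_le hN hΩ hΩb hc hcont hd hR hball
  obtain ⟨C₂, hC₂, H₂⟩ := hp.exists_sobolev_sub_mean hΩ hΩb hcc hcont hd hQ hR hball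
  set p := 2 * Q / (Q - 2) with hp'
  have hQ2 : 0 < Q - 2 := by linarith
  have hp1 : 1 ≤ p := by rw [hp', le_div_iff₀ hQ2]; linarith
  have hp0 : 0 < p := by linarith
  have hpe0 : ENNReal.ofReal p ≠ 0 := by simpa using hp0
  set V := volume.real Ω with hV
  have hVt : volume Ω ≠ ⊤ := hΩb.measure_lt_top.ne
  have hVnn : 0 ≤ V := measureReal_nonneg
  set C := C₂ ^ (1 / p) + C₁ * √V * V ^ (1 / p) with hC
  have hCpos : 0 < C := by positivity
  refine ⟨C, hCpos, fun φ hφ => ?_⟩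
  set s := (eLpNorm (xGrad c φ) 2 (volume.restrict Ω)).toReal with hs
  have hXc : Continuous (xGrad c φ) := continuous_xGrad hcc (hφ.contDiff_one le_top)
  have hXm : MemLp (xGrad c φ) 2 (volume.restrict Ω) := hXc.memLp_restrict hΩb 2
  have hs2 : s ^ 2 = ∫ y in Ω, ‖xGrad c φ y‖ ^ 2 := hXm.sq_toReal_eLpNorm_two
  have hs0 : 0 ≤ s := ENNReal.toReal_nonneg
  set a := ⨍ y in Ω, φ y with ha
  -- Cauchy–Schwarz on the finite measure of `Ω`.
  have hint : ∫ y in Ω, ‖xGrad c φ y‖ ≤ √V * s := by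
    have h1 := sq_setAverage_mul_le hVt (hXc.norm.integrableOn_of_isBounded hΩb)
      ((hXc.norm.pow 2).integrableOn_of_isBounded hΩb)
    rw [← hs2, setAverage_eq, smul_eq_mul] at h1
    refine le_of_sq_le_sq ?_ (by positivity)
    rw [mul_pow, Real.sq_sqrt hVnn]
    rcases hVnn.eq_or_lt with h | h
    · have : volume.restrict Ω = 0 :=
        Measure.restrict_eq_zero.2 ((ENNReal.toReal_eq_zero_iff _).1 h.symm |>.resolve_right hVt)
      simp [this, ← h]
    · rw [← hV] at h1
      field_simp at h1
      linarith
  have hmean : |a| ≤ C₁ * √V * s := by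
    rw [mul_assoc]; exact (H₁ φ hφ).trans (by gcongr)
  have hconst : eLpNorm (fun _ : EuclideanSpace ℝ (Fin N) => a) (ENNReal.ofReal p) (volume.restrict Ω) ≤
      ENNReal.ofReal (C₁ * √V * s * V ^ (1 / p)) := by
    rw [eLpNorm_const' _ hpe0 ENNReal.ofReal_ne_top, ENNReal.toReal_ofReal hp0.le,
      Measure.restrict_apply_univ, ENNReal.ofReal_mul (by positivity), Real.enorm_eq_ofReal_abs,
      ← ENNReal.ofReal_rpow_of_nonneg hVnn (by positivity), hV, ofReal_measureReal hVt]
    gcongr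
  -- The energy norm `s` may vanish, whereas the oscillation estimate wants a positive bound. Hence
  -- every `S > s` is used, and `S` decreases to `s` at the end.
  have hmain : ∀ S, s < S → eLpNorm (fun x => φ x - a) (ENNReal.ofReal p) (volume.restrict Ω) ≤
      ENNReal.ofReal (C₂ ^ (1 / p) * S) := by
    intro S hS
    have hS0 : 0 < S := hs0.trans_lt hS
    have h1 := H₂ φ (hφ.contDiff_one le_top) S hS0 (by rw [← hs2]; gcongr)
    rw [eLpNorm_eq_lintegral_rpow_enorm_toReal hpe0 ENNReal.ofReal_ne_top, ENNReal.toReal_ofReal hp0.le]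
    have h2 : ∀ x, ‖φ x - a‖ₑ ^ p = ENNReal.ofReal (|φ x - a| ^ p) := fun x => by
      rw [Real.enorm_eq_ofReal_abs, ENNReal.ofReal_rpow_of_nonneg (abs_nonneg _) hp0.le]
    simp_rw [h2]
    refine (ENNReal.rpow_le_rpow h1 (by positivity)).trans (le_of_eq ?_)
    rw [ENNReal.ofReal_rpow_of_nonneg (by positivity) (by positivity),
      Real.mul_rpow hC₂.le (by positivity), ← Real.rpow_mul hS0.le, mul_one_div_cancel hp0.ne',
      Real.rpow_one]
  have hall : ∀ S, s < S → eLpNorm φ (ENNReal.ofReal p) (volume.restrict Ω) ≤ ENNReal.ofReal (C * S) := by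
    intro S hS
    have hS0 : 0 < S := hs0.trans_lt hS
    have e : φ = (fun x => φ x - a) + fun _ => a := by ext x; simp
    have h1 := eLpNorm_add_le (μ := volume.restrict Ω) (p := ENNReal.ofReal p)
      (f := fun x => φ x - a) (g := fun _ => a)
      ((hφ.1.continuous.sub continuous_const).aestronglyMeasurable)
      aestronglyMeasurable_const (by simpa using hp1)
    rw [← e] at h1
    refine h1.trans ((add_le_add (hmain S hS) hconst).trans ?_)
    rw [← ENNReal.ofReal_add (by positivity) (by positivity)]
    refine ENNReal.ofReal_le_ofReal ?_
    rw [hC, add_mul]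
    have : C₁ * √V * s * V ^ (1 / p) ≤ C₁ * √V * S * V ^ (1 / p) := by gcongr
    linarith
  have hfin : eLpNorm φ (ENNReal.ofReal p) (volume.restrict Ω) ≤ ENNReal.ofReal (C * s) := by
    have hlim : Tendsto (fun S => ENNReal.ofReal (C * S)) (𝓝[>] s) (𝓝 (ENNReal.ofReal (C * s))) :=
      ((ENNReal.continuous_ofReal.comp (continuous_const_mul C)).tendsto s).mono_left
        nhdsWithin_le_nhds
    exact ge_of_tendsto hlim (eventually_nhdsWithin_of_forall fun S hS => hall S hS)
  rwa [ENNReal.ofReal_mul hCpos.le, hs, ENNReal.ofReal_toReal hXm.eLpNorm_ne_top] at hfin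
end

/-! ### Convergence in `L^p` -/

theorem tendsto_eLpNorm_zero_of_dominated {X E : Type*} [MeasurableSpace X] {μ : Measure X}
    [NormedAddCommGroup E] {p : ℝ≥0∞} (hp0 : p ≠ 0) (hpt : p ≠ ⊤) {F : ℕ → X → E} {g : X → ℝ}
    (hF : ∀ n, AEStronglyMeasurable (F n) μ) (hg : MemLp g p μ)
    (hle : ∀ n, ∀ᵐ x ∂μ, ‖F n x‖ ≤ g x)
    (hlim : ∀ᵐ x ∂μ, Tendsto (fun n => F n x) atTop (𝓝 0)) :
    Tendsto (fun n => eLpNorm (F n) p μ) atTop (𝓝 0) := by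
  have hpr : 0 < p.toReal := ENNReal.toReal_pos hp0 hpt
  simp only [eLpNorm_eq_lintegral_rpow_enorm_toReal hp0 hpt]
  have key : Tendsto (fun n => ∫⁻ x, ‖F n x‖ₑ ^ p.toReal ∂μ) atTop (𝓝 (∫⁻ _, 0 ∂μ)) := by
    refine tendsto_lintegral_of_dominated_convergence' (fun x => ‖g x‖ₑ ^ p.toReal)
      (fun n => (hF n).enorm.pow_const _) (fun n => ?_) ?_ ?_
    · filter_upwards [hle n] with x hx
      refine ENNReal.rpow_le_rpow ?_ hpr.le
      exact enorm_le_iff_norm_le.2 (hx.trans (le_abs_self _))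
    · exact (lintegral_rpow_enorm_lt_top_of_eLpNorm_lt_top hp0 hpt hg.2).ne
    · filter_upwards [hlim] with x hx
      have h1 : Tendsto (fun n => ‖F n x‖ₑ) atTop (𝓝 0) := by
        simpa using hx.enorm
      simpa [ENNReal.zero_rpow_of_pos hpr, Function.comp_def] using
        (ENNReal.continuous_rpow_const (y := p.toReal)).tendsto 0 |>.comp h1
  simp only [lintegral_zero] at key
  have := (ENNReal.continuous_rpow_const (y := 1 / p.toReal)).tendsto 0 |>.comp key
  simpa [Function.comp_def, ENNReal.zero_rpow_of_pos (inv_pos.2 hpr)] using this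

theorem tendsto_eLpNorm_sub_trans {X E : Type*} [MeasurableSpace X] {μ : Measure X}
    [NormedAddCommGroup E] {p : ℝ≥0∞} (hp : 1 ≤ p) {f g : ℕ → X → E} {h : X → E}
    (hf : ∀ n, AEStronglyMeasurable (f n) μ) (hg : ∀ n, AEStronglyMeasurable (g n) μ)
    (hh : AEStronglyMeasurable h μ)
    (h1 : Tendsto (fun n => eLpNorm (fun x => f n x - g n x) p μ) atTop (𝓝 0))
    (h2 : Tendsto (fun n => eLpNorm (fun x => g n x - h x) p μ) atTop (𝓝 0)) :
    Tendsto (fun n => eLpNorm (fun x => f n x - h x) p μ) atTop (𝓝 0) := by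
  refine tendsto_of_tendsto_of_tendsto_of_le_of_le tendsto_const_nhds
    (by simpa using h1.add h2) (fun _ => zero_le) fun n => ?_
  have : (fun x => f n x - h x) = (fun x => f n x - g n x) + fun x => g n x - h x := by
    ext x; simp
  simp only [this]
  exact eLpNorm_add_le ((hf n).sub (hg n)) ((hg n).sub hh) hp

theorem exists_subseq_tendsto_ae {X E : Type*} [MeasurableSpace X] {μ : Measure X}
    [NormedAddCommGroup E] {p : ℝ≥0∞} (hp : p ≠ 0) {f : ℕ → X → E} {g : X → E}
    (hf : ∀ n, AEStronglyMeasurable (f n) μ) (hg : AEStronglyMeasurable g μ)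
    (h : Tendsto (fun n => eLpNorm (fun x => f n x - g x) p μ) atTop (𝓝 0)) :
    ∃ ns : ℕ → ℕ, StrictMono ns ∧
      ∀ᵐ x ∂μ, Tendsto (fun i => f (ns i) x) atTop (𝓝 (g x)) :=
  (tendstoInMeasure_of_tendsto_eLpNorm hp hf hg h).exists_seq_tendsto_ae

section
variable {m N : ℕ} {c : VFields m N} {Ω : Set (EuclideanSpace ℝ (Fin N))} {Q : ℝ}

/-! ### Rules for the `X`-gradient -/

theorem xGrad_sub {φ ψ : EuclideanSpace ℝ (Fin N) → ℝ} {x : EuclideanSpace ℝ (Fin N)}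
    (hφ : DifferentiableAt ℝ φ x) (hψ : DifferentiableAt ℝ ψ x) :
    xGrad c (fun x => φ x - ψ x) x = xGrad c φ x - xGrad c ψ x := by
  ext j
  have : fderiv ℝ (fun x => φ x - ψ x) x = fderiv ℝ φ x - fderiv ℝ ψ x := fderiv_sub hφ hψ
  simp [xGrad, this]

theorem xGrad_comp {S : ℝ → ℝ} {φ : EuclideanSpace ℝ (Fin N) → ℝ}
    {x : EuclideanSpace ℝ (Fin N)} (hS : DifferentiableAt ℝ S (φ x))
    (hφ : DifferentiableAt ℝ φ x) :
    xGrad c (fun x => S (φ x)) x = deriv S (φ x) • xGrad c φ x := by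
  ext j
  have h : fderiv ℝ (fun x => S (φ x)) x = deriv S (φ x) • fderiv ℝ φ x :=
    (hS.hasDerivAt.comp_hasFDerivAt x hφ.hasFDerivAt).fderiv
  simp [xGrad, h]

/-! ### The spaces `W^{1,p}_0(Ω,X)` -/

theorem IsTest.sub {k : ℕ∞} {φ ψ : EuclideanSpace ℝ (Fin N) → ℝ} (hφ : IsTest k Ω φ)
    (hψ : IsTest k Ω ψ) : IsTest k Ω (fun x => φ x - ψ x) :=
  ⟨hφ.1.sub hψ.1, hφ.2.1.sub hψ.2.1,
    (tsupport_sub φ ψ).trans (union_subset hφ.2.2 hψ.2.2)⟩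

theorem IsTest.comp {φ : EuclideanSpace ℝ (Fin N) → ℝ} (hφ : IsTest ⊤ Ω φ) {S : ℝ → ℝ}
    (hS : ContDiff ℝ ∞ S) (hS0 : S 0 = 0) : IsTest ⊤ Ω (fun x => S (φ x)) := by
  refine ⟨hS.comp hφ.1, hφ.2.1.comp_left hS0, (closure_mono ?_).trans hφ.2.2⟩
  intro x hx h
  simp only [Function.mem_support] at hx
  exact hx (by rw [h, hS0])

theorem IsTest.differentiable {k : ℕ∞} (hk : 1 ≤ k) {φ : EuclideanSpace ℝ (Fin N) → ℝ}
    (hφ : IsTest k Ω φ) : Differentiable ℝ φ :=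
  (hφ.contDiff_one hk).differentiable one_ne_zero

theorem IsTest.memLp {k : ℕ∞} {φ : EuclideanSpace ℝ (Fin N) → ℝ} (hφ : IsTest k Ω φ)
    (hΩb : Bornology.IsBounded Ω) (p : ℝ≥0∞) : MemLp φ p (volume.restrict Ω) :=
  Continuous.memLp_restrict hφ.1.continuous hΩb p

theorem IsTest.memLp_xGrad {k : ℕ∞} (hk : 1 ≤ k) {φ : EuclideanSpace ℝ (Fin N) → ℝ}
    (hφ : IsTest k Ω φ) (hc : ∀ j, Continuous (c j))
    (hΩb : Bornology.IsBounded Ω) (p : ℝ≥0∞) :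
    MemLp (xGrad c φ) p (volume.restrict Ω) :=
  Continuous.memLp_restrict (continuous_xGrad hc (hφ.contDiff_one hk)) hΩb p

theorem MemW0.sub (hc : ∀ j, Continuous (c j)) (hΩb : Bornology.IsBounded Ω)
    {p : ℝ≥0∞} (hp : 1 ≤ p) {u v : EuclideanSpace ℝ (Fin N) → ℝ}
    {G H : EuclideanSpace ℝ (Fin N) → EuclideanSpace ℝ (Fin m)}
    (hu : MemW0 c Ω p u G) (hv : MemW0 c Ω p v H) :
    MemW0 c Ω p (fun x => u x - v x) (fun x => G x - H x) := by
  obtain ⟨hu1, hu2, φ, hφ, hφ1, hφ2⟩ := hu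
  obtain ⟨hv1, hv2, ψ, hψ, hψ1, hψ2⟩ := hv
  have htop : (1 : ℕ∞) ≤ ⊤ := le_top
  refine ⟨hu1.sub hv1, hu2.sub hv2, fun k x => φ k x - ψ k x, fun k => (hφ k).sub (hψ k), ?_, ?_⟩
  · refine tendsto_of_tendsto_of_tendsto_of_le_of_le tendsto_const_nhds
      (by simpa using hφ1.add hψ1) (fun _ => zero_le) fun k => ?_
    have : (fun x => φ k x - ψ k x - (u x - v x))
        = (fun x => φ k x - u x) - fun x => ψ k x - v x := by
      ext x; simp; ring
    simp only [this]
    exact eLpNorm_sub_le (((hφ k).memLp hΩb p).sub hu1).1 (((hψ k).memLp hΩb p).sub hv1).1 hp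
  · refine tendsto_of_tendsto_of_tendsto_of_le_of_le tendsto_const_nhds
      (by simpa using hφ2.add hψ2) (fun _ => zero_le) fun k => ?_
    have : (fun x => xGrad c (fun x => φ k x - ψ k x) x - (G x - H x))
        = (fun x => xGrad c (φ k) x - G x) - fun x => xGrad c (ψ k) x - H x := by
      ext1 x
      rw [xGrad_sub ((hφ k).differentiable htop x) ((hψ k).differentiable htop x)]
      simp only [Pi.sub_apply]
      abel
    simp only [this]
    exact eLpNorm_sub_le (((hφ k).memLp_xGrad htop hc hΩb p).sub hu2).1
      (((hψ k).memLp_xGrad htop hc hΩb p).sub hv2).1 hp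

theorem IsTest.memW0 (hc : ∀ j, Continuous (c j)) (hΩb : Bornology.IsBounded Ω) (p : ℝ≥0∞)
    {φ : EuclideanSpace ℝ (Fin N) → ℝ} (hφ : IsTest ⊤ Ω φ) : MemW0 c Ω p φ (xGrad c φ) :=
  ⟨hφ.memLp hΩb p, hφ.memLp_xGrad le_top hc hΩb p, fun _ => φ, fun _ => hφ, by simp, by simp⟩

/-- `W^{1,p}_0(Ω,X)` is closed. -/
theorem MemW0.of_tendsto (hc : ∀ j, Continuous (c j)) (hΩb : Bornology.IsBounded Ω) {p : ℝ≥0∞}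
    (hp : 1 ≤ p)
    {v : ℕ → EuclideanSpace ℝ (Fin N) → ℝ}
    {V : ℕ → EuclideanSpace ℝ (Fin N) → EuclideanSpace ℝ (Fin m)}
    {u : EuclideanSpace ℝ (Fin N) → ℝ}
    {G : EuclideanSpace ℝ (Fin N) → EuclideanSpace ℝ (Fin m)}
    (hv : ∀ n, MemW0 c Ω p (v n) (V n)) (hu : MemLp u p (volume.restrict Ω))
    (hG : MemLp G p (volume.restrict Ω))
    (h1 : Tendsto (fun n => eLpNorm (fun x => v n x - u x) p (volume.restrict Ω)) atTop (𝓝 0))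
    (h2 : Tendsto (fun n => eLpNorm (fun x => V n x - G x) p (volume.restrict Ω)) atTop (𝓝 0)) :
    MemW0 c Ω p u G := by
  have hex : ∀ n : ℕ, ∃ φ, IsTest ⊤ Ω φ ∧
      eLpNorm (fun x => φ x - v n x) p (volume.restrict Ω) ≤ (n + 1 : ℝ≥0∞)⁻¹ ∧
      eLpNorm (fun x => xGrad c φ x - V n x) p (volume.restrict Ω) ≤ (n + 1 : ℝ≥0∞)⁻¹ := by
    intro n
    obtain ⟨-, -, φ, hφ, hφ1, hφ2⟩ := hv n
    have hpos : (0 : ℝ≥0∞) < (n + 1 : ℝ≥0∞)⁻¹ :=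
      ENNReal.inv_pos.2 (by exact_mod_cast ENNReal.natCast_ne_top (n + 1))
    obtain ⟨k, hk1, hk2⟩ := ((hφ1.eventually_lt_const hpos).and
      (hφ2.eventually_lt_const hpos)).exists
    exact ⟨φ k, hφ k, hk1.le, hk2.le⟩
  choose φ hφ hφ1 hφ2 using hex
  have hlim : Tendsto (fun n : ℕ => (n + 1 : ℝ≥0∞)⁻¹) atTop (𝓝 0) := by
    have := (tendsto_add_atTop_iff_nat 1).2 ENNReal.tendsto_inv_nat_nhds_zero
    simpa using this
  refine ⟨hu, hG, φ, hφ, ?_, ?_⟩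
  · exact tendsto_eLpNorm_sub_trans hp (fun n => ((hφ n).memLp hΩb p).1) (fun n => (hv n).1.1) hu.1
      (tendsto_of_tendsto_of_tendsto_of_le_of_le tendsto_const_nhds hlim (fun _ => zero_le) hφ1) h1
  · exact tendsto_eLpNorm_sub_trans hp (fun n => ((hφ n).memLp_xGrad le_top hc hΩb p).1)
      (fun n => (hv n).2.1.1) hG.1
      (tendsto_of_tendsto_of_tendsto_of_le_of_le tendsto_const_nhds hlim (fun _ => zero_le) hφ2) h2

theorem tendsto_eLpNorm_of_exponent_le {X E : Type*} [MeasurableSpace X] {μ : Measure X}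
    [IsFiniteMeasure μ] [NormedAddCommGroup E] {p q : ℝ≥0∞} (hq : q ≠ 0) (hqp : q ≤ p)
    {f : ℕ → X → E} (hf : ∀ n, AEStronglyMeasurable (f n) μ)
    (h : Tendsto (fun n => eLpNorm (f n) p μ) atTop (𝓝 0)) :
    Tendsto (fun n => eLpNorm (f n) q μ) atTop (𝓝 0) := by
  have hexp : 0 ≤ 1 / q.toReal - 1 / p.toReal := by
    rw [sub_nonneg]
    rcases eq_or_ne p ⊤ with rfl | hpt
    · simp
    · have hqt : q ≠ ⊤ := ne_top_of_le_ne_top hpt hqp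
      exact one_div_le_one_div_of_le (ENNReal.toReal_pos hq hqt) (ENNReal.toReal_mono hpt hqp)
  have hfin : μ univ ^ (1 / q.toReal - 1 / p.toReal) ≠ ⊤ :=
    ENNReal.rpow_ne_top_of_nonneg hexp (measure_ne_top _ _)
  refine tendsto_of_tendsto_of_tendsto_of_le_of_le tendsto_const_nhds
    ?_ (fun _ => zero_le) fun n => eLpNorm_le_eLpNorm_mul_rpow_measure_univ hqp (hf n)
  simpa using ENNReal.Tendsto.mul_const h (Or.inr hfin)

theorem MemW0.mono_exponent (hc : ∀ j, Continuous (c j)) (hΩb : Bornology.IsBounded Ω)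
    {p q : ℝ≥0∞} (hq : q ≠ 0)
    (hqp : q ≤ p) {u : EuclideanSpace ℝ (Fin N) → ℝ}
    {G : EuclideanSpace ℝ (Fin N) → EuclideanSpace ℝ (Fin m)}
    (h : MemW0 c Ω p u G) : MemW0 c Ω q u G := by
  have : IsFiniteMeasure (volume.restrict Ω) := ⟨by simpa using hΩb.measure_lt_top⟩
  obtain ⟨hu, hG, φ, hφ, h1, h2⟩ := h
  exact ⟨hu.mono_exponent hqp, hG.mono_exponent hqp, φ, hφ,
    tendsto_eLpNorm_of_exponent_le hq hqp (fun n => (((hφ n).memLp hΩb p).sub hu).1) h1,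
    tendsto_eLpNorm_of_exponent_le hq hqp
      (fun n => (((hφ n).memLp_xGrad le_top hc hΩb p).sub hG).1) h2⟩

/-- The chain rule in `W^{1,2}_0(Ω,X)`. -/
theorem MemW0.comp (hc : ∀ j, Continuous (c j)) (hΩb : Bornology.IsBounded Ω)
    {v : EuclideanSpace ℝ (Fin N) → ℝ}
    {V : EuclideanSpace ℝ (Fin N) → EuclideanSpace ℝ (Fin m)} (h : MemW0 c Ω 2 v V)
    {S : ℝ → ℝ} (hS : ContDiff ℝ ∞ S) (hS0 : S 0 = 0) {B : ℝ} (hB : ∀ s, |deriv S s| ≤ B) :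
    MemW0 c Ω 2 (fun x => S (v x)) (fun x => deriv S (v x) • V x) := by
  obtain ⟨hv, hV, φ', hφ', h1', h2'⟩ := h
  obtain ⟨ns, hns, hae⟩ := exists_subseq_tendsto_ae two_ne_zero
    (fun n => ((hφ' n).memLp hΩb 2).1) hv.1 h1'
  set φ := fun n => φ' (ns n) with hφdef
  have hφ : ∀ n, IsTest ⊤ Ω (φ n) := fun n => hφ' _
  have h1 := h1'.comp hns.tendsto_atTop
  have h2 := h2'.comp hns.tendsto_atTop
  have htop : (1 : ℕ∞) ≤ ⊤ := le_top
  have hSd : Differentiable ℝ S := hS.differentiable (by simp)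
  have hS' : Continuous (deriv S) := hS.continuous_deriv (by exact_mod_cast le_top)
  have hB0 : 0 ≤ B := (abs_nonneg _).trans (hB 0)
  have hLip : ∀ a b, |S a - S b| ≤ B * |a - b| := fun a b => by
    simpa [Real.norm_eq_abs] using convex_univ.norm_image_sub_le_of_norm_deriv_le (f := S)
      (fun x _ => hSd x) (fun x _ => hB x) (mem_univ b) (mem_univ a)
  have hSv : MemLp (fun x => S (v x)) 2 (volume.restrict Ω) := by
    refine hv.of_le_mul (c := B) (hSd.continuous.comp_aestronglyMeasurable hv.1)
      (Eventually.of_forall fun x => ?_)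
    simpa [hS0] using hLip (v x) 0
  have hSV : MemLp (fun x => deriv S (v x) • V x) 2 (volume.restrict Ω) := by
    refine hV.of_le_mul (c := B) ((hS'.comp_aestronglyMeasurable hv.1).smul hV.1)
      (Eventually.of_forall fun x => ?_)
    rw [norm_smul]
    exact mul_le_mul_of_nonneg_right (hB _) (norm_nonneg _)
  have hzero : ∀ {f : ℕ → ℝ≥0∞}, Tendsto f atTop (𝓝 0) →
      Tendsto (fun n => ENNReal.ofReal B * f n) atTop (𝓝 0) := fun {f} hf => by
    simpa using ENNReal.Tendsto.const_mul hf (Or.inr (ENNReal.ofReal_ne_top (r := B)))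
  refine ⟨hSv, hSV, fun n x => S (φ n x), fun n => (hφ n).comp hS hS0, ?_, ?_⟩
  · refine tendsto_of_tendsto_of_tendsto_of_le_of_le tendsto_const_nhds
      (hzero h1) (fun _ => zero_le) fun n => ?_
    exact eLpNorm_le_mul_eLpNorm_of_ae_le_mul (Eventually.of_forall fun x => hLip _ _) 2
  -- The factor `S'(φ_n)` converges only pointwise almost everywhere, along the subsequence chosen
  -- above. The product with the fixed field `V` converges in `L²` by domination with `2 B ‖V‖`.
  · have hD : Tendsto (fun n => eLpNorm (fun x => (deriv S (φ n x) - deriv S (v x)) • V x) 2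
        (volume.restrict Ω)) atTop (𝓝 0) := by
      refine tendsto_eLpNorm_zero_of_dominated (g := fun x => (2 * B) * ‖V x‖) two_ne_zero
        ENNReal.ofNat_ne_top (fun n => ?_) (hV.norm.const_mul _) (fun n => ?_) ?_
      · exact ((hS'.comp_aestronglyMeasurable ((hφ n).memLp hΩb 2).1).sub
          (hS'.comp_aestronglyMeasurable hv.1)).smul hV.1
      · refine Eventually.of_forall fun x => ?_
        rw [norm_smul]
        refine mul_le_mul_of_nonneg_right ?_ (norm_nonneg _)
        refine (norm_sub_le _ _).trans ?_
        simp only [Real.norm_eq_abs]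
        linarith [hB (φ n x), hB (v x)]
      · filter_upwards [hae] with x hx
        have := (((hS'.tendsto (v x)).comp hx).sub_const (deriv S (v x))).smul_const (V x)
        simpa using this
    refine tendsto_of_tendsto_of_tendsto_of_le_of_le tendsto_const_nhds
      (by simpa using (hzero h2).add hD) (fun _ => zero_le) fun n => ?_
    have : (fun x => xGrad c (fun x => S (φ n x)) x - deriv S (v x) • V x)
        = (fun x => deriv S (φ n x) • (xGrad c (φ n) x - V x))
          + fun x => (deriv S (φ n x) - deriv S (v x)) • V x := by
      ext1 x
      rw [xGrad_comp (hSd _) ((hφ n).differentiable htop x)]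
      simp only [Pi.add_apply, smul_sub, sub_smul]
      abel
    simp only [this]
    have hm1 : AEStronglyMeasurable (fun x => xGrad c (φ n) x - V x) (volume.restrict Ω) :=
      (((hφ n).memLp_xGrad htop hc hΩb 2).sub hV).1
    refine (eLpNorm_add_le ((hS'.comp_aestronglyMeasurable ((hφ n).memLp hΩb 2).1).smul hm1)
      (((hS'.comp_aestronglyMeasurable ((hφ n).memLp hΩb 2).1).sub
          (hS'.comp_aestronglyMeasurable hv.1)).smul hV.1) one_le_two).trans ?_
    refine add_le_add_left (eLpNorm_le_mul_eLpNorm_of_ae_le_mul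
      (Eventually.of_forall fun x => ?_) 2) _
    simp only [Pi.smul_apply', norm_smul]
    exact mul_le_mul_of_nonneg_right (hB _) (norm_nonneg _)

/-- A Sobolev inequality for test functions passes to `W^{1,2}_0(Ω,X)`. -/
theorem MemW0.eLpNorm_le (hΩb : Bornology.IsBounded Ω) (hc : ∀ j, Continuous (c j))
    {p : ℝ≥0∞} {C : ℝ}
    (hC : ∀ φ, IsTest ⊤ Ω φ → eLpNorm φ p (volume.restrict Ω)
      ≤ ENNReal.ofReal C * eLpNorm (xGrad c φ) 2 (volume.restrict Ω))
    {v : EuclideanSpace ℝ (Fin N) → ℝ}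
    {V : EuclideanSpace ℝ (Fin N) → EuclideanSpace ℝ (Fin m)} (h : MemW0 c Ω 2 v V) :
    eLpNorm v p (volume.restrict Ω) ≤ ENNReal.ofReal C * eLpNorm V 2 (volume.restrict Ω) := by
  obtain ⟨hv, hV, φ, hφ, h1, h2⟩ := h
  obtain ⟨ns, hns, hae⟩ := exists_subseq_tendsto_ae two_ne_zero
    (fun n => ((hφ n).memLp hΩb 2).1) hv.1 h1
  -- The approximation is known in `L²` only, and `p` is arbitrary, so the left side passes to the
  -- limit by Fatou along an almost everywhere convergent subsequence.
  refine (Lp.eLpNorm_lim_le_liminf_eLpNorm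
    (fun n => ((hφ (ns n)).memLp hΩb 2).1) v hae).trans ?_
  have hlim : Tendsto (fun n => ENNReal.ofReal C * (eLpNorm (fun x => xGrad c (φ (ns n)) x - V x) 2
      (volume.restrict Ω) + eLpNorm V 2 (volume.restrict Ω))) atTop
      (𝓝 (ENNReal.ofReal C * (0 + eLpNorm V 2 (volume.restrict Ω)))) :=
    ENNReal.Tendsto.const_mul ((h2.comp hns.tendsto_atTop).add_const _)
      (Or.inr ENNReal.ofReal_ne_top)
  rw [zero_add] at hlim
  refine (liminf_le_liminf (Eventually.of_forall fun n => ?_)).trans hlim.liminf_eq.le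
  refine (hC _ (hφ (ns n))).trans (mul_le_mul_right ?_ _)
  have hm1 : AEStronglyMeasurable (fun x => xGrad c (φ (ns n)) x - V x) (volume.restrict Ω) :=
      (((hφ (ns n)).memLp_xGrad le_top hc hΩb 2).sub hV).1
  have : xGrad c (φ (ns n)) = (fun x => xGrad c (φ (ns n)) x - V x) + V := by ext1 x; simp
  conv_lhs => rw [this]
  exact eLpNorm_add_le hm1 hV.1 one_le_two

end

section
variable {m N : ℕ} {c : VFields m N} {Ω : Set (EuclideanSpace ℝ (Fin N))} {Q : ℝ}

/-! ### Functions of class `C^1_c(Ω)` -/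

/-- Mollification at a scale `δ` below the moduli of uniform continuity of `φ` and of its derivative
for `ε`, and small enough to keep the support in `Ω`. The derivative of the convolution is the
convolution with the derivative, so the same averaging estimate serves twice. -/
theorem IsTest.exists_smooth_approx (hΩ : IsOpen Ω) {φ : EuclideanSpace ℝ (Fin N) → ℝ}
    (hφ : IsTest 1 Ω φ) {ε : ℝ} (hε : 0 < ε) :
    ∃ ψ, IsTest ⊤ Ω ψ ∧ (∀ x, |ψ x - φ x| ≤ ε) ∧ ∀ x, ‖fderiv ℝ ψ x - fderiv ℝ φ x‖ ≤ ε := by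
  obtain ⟨hφ1, hφ2, hφ3⟩ := hφ
  have hφ1 : ContDiff ℝ 1 φ := by exact_mod_cast hφ1
  have hcd : Continuous (fderiv ℝ φ) := hφ1.continuous_fderiv one_ne_zero
  obtain ⟨δ₀, hδ₀, hK⟩ := hφ2.isCompact.exists_cthickening_subset_open hΩ hφ3
  obtain ⟨δ₁, hδ₁, h1⟩ := Metric.uniformContinuous_iff.1
    (hφ2.uniformContinuous_of_continuous hφ1.continuous) ε hε
  obtain ⟨δ₂, hδ₂, h2⟩ := Metric.uniformContinuous_iff.1
    ((hφ2.fderiv ℝ).uniformContinuous_of_continuous hcd) ε hε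
  set δ := min δ₀ (min δ₁ δ₂) with hδdef
  have hδ : 0 < δ := lt_min hδ₀ (lt_min hδ₁ hδ₂)
  let b : ContDiffBump (0 : EuclideanSpace ℝ (Fin N)) := ⟨δ / 2, δ, by positivity, by linarith⟩
  have hbr : b.rOut = δ := rfl
  set ψ := convolution (b.normed volume) φ (ContinuousLinearMap.lsmul ℝ ℝ) volume with hψ
  have hloc : LocallyIntegrable (b.normed (volume : Measure (EuclideanSpace ℝ (Fin N)))) volume :=
    b.continuous_normed.locallyIntegrable
  have hsupp : Function.support ψ ⊆ Metric.cthickening δ (tsupport φ) := by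
    refine (support_convolution_subset _).trans ?_
    rw [b.support_normed_eq, hbr]
    rintro _ ⟨y, hy, z, hz, rfl⟩
    refine Metric.thickening_subset_cthickening _ _ (Metric.mem_thickening_iff.2
      ⟨z, subset_tsupport _ hz, ?_⟩)
    simpa [dist_eq_norm] using hy
  have hsub : Metric.cthickening δ (tsupport φ) ⊆ Ω :=
    (Metric.cthickening_mono (min_le_left _ _) _).trans hK
  refine ⟨ψ, ⟨?_, ?_, ?_⟩, fun x => ?_, fun x => ?_⟩
  · exact b.hasCompactSupport_normed.contDiff_convolution_left _ b.contDiff_normed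
      hφ1.continuous.locallyIntegrable
  · exact HasCompactSupport.of_support_subset_isCompact hφ2.isCompact.cthickening hsupp
  · exact (closure_minimal hsupp Metric.isClosed_cthickening).trans hsub
  · have := b.dist_normed_convolution_le (μ := volume) (g := φ) (x₀ := x) (ε := ε)
      hφ1.continuous.aestronglyMeasurable (fun y hy => (h1 ?_).le)
    · rwa [Real.dist_eq] at this
    · rw [hbr] at hy
      exact hy.trans_le ((min_le_right _ _).trans (min_le_left _ _))
  · refine ContinuousLinearMap.opNorm_le_bound _ hε.le fun v => ?_
    have hd := (hφ2.hasFDerivAt_convolution_right (ContinuousLinearMap.lsmul ℝ ℝ) hloc hφ1 x).fderiv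
    rw [sub_apply, ← hψ] at *
    rw [hd, convolution_precompR_apply _ hloc (hφ2.fderiv ℝ) hcd]
    rw [← dist_eq_norm]
    refine b.dist_normed_convolution_le (μ := volume) (g := fun a => fderiv ℝ φ a v)
      (hcd.clm_apply continuous_const).aestronglyMeasurable (fun y hy => ?_)
    rw [hbr] at hy
    have := (h2 (hy.trans_le ((min_le_right _ _).trans (min_le_right _ _)))).le
    rw [dist_eq_norm] at this ⊢
    rw [← sub_apply]
    exact ContinuousLinearMap.le_of_opNorm_le _ this v

theorem EuclideanSpace.norm_le_sum_abs {ι : Type*} [Fintype ι] (y : EuclideanSpace ℝ ι) :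
    ‖y‖ ≤ ∑ j, |y j| := by
  refine abs_le_of_sq_le_sq' ?_ (Finset.sum_nonneg fun _ _ => abs_nonneg _) |>.2
  rw [EuclideanSpace.norm_sq_eq]
  simpa using Finset.sum_sq_le_sq_sum_of_nonneg (s := Finset.univ) (f := fun j => |y j|)
    fun _ _ => abs_nonneg _

/-- Distributional solutions are tested with `C¹_c` functions, whereas `W^{1,p}_0` is defined
through `C^∞_c`. With this lemma a `C¹_c` function may be inserted in the weak formulation. -/
theorem IsTest.memW0_of_one (hΩ : IsOpen Ω) (hc : ∀ j, Continuous (c j))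
    (hΩb : Bornology.IsBounded Ω) {p : ℝ≥0∞} (hp0 : p ≠ 0) (hpt : p ≠ ⊤)
    {φ : EuclideanSpace ℝ (Fin N) → ℝ} (hφ : IsTest 1 Ω φ) : MemW0 c Ω p φ (xGrad c φ) := by
  have : IsFiniteMeasure (volume.restrict Ω) := ⟨by simpa using hΩb.measure_lt_top⟩
  choose ψ hψ h1 h2 using fun n : ℕ =>
    hφ.exists_smooth_approx hΩ (Nat.one_div_pos_of_nat (α := ℝ) (n := n))
  have hle : ∀ n : ℕ, 1 / ((n : ℝ) + 1) ≤ 1 := fun n => by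
    rw [div_le_one (by positivity)]; linarith [n.cast_nonneg (α := ℝ)]
  have hlim : Tendsto (fun n : ℕ => 1 / ((n : ℝ) + 1)) atTop (𝓝 0) :=
    tendsto_one_div_add_atTop_nhds_zero_nat
  have hG : ∀ n x, ‖xGrad c (ψ n) x - xGrad c φ x‖ ≤ 1 / ((n : ℝ) + 1) * ∑ j, ‖c j x‖ := by
    intro n x
    refine (EuclideanSpace.norm_le_sum_abs _).trans ?_
    rw [Finset.mul_sum]
    refine Finset.sum_le_sum fun j _ => ?_
    have : (xGrad c (ψ n) x - xGrad c φ x) j = (fderiv ℝ (ψ n) x - fderiv ℝ φ x) (c j x) := by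
      simp [xGrad]
    rw [this]
    exact ContinuousLinearMap.le_of_opNorm_le _ (h2 n x) _
  refine ⟨hφ.memLp hΩb p, hφ.memLp_xGrad le_rfl hc hΩb p, ψ, hψ, ?_, ?_⟩
  · refine tendsto_eLpNorm_zero_of_dominated (g := fun _ => 1) hp0 hpt
      (fun n => (((hψ n).memLp hΩb p).sub (hφ.memLp hΩb p)).1) (memLp_const 1)
      (fun n => ae_of_all _ fun x => (h1 n x).trans (hle n)) (ae_of_all _ fun x => ?_)
    exact squeeze_zero_norm (fun n => h1 n x) hlim
  · refine tendsto_eLpNorm_zero_of_dominated (g := fun x => ∑ j, ‖c j x‖) hp0 hpt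
      (fun n => (((hψ n).memLp_xGrad le_top hc hΩb p).sub (hφ.memLp_xGrad le_rfl hc hΩb p)).1)
      ?_ (fun n => ae_of_all _ fun x => (hG n x).trans ?_) (ae_of_all _ fun x => ?_)
    · exact Continuous.memLp_restrict (continuous_finsetSum _ fun j _ => (hc j).norm) hΩb p
    · exact mul_le_of_le_one_left (Finset.sum_nonneg fun _ _ => norm_nonneg _) (hle n)
    · exact squeeze_zero_norm (fun n => hG n x) (by simpa using hlim.mul_const _)

/-! ### The bilinear form -/

variable {A : EuclideanSpace ℝ (Fin N) → Matrix (Fin m) (Fin m) ℝ} {α β : ℝ}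

theorem aForm_sub_left (x : EuclideanSpace ℝ (Fin N)) (η η' ξ : EuclideanSpace ℝ (Fin m)) :
    aForm A x (η - η') ξ = aForm A x η ξ - aForm A x η' ξ := by
  simp [aForm, mul_sub, sub_mul, Finset.sum_sub_distrib]

theorem aForm_add_left (x : EuclideanSpace ℝ (Fin N)) (η η' ξ : EuclideanSpace ℝ (Fin m)) :
    aForm A x (η + η') ξ = aForm A x η ξ + aForm A x η' ξ := by
  simp [aForm, mul_add, add_mul, Finset.sum_add_distrib]

theorem aForm_smul_left (x : EuclideanSpace ℝ (Fin N)) (a : ℝ) (η ξ : EuclideanSpace ℝ (Fin m)) :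
    aForm A x (a • η) ξ = a * aForm A x η ξ := by
  simp only [aForm, PiLp.smul_apply, smul_eq_mul, Finset.mul_sum, Finset.sum_mul]
  exact Finset.sum_congr rfl fun i _ => Finset.sum_congr rfl fun j _ => by ring

theorem aForm_add_right (x : EuclideanSpace ℝ (Fin N)) (η ξ ξ' : EuclideanSpace ℝ (Fin m)) :
    aForm A x η (ξ + ξ') = aForm A x η ξ + aForm A x η ξ' := by
  simp [aForm, mul_add, Finset.sum_add_distrib]

theorem aForm_smul_right (x : EuclideanSpace ℝ (Fin N)) (a : ℝ) (η ξ : EuclideanSpace ℝ (Fin m)) :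
    aForm A x η (a • ξ) = a * aForm A x η ξ := by
  simp only [aForm, PiLp.smul_apply, smul_eq_mul, Finset.mul_sum]
  exact Finset.sum_congr rfl fun i _ => by ring

/-- Ellipticity controls the symmetric part of `A` only, so the bound on the entries is what makes
the form continuous. The summand `1` makes the constant positive even for `m = 0`. -/
theorem IsElliptic.exists_abs_aForm_le (hA : IsElliptic Ω α β A) :
    ∃ M > 0, ∀ᵐ x ∂(volume.restrict Ω), ∀ η ξ : EuclideanSpace ℝ (Fin m),
      |aForm A x η ξ| ≤ M * (‖η‖ * ‖ξ‖) := by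
  obtain ⟨M, hM⟩ := hA.bounded
  refine ⟨∑ _i : Fin m, ∑ _j : Fin m, |M| + 1, by positivity, ?_⟩
  filter_upwards [hM] with x hx η ξ
  have h1 : |aForm A x η ξ| ≤ ∑ _i : Fin m, ∑ _j : Fin m, |M| * (‖η‖ * ‖ξ‖) := by
    refine (Finset.abs_sum_le_sum_abs _ _).trans (Finset.sum_le_sum fun i _ => ?_)
    rw [Finset.sum_mul]
    refine (Finset.abs_sum_le_sum_abs _ _).trans (Finset.sum_le_sum fun j _ => ?_)
    rw [abs_mul, abs_mul, mul_assoc]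
    have h2 : |η j| ≤ ‖η‖ := PiLp.norm_apply_le η j
    have h3 : |ξ i| ≤ ‖ξ‖ := PiLp.norm_apply_le ξ i
    have h4 : |A x i j| ≤ |M| := (hx i j).trans (le_abs_self _)
    gcongr
  refine h1.trans ?_
  simp only [← Finset.sum_mul]
  have : 0 ≤ ‖η‖ * ‖ξ‖ := by positivity
  linarith

theorem IsElliptic.aestronglyMeasurable (hA : IsElliptic Ω α β A)
    {G H : EuclideanSpace ℝ (Fin N) → EuclideanSpace ℝ (Fin m)}
    (hG : AEStronglyMeasurable G (volume.restrict Ω))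
    (hH : AEStronglyMeasurable H (volume.restrict Ω)) :
    AEStronglyMeasurable (fun x => aForm A x (G x) (H x)) (volume.restrict Ω) := by
  have hcoord : ∀ {F : EuclideanSpace ℝ (Fin N) → EuclideanSpace ℝ (Fin m)},
      AEStronglyMeasurable F (volume.restrict Ω) → ∀ j,
      AEStronglyMeasurable (fun x => F x j) (volume.restrict Ω) := fun hF j =>
    (EuclideanSpace.proj (𝕜 := ℝ) j).continuous.comp_aestronglyMeasurable hF
  unfold aForm
  refine Finset.aestronglyMeasurable_fun_sum _ fun i _ => ?_
  refine AEStronglyMeasurable.mul ?_ (hcoord hH i)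
  exact Finset.aestronglyMeasurable_fun_sum _ fun j _ =>
    (hA.measurable i j).aestronglyMeasurable.mul (hcoord hG j)

theorem IsElliptic.integrable (hA : IsElliptic Ω α β A)
    {G H : EuclideanSpace ℝ (Fin N) → EuclideanSpace ℝ (Fin m)}
    {p q : ℝ≥0∞} [p.HolderTriple q 1]
    (hG : MemLp G p (volume.restrict Ω)) (hH : MemLp H q (volume.restrict Ω)) :
    Integrable (fun x => aForm A x (G x) (H x)) (volume.restrict Ω) := by
  obtain ⟨M, hM, hle⟩ := hA.exists_abs_aForm_le
  refine Integrable.mono' ((hG.norm.integrable_mul hH.norm).const_mul M)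
    (hA.aestronglyMeasurable hG.1 hH.1) ?_
  filter_upwards [hle] with x hx
  exact hx _ _

/-- Passage to the limit in the bilinear form, tested with a bounded field. -/
theorem IsElliptic.tendsto_integral (hA : IsElliptic Ω α β A)
    {V : ℕ → EuclideanSpace ℝ (Fin N) → EuclideanSpace ℝ (Fin m)}
    {G H : EuclideanSpace ℝ (Fin N) → EuclideanSpace ℝ (Fin m)}
    (hV : ∀ n, MemLp (V n) 1 (volume.restrict Ω)) (hG : MemLp G 1 (volume.restrict Ω))
    (hH : AEStronglyMeasurable H (volume.restrict Ω)) {B : ℝ}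
    (hB : ∀ᵐ x ∂(volume.restrict Ω), ‖H x‖ ≤ B)
    (h : Tendsto (fun n => eLpNorm (fun x => V n x - G x) 1 (volume.restrict Ω)) atTop (𝓝 0)) :
    Tendsto (fun n => ∫ x in Ω, aForm A x (V n x) (H x)) atTop
      (𝓝 (∫ x in Ω, aForm A x (G x) (H x))) := by
  obtain ⟨M, hM, hle⟩ := hA.exists_abs_aForm_le
  have hH' : MemLp H ⊤ (volume.restrict Ω) := memLp_top_of_bound hH B hB
  refine tendsto_integral_of_L1' _ (hA.integrable hG hH').aestronglyMeasurable
    (Eventually.of_forall fun n => hA.integrable (hV n) hH') ?_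
  refine tendsto_of_tendsto_of_tendsto_of_le_of_le tendsto_const_nhds
    (by simpa using ENNReal.Tendsto.const_mul h (Or.inr (ENNReal.ofReal_ne_top (r := M * B))))
    (fun _ => zero_le) fun n => ?_
  refine eLpNorm_le_mul_eLpNorm_of_ae_le_mul ?_ 1
  filter_upwards [hle, hB] with x hx hBx
  simp only [Pi.sub_apply, ← aForm_sub_left]
  refine (hx _ _).trans ?_
  rw [mul_assoc, mul_comm B]
  gcongr

end

/-! ### Hölder's inequality and the dual Sobolev exponents -/

theorem abs_integral_le_mul_toReal_eLpNorm {X E F : Type*} [MeasurableSpace X] {μ : Measure X}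
    [NormedAddCommGroup E] [NormedAddCommGroup F] {p q : ℝ≥0∞} [p.HolderTriple q 1]
    {f : X → E} {g : X → F} {h : X → ℝ} {M : ℝ} (hM : 0 ≤ M) (hf : MemLp f p μ)
    (hg : MemLp g q μ) (hle : ∀ᵐ x ∂μ, |h x| ≤ M * (‖f x‖ * ‖g x‖)) :
    |∫ x, h x ∂μ| ≤ M * ((eLpNorm f p μ).toReal * (eLpNorm g q μ).toReal) := by
  have h1 : eLpNorm (fun x => ‖f x‖ * ‖g x‖) 1 μ ≤ eLpNorm f p μ * eLpNorm g q μ := by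
    simpa using eLpNorm_le_eLpNorm_mul_eLpNorm_of_nnnorm hf.1 hg.1
      (fun a b => ‖a‖ * ‖b‖) 1 (ae_of_all _ fun x => by simp)
  have hint : Integrable (fun x => ‖f x‖ * ‖g x‖) μ := hf.norm.integrable_mul hg.norm
  have h2 : ∫ x, ‖f x‖ * ‖g x‖ ∂μ = (eLpNorm (fun x => ‖f x‖ * ‖g x‖) 1 μ).toReal := by
    rw [eLpNorm_one_eq_lintegral_enorm, ← integral_norm_eq_lintegral_enorm hint.1]
    refine integral_congr_ae (ae_of_all _ fun x => ?_)
    simp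
  calc |∫ x, h x ∂μ| ≤ ∫ x, M * (‖f x‖ * ‖g x‖) ∂μ :=
        norm_integral_le_of_norm_le (f := h) (hint.const_mul M) hle
    _ = M * (eLpNorm (fun x => ‖f x‖ * ‖g x‖) 1 μ).toReal := by rw [integral_const_mul, h2]
    _ ≤ _ := by
        rw [← ENNReal.toReal_mul]
        gcongr
        exact ENNReal.mul_ne_top hf.2.ne hg.2.ne

/-- The reciprocals of the exponents add up to `1`; this is why `L^{2Q/(Q+2)}` is the natural space
for the data of weak solutions. -/
theorem holderTriple_ofReal_sobolev {Q : ℝ} (hQ : 2 < Q) :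
    (ENNReal.ofReal (2 * Q / (Q + 2))).HolderTriple (ENNReal.ofReal (2 * Q / (Q - 2))) 1 := by
  have : (2 * Q / (Q + 2)).HolderConjugate (2 * Q / (Q - 2)) := by
    rw [Real.holderConjugate_iff]
    refine ⟨?_, ?_⟩
    · rw [lt_div_iff₀ (by linarith)]; linarith
    · rw [inv_div, inv_div]; field_simp; ring
  exact this.ennrealOfReal

section
variable {m N : ℕ} {c : VFields m N} {Ω : Set (EuclideanSpace ℝ (Fin N))} {Q : ℝ}
variable {A : EuclideanSpace ℝ (Fin N) → Matrix (Fin m) (Fin m) ℝ} {α β : ℝ}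

theorem MemW0.congr {p : ℝ≥0∞} {u u' : EuclideanSpace ℝ (Fin N) → ℝ}
    {G G' : EuclideanSpace ℝ (Fin N) → EuclideanSpace ℝ (Fin m)} (h : MemW0 c Ω p u G)
    (hu : u =ᵐ[volume.restrict Ω] u') (hG : G =ᵐ[volume.restrict Ω] G') :
    MemW0 c Ω p u' G' := by
  obtain ⟨h1, h2, φ, hφ, h3, h4⟩ := h
  refine ⟨h1.ae_eq hu, h2.ae_eq hG, φ, hφ, h3.congr fun k => eLpNorm_congr_ae ?_,
    h4.congr fun k => eLpNorm_congr_ae ?_⟩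
  · filter_upwards [hu] with x hx
    rw [hx]
  · filter_upwards [hG] with x hx
    rw [hx]

theorem MemW0.const_mul (hc : ∀ j, Continuous (c j)) (hΩb : Bornology.IsBounded Ω)
    {v : EuclideanSpace ℝ (Fin N) → ℝ}
    {V : EuclideanSpace ℝ (Fin N) → EuclideanSpace ℝ (Fin m)} (h : MemW0 c Ω 2 v V) (a : ℝ) :
    MemW0 c Ω 2 (fun x => a * v x) (fun x => a • V x) := by
  have hd : deriv (fun s : ℝ => a * s) = fun _ => a := by
    ext s; simp
  simpa [hd] using h.comp hc hΩb (S := fun s => a * s) (contDiff_const.mul contDiff_id)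
    (mul_zero a) (B := |a|) (by simp [hd])

theorem MemW0.add (hc : ∀ j, Continuous (c j)) (hΩb : Bornology.IsBounded Ω)
    {u v : EuclideanSpace ℝ (Fin N) → ℝ}
    {G H : EuclideanSpace ℝ (Fin N) → EuclideanSpace ℝ (Fin m)}
    (hu : MemW0 c Ω 2 u G) (hv : MemW0 c Ω 2 v H) :
    MemW0 c Ω 2 (fun x => u x + v x) (fun x => G x + H x) := by
  simpa using hu.sub hc hΩb one_le_two (hv.const_mul hc hΩb (-1))

/-! ### Weak solutions -/

/-- `W^{1,2}_0(Ω,X)` as a space of pairs (function, `X`-gradient). -/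
def w0Submodule (hc : ∀ j, Continuous (c j)) (hΩb : Bornology.IsBounded Ω) :
    Submodule ℝ (WithLp 2 (Lp ℝ 2 (volume.restrict Ω) ×
      Lp (EuclideanSpace ℝ (Fin m)) 2 (volume.restrict Ω))) where
  carrier := {z | MemW0 c Ω 2 z.fst z.snd}
  add_mem' {z w} hz hw := (MemW0.add hc hΩb hz hw).congr (Lp.coeFn_add z.fst w.fst).symm
    (Lp.coeFn_add z.snd w.snd).symm
  zero_mem' := by
    have h0 : IsTest ⊤ Ω (fun _ : EuclideanSpace ℝ (Fin N) => (0 : ℝ)) :=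
      ⟨contDiff_const, HasCompactSupport.zero, by simp [tsupport]⟩
    refine (h0.memW0 hc hΩb 2).congr (Lp.coeFn_zero ℝ 2 _).symm ?_
    refine EventuallyEq.trans (Eventually.of_forall fun x => ?_) (Lp.coeFn_zero _ 2 _).symm
    ext j
    simp [xGrad]
  smul_mem' a z hz := (MemW0.const_mul hc hΩb hz a).congr (Lp.coeFn_smul a z.fst).symm
    (Lp.coeFn_smul a z.snd).symm

theorem isClosed_w0Submodule (hc : ∀ j, Continuous (c j)) (hΩb : Bornology.IsBounded Ω) :
    IsClosed (w0Submodule hc hΩb : Set (WithLp 2 (Lp ℝ 2 (volume.restrict Ω) ×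
      Lp (EuclideanSpace ℝ (Fin m)) 2 (volume.restrict Ω)))) := by
  refine IsSeqClosed.isClosed fun z w hz hw => ?_
  have h1 := ((WithLp.fstL 2 ℝ _ _).continuous.tendsto w).comp hw
  have h2 := ((WithLp.sndL 2 ℝ _ _).continuous.tendsto w).comp hw
  exact MemW0.of_tendsto hc hΩb one_le_two hz (Lp.memLp _) (Lp.memLp _)
    ((Lp.tendsto_Lp_iff_tendsto_eLpNorm' _ _).1 h1) ((Lp.tendsto_Lp_iff_tendsto_eLpNorm' _ _).1 h2)

/-- `W^{1,2}_0(Ω,X)` is a Hilbert space. -/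
theorem exists_hilbert_memW0 (hc : ∀ j, Continuous (c j)) (hΩb : Bornology.IsBounded Ω) :
    ∃ (K : Type) (_ : NormedAddCommGroup K) (_ : InnerProductSpace ℝ K) (_ : CompleteSpace K)
      (F : K →L[ℝ] Lp ℝ 2 (volume.restrict Ω))
      (P : K →L[ℝ] Lp (EuclideanSpace ℝ (Fin m)) 2 (volume.restrict Ω)),
      (∀ z, MemW0 c Ω 2 (F z) (P z)) ∧ (∀ z, ‖z‖ ^ 2 = ‖F z‖ ^ 2 + ‖P z‖ ^ 2) ∧
      ∀ v V, MemW0 c Ω 2 v V → ∃ z, F z =ᵐ[volume.restrict Ω] v ∧ P z =ᵐ[volume.restrict Ω] V := by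
  refine ⟨w0Submodule hc hΩb, inferInstance, inferInstance,
    (isClosed_w0Submodule hc hΩb).completeSpace_coe,
    (WithLp.fstL 2 ℝ _ _).comp (w0Submodule hc hΩb).subtypeL,
    (WithLp.sndL 2 ℝ _ _).comp (w0Submodule hc hΩb).subtypeL, fun z => z.2,
    fun z => WithLp.prod_norm_sq_eq_of_L2 z.1,
    fun v V h => ⟨⟨WithLp.toLp 2 (h.1.toLp v, h.2.1.toLp V),
      h.congr h.1.coeFn_toLp.symm h.2.1.coeFn_toLp.symm⟩, h.1.coeFn_toLp, h.2.1.coeFn_toLp⟩⟩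

variable {C : ℝ}

theorem IsElliptic.exists_bilinear (hA : IsElliptic Ω α β A) :
    ∃ B : Lp (EuclideanSpace ℝ (Fin m)) 2 (volume.restrict Ω) →L[ℝ]
      Lp (EuclideanSpace ℝ (Fin m)) 2 (volume.restrict Ω) →L[ℝ] ℝ,
      ∀ V W, B V W = ∫ x in Ω, aForm A x (V x) (W x) := by
  obtain ⟨M, hM, hle⟩ := hA.exists_abs_aForm_le
  have hint : ∀ V W : Lp (EuclideanSpace ℝ (Fin m)) 2 (volume.restrict Ω),
      Integrable (fun x => aForm A x (V x) (W x)) (volume.restrict Ω) := fun V W =>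
    hA.integrable (p := 2) (q := 2) (Lp.memLp V) (Lp.memLp W)
  refine ⟨LinearMap.mkContinuous₂ (LinearMap.mk₂ ℝ
    (fun V W => ∫ x in Ω, aForm A x (V x) (W x)) ?_ ?_ ?_ ?_) M ?_, fun V W => rfl⟩
  · intro V V' W
    rw [← integral_add (hint V W) (hint V' W)]
    refine integral_congr_ae ?_
    filter_upwards [Lp.coeFn_add V V'] with x hx
    rw [← aForm_add_left, hx, Pi.add_apply]
  · intro a V W
    rw [smul_eq_mul, ← integral_const_mul]
    refine integral_congr_ae ?_
    filter_upwards [Lp.coeFn_smul a V] with x hx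
    rw [← aForm_smul_left, hx, Pi.smul_apply]
  · intro V W W'
    rw [← integral_add (hint V W) (hint V W')]
    refine integral_congr_ae ?_
    filter_upwards [Lp.coeFn_add W W'] with x hx
    rw [← aForm_add_right, hx, Pi.add_apply]
  · intro a V W
    rw [smul_eq_mul, ← integral_const_mul]
    refine integral_congr_ae ?_
    filter_upwards [Lp.coeFn_smul a W] with x hx
    rw [← aForm_smul_right, hx, Pi.smul_apply]
  · intro V W
    refine (abs_integral_le_mul_toReal_eLpNorm (p := 2) (q := 2) hM.le
      (Lp.memLp V) (Lp.memLp W) (by filter_upwards [hle] with x hx using hx _ _)).trans ?_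
    rw [mul_assoc]
    rfl

theorem MemW0.memLp_sobolev (hc : ∀ j, Continuous (c j)) (hΩb : Bornology.IsBounded Ω)
    {p : ℝ≥0∞}
    (hC : ∀ φ, IsTest ⊤ Ω φ → eLpNorm φ p (volume.restrict Ω)
      ≤ ENNReal.ofReal C * eLpNorm (xGrad c φ) 2 (volume.restrict Ω))
    {v : EuclideanSpace ℝ (Fin N) → ℝ}
    {V : EuclideanSpace ℝ (Fin N) → EuclideanSpace ℝ (Fin m)} (h : MemW0 c Ω 2 v V) :
    MemLp v p (volume.restrict Ω) :=
  ⟨h.1.1, (h.eLpNorm_le hΩb hc hC).trans_lt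
    (ENNReal.mul_lt_top ENNReal.ofReal_lt_top h.2.1.2)⟩

/-- Lax–Milgram, as `A` need not be symmetric. The Sobolev inequality is used twice: with Hölder's
inequality it makes the datum a bounded functional, and on the finite measure of `Ω` it bounds the
function by its `X`-gradient in `L²`, which gives coercivity. -/
theorem exists_isWeakSol (hQ : 2 < Q) (hc : ∀ j, Continuous (c j))
    (hΩb : Bornology.IsBounded Ω) (hα : 0 < α) (hA : IsElliptic Ω α β A)
    (hC0 : 0 < C)
    (hC : ∀ φ, IsTest ⊤ Ω φ → eLpNorm φ (ENNReal.ofReal (2 * Q / (Q - 2))) (volume.restrict Ω)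
      ≤ ENNReal.ofReal C * eLpNorm (xGrad c φ) 2 (volume.restrict Ω))
    {g : EuclideanSpace ℝ (Fin N) → ℝ}
    (hg : MemLp g (ENNReal.ofReal (2 * Q / (Q + 2))) (volume.restrict Ω)) :
    ∃ v V, IsWeakSol c Ω A g v V := by
  have : IsFiniteMeasure (volume.restrict Ω) := ⟨by simpa using hΩb.measure_lt_top⟩
  have := holderTriple_ofReal_sobolev hQ
  have hpp : 0 < 2 * Q / (Q - 2) := div_pos (by linarith) (by linarith)
  have h2p : 2 ≤ ENNReal.ofReal (2 * Q / (Q - 2)) := by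
    rw [ENNReal.le_ofReal_iff_toReal_le ENNReal.ofNat_ne_top hpp.le, le_div_iff₀ (by linarith)]
    rw [ENNReal.toReal_ofNat]
    linarith
  obtain ⟨K, _, _, _, F, P, hFP, hnorm, hsurj⟩ := exists_hilbert_memW0 (c := c) (Ω := Ω) hc hΩb
  have hSob : ∀ z, MemLp (F z) (ENNReal.ofReal (2 * Q / (Q - 2))) (volume.restrict Ω) :=
    fun z => (hFP z).memLp_sobolev hc hΩb hC
  have hPle : ∀ z, ‖P z‖ ≤ ‖z‖ := fun z => by
    refine abs_le_of_sq_le_sq' ?_ (norm_nonneg _) |>.2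
    rw [hnorm]
    exact le_add_of_nonneg_left (sq_nonneg _)
  -- the functional
  have hintg : ∀ z, Integrable (fun x => g x * F z x) (volume.restrict Ω) := fun z =>
    hg.integrable_mul (hSob z)
  let L₀ : K →ₗ[ℝ] ℝ :=
    { toFun := fun z => ∫ x in Ω, g x * F z x
      map_add' := fun z w => by
        rw [← integral_add (hintg z) (hintg w), map_add]
        refine integral_congr_ae ?_
        filter_upwards [Lp.coeFn_add (F z) (F w)] with x hx
        rw [← mul_add, hx, Pi.add_apply]
      map_smul' := fun a z => by
        rw [RingHom.id_apply, smul_eq_mul, ← integral_const_mul, map_smul]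
        refine integral_congr_ae ?_
        filter_upwards [Lp.coeFn_smul a (F z)] with x hx
        rw [mul_left_comm, hx, Pi.smul_apply, smul_eq_mul] }
  have hL₀ : ∀ z, ‖L₀ z‖ ≤
      (eLpNorm g (ENNReal.ofReal (2 * Q / (Q + 2))) (volume.restrict Ω)).toReal * C * ‖z‖ := by
    intro z
    refine (abs_integral_le_mul_toReal_eLpNorm zero_le_one hg (hSob z)
      (h := fun x => g x * F z x) (ae_of_all _ fun x => by simp [abs_mul])).trans ?_
    rw [one_mul, mul_assoc]
    refine mul_le_mul_of_nonneg_left ?_ ENNReal.toReal_nonneg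
    refine (ENNReal.toReal_mono (ENNReal.mul_ne_top ENNReal.ofReal_ne_top
      (Lp.memLp (P z)).2.ne) ((hFP z).eLpNorm_le hΩb hc hC)).trans ?_
    rw [ENNReal.toReal_mul, ENNReal.toReal_ofReal hC0.le]
    exact mul_le_mul_of_nonneg_left (hPle z) hC0.le
  let L : K →L[ℝ] ℝ := L₀.mkContinuous _ hL₀
  have hL : ∀ z, L z = ∫ x in Ω, g x * F z x := fun z => rfl
  -- the coercive form
  obtain ⟨B₀, hB₀⟩ := hA.exists_bilinear
  let B := B₀.bilinearComp P P
  have hB : ∀ z w, B z w = ∫ x in Ω, aForm A x (P z x) (P w x) := fun z w => hB₀ _ _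
  have hcoer : IsCoercive B := by
    set κ := volume.restrict Ω univ
      ^ (1 / (2 : ℝ≥0∞).toReal - 1 / (ENNReal.ofReal (2 * Q / (Q - 2))).toReal) with hκ
    have hκt : κ ≠ ⊤ := by
      refine ENNReal.rpow_ne_top_of_nonneg ?_ (measure_ne_top _ _)
      rw [sub_nonneg]
      exact one_div_le_one_div_of_le (by simp) (ENNReal.toReal_mono ENNReal.ofReal_ne_top h2p)
    -- From `‖F z‖ ≤ C κ ‖P z‖` the full norm satisfies `‖z‖² ≤ ((C κ)² + 1) ‖P z‖²`, while
    -- ellipticity bounds the form below by `α ‖P z‖²`.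
    refine ⟨α / ((C * κ.toReal) ^ 2 + 1), by positivity, fun z => ?_⟩
    have h1 := (eLpNorm_le_eLpNorm_mul_rpow_measure_univ h2p (hSob z).1).trans
      (mul_le_mul_left ((hFP z).eLpNorm_le hΩb hc hC) _)
    have h2 := ENNReal.toReal_mono (ENNReal.mul_ne_top (ENNReal.mul_ne_top ENNReal.ofReal_ne_top
      (Lp.memLp (P z)).2.ne) hκt) h1
    rw [ENNReal.toReal_mul, ENNReal.toReal_mul, ENNReal.toReal_ofReal hC0.le] at h2
    have h3 : ‖F z‖ ≤ C * κ.toReal * ‖P z‖ := by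
      calc ‖F z‖ ≤ C * ‖P z‖ * κ.toReal := h2
        _ = _ := by ring
    have h4 : ‖F z‖ ^ 2 ≤ (C * κ.toReal) ^ 2 * ‖P z‖ ^ 2 := by
      rw [← mul_pow]
      exact pow_le_pow_left₀ (norm_nonneg _) h3 2
    have h5 : ‖P z‖ ^ 2 = ∫ x in Ω, ‖P z x‖ ^ 2 := (Lp.memLp (P z)).sq_toReal_eLpNorm_two
    have h6 : α * ‖P z‖ ^ 2 ≤ B z z := by
      rw [hB, h5, ← integral_const_mul]
      refine integral_mono_ae ?_
        (hA.integrable (p := 2) (q := 2) (Lp.memLp (P z)) (Lp.memLp (P z))) ?_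
      · exact ((Lp.memLp (P z)).norm.integrable_sq).const_mul α
      · filter_upwards [hA.elliptic] with x hx using (hx _).1
    refine le_trans ?_ h6
    rw [mul_assoc, ← sq, div_mul_eq_mul_div, div_le_iff₀ (by positivity), mul_assoc, hnorm]
    refine mul_le_mul_of_nonneg_left ?_ hα.le
    linarith
  set z := hcoer.continuousLinearEquivOfBilin.symm ((InnerProductSpace.toDual ℝ K).symm L)
    with hz
  have hsol : ∀ w, B z w = L w := fun w => by
    rw [← hcoer.continuousLinearEquivOfBilin_apply, hz, ContinuousLinearEquiv.apply_symm_apply,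
      InnerProductSpace.toDual_symm_apply]
  refine ⟨F z, P z, hFP z, fun v V hv => ⟨?_, ?_, ?_⟩⟩
  · exact hA.integrable (p := 2) (q := 2) (hFP z).2.1 hv.2.1
  · exact hg.integrable_mul (hv.memLp_sobolev hc hΩb hC)
  · obtain ⟨w, hw1, hw2⟩ := hsurj v V hv
    have := hsol w
    rw [hB, hL] at this
    refine (integral_congr_ae ?_).trans (this.trans (integral_congr_ae ?_))
    · filter_upwards [hw2] with x hx
      rw [hx]
    · filter_upwards [hw1] with x hx
      rw [hx]

/-- Through this linearity every estimate for one solution becomes an estimate for the difference of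
two, in terms of the difference of their data. -/
theorem IsWeakSol.sub (hc : ∀ j, Continuous (c j)) (hΩb : Bornology.IsBounded Ω)
    {g g' v v' : EuclideanSpace ℝ (Fin N) → ℝ}
    {V V' : EuclideanSpace ℝ (Fin N) → EuclideanSpace ℝ (Fin m)}
    (h : IsWeakSol c Ω A g v V) (h' : IsWeakSol c Ω A g' v' V') :
    IsWeakSol c Ω A (fun x => g x - g' x) (fun x => v x - v' x) (fun x => V x - V' x) := by
  refine ⟨h.1.sub hc hΩb one_le_two h'.1, fun w W hw => ?_⟩
  obtain ⟨h1, h2, h3⟩ := h.2 w W hw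
  obtain ⟨h1', h2', h3'⟩ := h'.2 w W hw
  simp only [aForm_sub_left, sub_mul]
  exact ⟨h1.sub h1', h2.sub h2', by rw [integral_sub h1 h1', integral_sub h2 h2', h3, h3']⟩

/-- The difference of two solutions is an admissible test function for itself. Ellipticity kills its
`X`-gradient, and the Sobolev inequality then kills the difference. -/
theorem IsWeakSol.unique (hQ : 2 < Q) (hc : ∀ j, Continuous (c j))
    (hΩb : Bornology.IsBounded Ω) (hα : 0 < α) (hA : IsElliptic Ω α β A)
    (hC : ∀ φ, IsTest ⊤ Ω φ → eLpNorm φ (ENNReal.ofReal (2 * Q / (Q - 2))) (volume.restrict Ω)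
      ≤ ENNReal.ofReal C * eLpNorm (xGrad c φ) 2 (volume.restrict Ω))
    {g v v' : EuclideanSpace ℝ (Fin N) → ℝ}
    {V V' : EuclideanSpace ℝ (Fin N) → EuclideanSpace ℝ (Fin m)}
    (h : IsWeakSol c Ω A g v V) (h' : IsWeakSol c Ω A g v' V') :
    v =ᵐ[volume.restrict Ω] v' ∧ V =ᵐ[volume.restrict Ω] V' := by
  have hd := h.sub hc hΩb h'
  obtain ⟨h1, -, h3⟩ := hd.2 _ _ hd.1
  simp only [sub_self, zero_mul, integral_zero] at h3
  have hsq : Integrable (fun x => ‖V x - V' x‖ ^ 2) (volume.restrict Ω) :=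
    hd.1.2.1.norm.integrable_sq
  have hle : ∫ x in Ω, α * ‖V x - V' x‖ ^ 2 ≤ 0 := by
    rw [← h3]
    refine integral_mono_ae (hsq.const_mul α) h1 ?_
    filter_upwards [hA.elliptic] with x hx using (hx _).1
  have h0 : ∫ x in Ω, ‖V x - V' x‖ ^ 2 = 0 := by
    rw [integral_const_mul] at hle
    refine le_antisymm (nonpos_of_mul_nonpos_right hle hα) (integral_nonneg fun _ => by positivity)
  have hV : (fun x => V x - V' x) =ᵐ[volume.restrict Ω] 0 := by
    filter_upwards [(integral_eq_zero_iff_of_nonneg (fun _ => by positivity) hsq).1 h0] with x hx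
    simpa using hx
  have hv : (fun x => v x - v' x) =ᵐ[volume.restrict Ω] 0 := by
    have h4 := hd.1.eLpNorm_le hΩb hc hC
    rw [eLpNorm_congr_ae hV, eLpNorm_zero, mul_zero] at h4
    refine (eLpNorm_eq_zero_iff hd.1.1.1 ?_).1 (le_antisymm h4 zero_le)
    have : 0 < 2 * Q / (Q - 2) := div_pos (by linarith) (by linarith)
    simpa using this
  exact ⟨by filter_upwards [hv] with x hx; simpa [sub_eq_zero] using hx,
    by filter_upwards [hV] with x hx; simpa [sub_eq_zero] using hx⟩

end

/-! ### Weak-type bounds -/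

section
variable {X E : Type*} [MeasurableSpace X] {μ : Measure X} [NormedAddCommGroup E]

/-- On a finite measure space a weak-type bound of exponent `p` gives a strong bound of every
exponent `s < p`. -/
theorem exists_eLpNorm_le_of_meas_ge_le [IsFiniteMeasure μ] {s p : ℝ} (hs : 0 < s) (hsp : s < p) :
    ∃ C : ℝ≥0∞, C ≠ ⊤ ∧ ∀ (w : X → E) (K : ℝ), AEStronglyMeasurable w μ → 0 < K →
      (∀ t, 0 < t → μ {x | t ≤ ‖w x‖} ≤ ENNReal.ofReal ((K / t) ^ p)) →
      eLpNorm w (ENNReal.ofReal s) μ ≤ C * ENNReal.ofReal K := by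
  -- The layer-cake integral of `w / K` is split at `t = 1`: below, the finite total measure is
  -- used, above, the weak-type bound. The two pieces converge because `s > 0` and `s < p`.
  set I₁ := ∫⁻ t in Ioc (0 : ℝ) 1, μ univ * ENNReal.ofReal (t ^ (s - 1)) with hI₁
  set I₂ := ∫⁻ t in Ioi (1 : ℝ), ENNReal.ofReal (t ^ (s - 1 - p)) with hI₂
  have hI₁t : I₁ ≠ ⊤ := by
    rw [hI₁, lintegral_const_mul' _ _ (measure_ne_top _ _)]
    refine ENNReal.mul_ne_top (measure_ne_top _ _) ?_
    have := (intervalIntegral.intervalIntegrable_rpow' (a := 0) (b := 1) (r := s - 1)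
      (by linarith)).1
    refine ne_top_of_le_ne_top this.2.ne (lintegral_mono fun t => ?_)
    exact Real.ofReal_le_enorm _
  have hI₂t : I₂ ≠ ⊤ := by
    have := integrableOn_Ioi_rpow_of_lt (a := s - 1 - p) (by linarith) one_pos
    refine ne_top_of_le_ne_top this.2.ne (lintegral_mono fun t => ?_)
    exact Real.ofReal_le_enorm _
  refine ⟨(ENNReal.ofReal s * (I₁ + I₂)) ^ (1 / s),
    ENNReal.rpow_ne_top_of_nonneg (by positivity)
      (ENNReal.mul_ne_top ENNReal.ofReal_ne_top (ENNReal.add_ne_top.2 ⟨hI₁t, hI₂t⟩)), ?_⟩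
  intro w K hw hK hle
  set f : X → ℝ := fun x => ‖w x‖ / K with hf
  have hf0 : ∀ x, 0 ≤ f x := fun x => by positivity
  have hfm : AEMeasurable f μ := hw.norm.aemeasurable.div_const K
  have hfle : ∀ t, 0 < t → μ {x | t ≤ f x} ≤ ENNReal.ofReal (t ^ (-p)) := by
    intro t ht
    have : {x | t ≤ f x} = {x | K * t ≤ ‖w x‖} := by
      ext x
      simp only [hf, mem_ofPred_eq, le_div_iff₀ hK, mul_comm]
    rw [this]
    refine (hle (K * t) (by positivity)).trans (le_of_eq ?_)
    rw [div_mul_cancel_left₀ hK.ne', Real.inv_rpow ht.le, Real.rpow_neg ht.le]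
  have hmain : ∫⁻ x, ENNReal.ofReal (f x ^ s) ∂μ ≤ ENNReal.ofReal s * (I₁ + I₂) := by
    rw [lintegral_rpow_eq_lintegral_meas_le_mul μ (ae_of_all _ hf0) hfm hs,
      ← Ioc_union_Ioi_eq_Ioi zero_le_one,
      lintegral_union measurableSet_Ioi Ioc_disjoint_Ioi_same]
    refine mul_le_mul_right (add_le_add ?_ ?_) _
    · exact lintegral_mono fun t => mul_le_mul_left (measure_mono (subset_univ _)) _
    · refine setLIntegral_mono' measurableSet_Ioi fun t ht => ?_
      have ht0 : 0 < t := one_pos.trans ht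
      refine (mul_le_mul_left (hfle t ht0) _).trans (le_of_eq ?_)
      rw [← ENNReal.ofReal_mul (by positivity), ← Real.rpow_add ht0]
      congr 2
      ring
  have hwf : ∀ x, ‖w x‖ₑ ^ s = ENNReal.ofReal K ^ s * ENNReal.ofReal (f x ^ s) := by
    intro x
    rw [ENNReal.ofReal_rpow_of_pos hK, ← ENNReal.ofReal_mul (by positivity),
      ← Real.mul_rpow hK.le (hf0 x), ← ofReal_norm,
      ENNReal.ofReal_rpow_of_nonneg (norm_nonneg _) hs.le]
    simp only [hf]
    rw [mul_div_cancel₀ _ hK.ne']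
  have hs' : (ENNReal.ofReal s).toReal = s := ENNReal.toReal_ofReal hs.le
  rw [eLpNorm_eq_lintegral_rpow_enorm_toReal (by simpa using hs) ENNReal.ofReal_ne_top, hs']
  simp only [hwf]
  have hKs : ENNReal.ofReal K ^ s ≠ ⊤ := ENNReal.rpow_ne_top_of_nonneg hs.le ENNReal.ofReal_ne_top
  rw [lintegral_const_mul' _ _ hKs, ENNReal.mul_rpow_of_nonneg _ _ (by positivity),
    ← ENNReal.rpow_mul, mul_one_div_cancel hs.ne', ENNReal.rpow_one, mul_comm]
  gcongr

/-- Uniform weak-type bounds pass to limits in measure. -/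
theorem meas_ge_le_of_tendstoInMeasure {w : ℕ → X → E} {w' : X → E} {K p : ℝ}
    (h : TendstoInMeasure μ w atTop w')
    (hle : ∀ᶠ n in atTop, ∀ t, 0 < t → μ {x | t ≤ ‖w n x‖} ≤ ENNReal.ofReal ((K / t) ^ p))
    {t : ℝ} (ht : 0 < t) : μ {x | t ≤ ‖w' x‖} ≤ ENNReal.ofReal ((2 * K / t) ^ p) := by
  have h1 := tendstoInMeasure_iff_norm.1 h (t / 2) (by positivity)
  have h2 := h1.const_add (ENNReal.ofReal ((2 * K / t) ^ p))
  rw [add_zero] at h2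
  refine ge_of_tendsto h2 ?_
  filter_upwards [hle] with n hn
  -- Where `‖w'‖ ≥ t`, either `w n` or its distance from `w'` is at least `t / 2`; halving the level
  -- is the origin of the factor `2` in the bound.
  refine (measure_mono (t := {x | t / 2 ≤ ‖w n x‖} ∪ {x | t / 2 ≤ ‖w n x - w' x‖}) ?_).trans
    ((measure_union_le _ _).trans (add_le_add_left ?_ _))
  · intro x hx
    by_contra hcon
    simp only [mem_union, mem_ofPred_eq, not_or, not_le] at hcon hx
    have := norm_sub_norm_le (w' x) (w n x)
    rw [norm_sub_rev] at this
    linarith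
  · have := hn (t / 2) (by positivity)
    rwa [show K / (t / 2) = 2 * K / t by field_simp] at this

theorem exists_tendsto_eLpNorm_of_le {p : ℝ≥0∞} [Fact (1 ≤ p)] [CompleteSpace E] {f : ℕ → X → E}
    (hf : ∀ n, MemLp (f n) p μ) {a : ℕ → ℝ≥0∞} (ha : Tendsto a atTop (𝓝 0))
    (hle : ∀ n k, eLpNorm (fun x => f n x - f k x) p μ ≤ a n + a k) :
    ∃ u, MemLp u p μ ∧ Tendsto (fun n => eLpNorm (fun x => f n x - u x) p μ) atTop (𝓝 0) := by
  have hc : CauchySeq fun n => (hf n).toLp (f n) := by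
    rw [EMetric.cauchySeq_iff]
    intro ε hε
    have hε2 : 0 < ε / 2 := ENNReal.half_pos hε.ne'
    obtain ⟨n₀, hn₀⟩ := eventually_atTop.1 (ha.eventually_lt_const hε2)
    refine ⟨n₀, fun n hn k hk => ?_⟩
    rw [Lp.edist_toLp_toLp]
    refine (hle n k).trans_lt ?_
    rw [← ENNReal.add_halves ε]
    exact ENNReal.add_lt_add (hn₀ n hn) (hn₀ k hk)
  obtain ⟨u, hu⟩ := cauchySeq_tendsto_of_complete hc
  refine ⟨u, Lp.memLp u, ?_⟩
  have := (Lp.tendsto_Lp_iff_tendsto_eLpNorm' _ _).1 hu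
  refine this.congr fun n => eLpNorm_congr_ae ?_
  filter_upwards [(hf n).coeFn_toLp] with x hx
  rw [Pi.sub_apply, hx]

theorem AEEq_of_tendsto_eLpNorm {p : ℝ≥0∞} (hp : 1 ≤ p) {f : ℕ → X → E} {u u' : X → E}
    (hf : ∀ n, AEStronglyMeasurable (f n) μ) (hu : AEStronglyMeasurable u μ)
    (hu' : AEStronglyMeasurable u' μ)
    (h : Tendsto (fun n => eLpNorm (fun x => f n x - u x) p μ) atTop (𝓝 0))
    (h' : Tendsto (fun n => eLpNorm (fun x => f n x - u' x) p μ) atTop (𝓝 0)) : u =ᵐ[μ] u' := by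
  have h1 : Tendsto (fun n => eLpNorm (fun x => u x - f n x) p μ) atTop (𝓝 0) :=
    h.congr fun n => by
      have : (fun x => u x - f n x) = -fun x => f n x - u x := by ext x; simp
      rw [this, eLpNorm_neg]
  have h2 := tendsto_eLpNorm_sub_trans (f := fun _ => u) hp (fun _ => hu) hf hu' h1 h'
  have h3 := tendsto_nhds_unique h2 tendsto_const_nhds
  have h4 := (eLpNorm_eq_zero_iff (hu.sub hu') (zero_lt_one.trans_le hp).ne').1 h3.symm
  filter_upwards [h4] with x hx
  simpa [sub_eq_zero] using hx

end

/-! ### A smooth bounded truncation -/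

/-- `k arctan (s / k)`, a smooth substitute for the truncation at height `k`. -/
def arctanTrunc (k s : ℝ) : ℝ := k * Real.arctan (s / k)

theorem contDiff_arctanTrunc (k : ℝ) : ContDiff ℝ ∞ (arctanTrunc k) :=
  contDiff_const.mul (Real.contDiff_arctan.comp (contDiff_id.div_const k))

theorem arctanTrunc_zero (k : ℝ) : arctanTrunc k 0 = 0 := by simp [arctanTrunc]

theorem deriv_arctanTrunc {k : ℝ} (hk : k ≠ 0) (s : ℝ) :
    deriv (arctanTrunc k) s = 1 / (1 + (s / k) ^ 2) := by
  have := (((hasDerivAt_id s).div_const k).arctan.const_mul k).deriv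
  refine this.trans ?_
  simp only [id]
  field_simp

theorem deriv_arctanTrunc_pos {k : ℝ} (hk : k ≠ 0) (s : ℝ) : 0 < deriv (arctanTrunc k) s := by
  rw [deriv_arctanTrunc hk]; positivity

theorem deriv_arctanTrunc_le_one {k : ℝ} (hk : k ≠ 0) (s : ℝ) : deriv (arctanTrunc k) s ≤ 1 := by
  rw [deriv_arctanTrunc hk, div_le_one (by positivity)]
  linarith [sq_nonneg (s / k)]

/-- Together with `half_le_abs_arctanTrunc` this gives what the exact truncation would give, up to
constants: slope of order one below the level `k` and values of order `k` above it. -/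
theorem half_le_deriv_arctanTrunc {k s : ℝ} (hk : 0 < k) (hs : |s| ≤ k) :
    1 / 2 ≤ deriv (arctanTrunc k) s := by
  rw [deriv_arctanTrunc hk.ne', div_le_div_iff₀ two_pos (by positivity)]
  have : (s / k) ^ 2 ≤ 1 := by
    rw [sq_le_one_iff_abs_le_one, abs_div, abs_of_pos hk, div_le_one hk]
    exact hs
  linarith

theorem abs_arctanTrunc_le {k : ℝ} (hk : 0 < k) (s : ℝ) : |arctanTrunc k s| ≤ 2 * k := by
  rw [arctanTrunc, abs_mul, abs_of_pos hk, mul_comm]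
  refine mul_le_mul_of_nonneg_right ?_ hk.le
  rw [abs_le]
  have h1 := Real.arctan_lt_pi_div_two (s / k)
  have h2 := Real.neg_pi_div_two_lt_arctan (s / k)
  have h3 := Real.pi_le_four
  constructor <;> linarith

theorem half_le_abs_arctanTrunc {k s : ℝ} (hk : 0 < k) (hs : k ≤ |s|) :
    k / 2 ≤ |arctanTrunc k s| := by
  have h0 : 1 / 2 ≤ Real.arctan (|s| / k) := by
    have h1 : Real.arctan 1 ≤ Real.arctan (|s| / k) :=
      Real.arctan_strictMono.monotone (by rwa [le_div_iff₀ hk, one_mul])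
    rw [Real.arctan_one] at h1
    linarith [Real.pi_gt_three]
  have h2 : |Real.arctan (s / k)| = |Real.arctan (|s| / k)| := by
    rcases abs_cases s with ⟨h, -⟩ | ⟨h, -⟩ <;> rw [h]
    rw [neg_div, Real.arctan_neg, abs_neg]
  rw [arctanTrunc, abs_mul, abs_of_pos hk, h2, abs_of_nonneg (by linarith)]
  nlinarith

section
variable {m N : ℕ} {c : VFields m N} {Ω : Set (EuclideanSpace ℝ (Fin N))} {Q : ℝ}
variable {A : EuclideanSpace ℝ (Fin N) → Matrix (Fin m) (Fin m) ℝ} {α β C : ℝ}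

/-! ### A priori estimates for weak solutions -/

/-- The energy estimate for truncated weak solutions. -/
theorem IsWeakSol.integral_deriv_arctanTrunc_mul_le (hc : ∀ j, Continuous (c j))
    (hΩb : Bornology.IsBounded Ω) (hα : 0 < α) (hA : IsElliptic Ω α β A)
    {g v : EuclideanSpace ℝ (Fin N) → ℝ}
    {V : EuclideanSpace ℝ (Fin N) → EuclideanSpace ℝ (Fin m)} (h : IsWeakSol c Ω A g v V)
    (hg : Integrable g (volume.restrict Ω)) {γ : ℝ} (hγ : ∫ x in Ω, |g x| ≤ γ) {k : ℝ}
    (hk : 0 < k) :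
    Integrable (fun x => deriv (arctanTrunc k) (v x) * ‖V x‖ ^ 2) (volume.restrict Ω) ∧
    ∫ x in Ω, deriv (arctanTrunc k) (v x) * ‖V x‖ ^ 2 ≤ 2 * k * γ / α := by
  have hS' : Continuous (deriv (arctanTrunc k)) :=
    (contDiff_arctanTrunc k).continuous_deriv (by exact_mod_cast le_top)
  have hbd : ∀ s, |deriv (arctanTrunc k) s| ≤ 1 := fun s => by
    rw [abs_of_pos (deriv_arctanTrunc_pos hk.ne' s)]
    exact deriv_arctanTrunc_le_one hk.ne' s
  have hint : Integrable (fun x => deriv (arctanTrunc k) (v x) * ‖V x‖ ^ 2)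
      (volume.restrict Ω) := by
    refine Integrable.mono' h.1.2.1.norm.integrable_sq
      ((hS'.comp_aestronglyMeasurable h.1.1.1).mul (h.1.2.1.1.norm.pow 2)) (ae_of_all _ fun x => ?_)
    rw [norm_mul, Real.norm_eq_abs, Real.norm_of_nonneg (sq_nonneg ‖V x‖)]
    exact mul_le_of_le_one_left (sq_nonneg _) (hbd _)
  refine ⟨hint, ?_⟩
  -- The equation is tested with the truncation of the solution itself, which is bounded by `2 k`,
  -- so that the datum enters only through its `L¹` norm.
  obtain ⟨h1, h2, h3⟩ := h.2 _ _ (h.1.comp hc hΩb (contDiff_arctanTrunc k) (arctanTrunc_zero k) hbd)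
  rw [le_div_iff₀ hα, mul_comm, ← integral_const_mul]
  calc ∫ x in Ω, α * (deriv (arctanTrunc k) (v x) * ‖V x‖ ^ 2)
      ≤ ∫ x in Ω, aForm A x (V x) (deriv (arctanTrunc k) (v x) • V x) := by
        refine integral_mono_ae (hint.const_mul α) h1 ?_
        filter_upwards [hA.elliptic] with x hx
        rw [aForm_smul_right, mul_left_comm]
        exact mul_le_mul_of_nonneg_left (hx _).1 (deriv_arctanTrunc_pos hk.ne' _).le
    _ = ∫ x in Ω, g x * arctanTrunc k (v x) := h3
    _ ≤ ∫ x in Ω, |g x| * (2 * k) := by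
        refine integral_mono_ae h2 (hg.abs.mul_const _) (ae_of_all _ fun x => ?_)
        refine (le_abs_self _).trans ?_
        rw [abs_mul]
        exact mul_le_mul_of_nonneg_left (abs_arctanTrunc_le hk _) (abs_nonneg _)
    _ ≤ 2 * k * γ := by
        rw [integral_mul_const, mul_comm]
        exact mul_le_mul_of_nonneg_left hγ (by positivity)

end

section
variable {m N : ℕ} {c : VFields m N} {Ω : Set (EuclideanSpace ℝ (Fin N))} {Q : ℝ}
variable {A : EuclideanSpace ℝ (Fin N) → Matrix (Fin m) (Fin m) ℝ} {α β C : ℝ}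

/-- The truncated solution has squared energy at most `E = 2 k γ / α`, because its slope is at most
`1` and so dominates its square. The Sobolev inequality and Chebyshev at level `k / 2` give the base
`4 C² E / k² = 8 C² γ / (α k)`. -/
theorem IsWeakSol.meas_ge_le (hQ : 2 < Q) (hc : ∀ j, Continuous (c j))
    (hΩb : Bornology.IsBounded Ω) (hα : 0 < α) (hA : IsElliptic Ω α β A) (hC0 : 0 < C)
    (hC : ∀ φ, IsTest ⊤ Ω φ → eLpNorm φ (ENNReal.ofReal (2 * Q / (Q - 2))) (volume.restrict Ω)
      ≤ ENNReal.ofReal C * eLpNorm (xGrad c φ) 2 (volume.restrict Ω))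
    {g v : EuclideanSpace ℝ (Fin N) → ℝ}
    {V : EuclideanSpace ℝ (Fin N) → EuclideanSpace ℝ (Fin m)} (h : IsWeakSol c Ω A g v V)
    (hg : Integrable g (volume.restrict Ω)) {γ : ℝ} (hγ0 : 0 < γ) (hγ : ∫ x in Ω, |g x| ≤ γ)
    {k : ℝ} (hk : 0 < k) :
    volume.restrict Ω {x | k ≤ |v x|}
      ≤ ENNReal.ofReal ((8 * C ^ 2 / α * γ / k) ^ (Q / (Q - 2))) := by
  obtain ⟨hint, hE⟩ := h.integral_deriv_arctanTrunc_mul_le hc hΩb hα hA hg hγ hk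
  have hbd : ∀ s, |deriv (arctanTrunc k) s| ≤ 1 := fun s => by
    rw [abs_of_pos (deriv_arctanTrunc_pos hk.ne' s)]
    exact deriv_arctanTrunc_le_one hk.ne' s
  have hW := h.1.comp hc hΩb (contDiff_arctanTrunc k) (arctanTrunc_zero k) hbd
  set E := 2 * k * γ / α with hEdef
  have hE0 : 0 < E := by positivity
  have h1 : (eLpNorm (fun x => deriv (arctanTrunc k) (v x) • V x) 2
      (volume.restrict Ω)).toReal ^ 2 ≤ E := by
    rw [hW.2.1.sq_toReal_eLpNorm_two]
    refine (integral_mono_ae hW.2.1.norm.integrable_sq hint (ae_of_all _ fun x => ?_)).trans hE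
    simp only [norm_smul, mul_pow, Real.norm_eq_abs]
    refine mul_le_mul_of_nonneg_right ?_ (sq_nonneg _)
    rw [sq_abs]
    nlinarith [deriv_arctanTrunc_pos hk.ne' (v x), deriv_arctanTrunc_le_one hk.ne' (v x)]
  have h2 : eLpNorm (fun x => arctanTrunc k (v x)) (ENNReal.ofReal (2 * Q / (Q - 2)))
      (volume.restrict Ω) ≤ ENNReal.ofReal (C * √E) := by
    refine (hW.eLpNorm_le hΩb hc hC).trans ?_
    rw [ENNReal.ofReal_mul hC0.le]
    refine mul_le_mul_right ?_ _
    rw [ENNReal.le_ofReal_iff_toReal_le hW.2.1.2.ne (Real.sqrt_nonneg _)]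
    exact Real.le_sqrt_of_sq_le h1
  have hp : 0 < 2 * Q / (Q - 2) := div_pos (by linarith) (by linarith)
  have hptr : (ENNReal.ofReal (2 * Q / (Q - 2))).toReal = 2 * Q / (Q - 2) :=
    ENNReal.toReal_ofReal hp.le
  have h3 := mul_meas_ge_le_pow_eLpNorm' (volume.restrict Ω)
    (p := ENNReal.ofReal (2 * Q / (Q - 2))) (by simpa using hp) ENNReal.ofReal_ne_top hW.1.1
    (ENNReal.ofReal (k / 2))
  rw [hptr] at h3
  have h4 : {x | k ≤ |v x|} ⊆ {x | ENNReal.ofReal (k / 2) ≤ ‖arctanTrunc k (v x)‖ₑ} := by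
    intro x hx
    rw [mem_ofPred_eq, ← ofReal_norm]
    exact ENNReal.ofReal_le_ofReal (half_le_abs_arctanTrunc hk hx)
  refine (measure_mono h4).trans ?_
  have h5 := h3.trans (ENNReal.rpow_le_rpow h2 hp.le)
  have hk2 : (0 : ℝ) < k / 2 := by positivity
  rw [ENNReal.ofReal_rpow_of_pos hk2, ENNReal.ofReal_rpow_of_nonneg (by positivity) hp.le,
    mul_comm, ← ENNReal.le_div_iff_mul_le (by left; simp; positivity)
      (Or.inl ENNReal.ofReal_ne_top), ← ENNReal.ofReal_div_of_pos (by positivity),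
    ← Real.div_rpow (by positivity) hk2.le] at h5
  refine h5.trans (ENNReal.ofReal_le_ofReal (le_of_eq ?_))
  rw [show 2 * Q / (Q - 2) = ((2 : ℕ) : ℝ) * (Q / (Q - 2)) by push_cast; ring,
    Real.rpow_natCast_mul (by positivity)]
  congr 1
  rw [div_pow, mul_pow, Real.sq_sqrt hE0.le, hEdef]
  field_simp
  norm_num

/-- A large `X`-gradient occurs either where `|v| ≥ k`, a small set by the bound for `v`, or below
that level, where the energy estimate and Chebyshev apply. The level `k` is then optimised. That the
constants are linear in `γ` makes differences of solutions small when the data are close in `L¹`. -/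
theorem exists_weak_type_bounds (hQ : 2 < Q) (hc : ∀ j, Continuous (c j))
    (hΩb : Bornology.IsBounded Ω) (hα : 0 < α) (hA : IsElliptic Ω α β A) (hC0 : 0 < C)
    (hC : ∀ φ, IsTest ⊤ Ω φ → eLpNorm φ (ENNReal.ofReal (2 * Q / (Q - 2))) (volume.restrict Ω)
      ≤ ENNReal.ofReal C * eLpNorm (xGrad c φ) 2 (volume.restrict Ω)) :
    ∃ D > 0, ∀ (g v : EuclideanSpace ℝ (Fin N) → ℝ)
      (V : EuclideanSpace ℝ (Fin N) → EuclideanSpace ℝ (Fin m)) (γ : ℝ),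
      IsWeakSol c Ω A g v V → Integrable g (volume.restrict Ω) → 0 < γ → ∫ x in Ω, |g x| ≤ γ →
      ∀ t, 0 < t →
        volume.restrict Ω {x | t ≤ ‖v x‖} ≤ ENNReal.ofReal ((D * γ / t) ^ (Q / (Q - 2))) ∧
        volume.restrict Ω {x | t ≤ ‖V x‖} ≤ ENNReal.ofReal ((D * γ / t) ^ (Q / (Q - 1))) := by
  have : IsFiniteMeasure (volume.restrict Ω) := ⟨by simpa using hΩb.measure_lt_top⟩
  have hQ2 : 0 < Q - 2 := by linarith
  have hQ1 : 0 < Q - 1 := by linarith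
  have hQ0 : 0 < Q := by linarith
  set D := (8 * C ^ 2 + 4) / α with hD
  have hD0 : 0 < D := by positivity
  refine ⟨2 * D, by positivity, fun g v V γ h hg hγ0 hγ => ?_⟩
  have hv : ∀ k, 0 < k → volume.restrict Ω {x | k ≤ |v x|}
      ≤ ENNReal.ofReal ((D * γ / k) ^ (Q / (Q - 2))) := fun k hk => by
    refine (h.meas_ge_le hQ hc hΩb hα hA hC0 hC hg hγ0 hγ hk).trans
      (ENNReal.ofReal_le_ofReal ?_)
    rw [hD]
    gcongr
    linarith
  intro t ht
  refine ⟨(hv t ht).trans (ENNReal.ofReal_le_ofReal ?_), ?_⟩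
  · gcongr
    linarith
  set y := D * γ / t with hy
  have hy0 : 0 < y := by positivity
  -- With this level both parts have measure at most `y ^ (Q / (Q - 1))`.
  set k := y ^ (1 / (Q - 1)) * t with hk
  have hk0 : 0 < k := by positivity
  obtain ⟨hint, hE⟩ := h.integral_deriv_arctanTrunc_mul_le hc hΩb hα hA hg hγ hk0
  have hsub : {x | t ≤ ‖V x‖} ⊆
      {x | t ^ 2 / 2 ≤ deriv (arctanTrunc k) (v x) * ‖V x‖ ^ 2} ∪ {x | k ≤ |v x|} := by
    intro x hx
    rcases le_or_gt k |v x| with hxk | hxk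
    · exact Or.inr hxk
    · left
      have h1 := half_le_deriv_arctanTrunc hk0 hxk.le
      have h2 : t ^ 2 ≤ ‖V x‖ ^ 2 := pow_le_pow_left₀ ht.le hx 2
      rw [mem_ofPred_eq]
      nlinarith
  have h1 : volume.restrict Ω {x | t ^ 2 / 2 ≤ deriv (arctanTrunc k) (v x) * ‖V x‖ ^ 2}
      ≤ ENNReal.ofReal (y ^ (Q / (Q - 1))) := by
    have h2 := (mul_meas_ge_le_integral_of_nonneg (ae_of_all _ fun x =>
      mul_nonneg (deriv_arctanTrunc_pos hk0.ne' (v x)).le (sq_nonneg ‖V x‖)) hint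
      (t ^ 2 / 2)).trans hE
    rw [← ofReal_measureReal]
    refine ENNReal.ofReal_le_ofReal ?_
    rw [← le_div_iff₀' (by positivity)] at h2
    refine h2.trans ?_
    have h3 : y ^ (Q / (Q - 1)) = y ^ (1 / (Q - 1)) * y := by
      rw [show Q / (Q - 1) = 1 / (Q - 1) + 1 by field_simp; ring, Real.rpow_add hy0, Real.rpow_one]
    rw [h3, hk]
    have h4 : 2 * (y ^ (1 / (Q - 1)) * t) * γ / α / (t ^ 2 / 2)
        = y ^ (1 / (Q - 1)) * (4 / α * γ / t) := by
      field_simp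
      norm_num
    rw [h4, hy, hD]
    gcongr
    linarith [sq_nonneg C]
  have h2 : volume.restrict Ω {x | k ≤ |v x|} ≤ ENNReal.ofReal (y ^ (Q / (Q - 1))) := by
    refine (hv k hk0).trans (ENNReal.ofReal_le_ofReal (le_of_eq ?_))
    have h3 : D * γ / k = y ^ ((Q - 2) / (Q - 1)) := by
      have : D * γ = y * t := by rw [hy]; field_simp
      rw [this, hk, mul_div_mul_right _ _ ht.ne',
        show (Q - 2) / (Q - 1) = 1 - 1 / (Q - 1) by field_simp; ring, Real.rpow_sub hy0,
        Real.rpow_one]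
    rw [h3, ← Real.rpow_mul hy0.le]
    congr 1
    field_simp
  refine (measure_mono hsub).trans ((measure_union_le _ _).trans ((add_le_add h1 h2).trans ?_))
  rw [← ENNReal.ofReal_add (by positivity) (by positivity)]
  refine ENNReal.ofReal_le_ofReal ?_
  -- The two equal contributions are absorbed by doubling the base, since the exponent `Q / (Q - 1)`
  -- is at least `1`.
  rw [show 2 * D * γ / t = 2 * y by rw [hy]; ring, Real.mul_rpow two_pos.le hy0.le, ← two_mul]
  refine mul_le_mul_of_nonneg_right ?_ (by positivity)
  calc (2 : ℝ) = 2 ^ (1 : ℝ) := (Real.rpow_one 2).symm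
    _ ≤ _ := Real.rpow_le_rpow_of_exponent_le one_le_two
      (by rw [le_div_iff₀ hQ1]; linarith)

/-! ### Convergence of approximating solutions -/

theorem marNorm_le {p K : ℝ} (hp : 0 < p) (hK : 0 < K) {w : EuclideanSpace ℝ (Fin N) → ℝ}
    (h : ∀ t, 0 < t → volume.restrict Ω {x | t ≤ ‖w x‖} ≤ ENNReal.ofReal ((K / t) ^ p)) :
    marNorm Ω p w ≤ ENNReal.ofReal K := by
  refine iSup₂_le fun t ht => ?_
  have h1 := ENNReal.rpow_le_rpow (h t ht) (one_div_pos.2 hp).le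
  rw [ENNReal.ofReal_rpow_of_pos (by positivity), ← Real.rpow_mul (by positivity),
    mul_one_div_cancel hp.ne', Real.rpow_one] at h1
  refine (mul_le_mul_right h1 _).trans (le_of_eq ?_)
  rw [← ENNReal.ofReal_mul ht.le, mul_div_cancel₀ _ ht.ne']

/-- All three modes of convergence follow from weak-type bounds whose constants tend to zero: the
Marcinkiewicz norm is the weak-type constant itself, and the Lebesgue norms of smaller exponent are
bounded by it. -/
theorem approxConv_of_meas_ge_le (hΩb : Bornology.IsBounded Ω) (hQ : 2 < Q)
    {v : ℕ → EuclideanSpace ℝ (Fin N) → ℝ}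
    {V : ℕ → EuclideanSpace ℝ (Fin N) → EuclideanSpace ℝ (Fin m)}
    {u : EuclideanSpace ℝ (Fin N) → ℝ}
    {G : EuclideanSpace ℝ (Fin N) → EuclideanSpace ℝ (Fin m)}
    (hv : ∀ n, AEStronglyMeasurable (v n) (volume.restrict Ω))
    (hV : ∀ n, AEStronglyMeasurable (V n) (volume.restrict Ω))
    (hu : AEStronglyMeasurable u (volume.restrict Ω))
    (hG : AEStronglyMeasurable G (volume.restrict Ω))
    {K : ℕ → ℝ} (hK0 : ∀ n, 0 < K n) (hK : Tendsto K atTop (𝓝 0))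
    (h : ∀ n t, 0 < t → volume.restrict Ω {x | t ≤ ‖v n x - u x‖}
      ≤ ENNReal.ofReal ((K n / t) ^ (Q / (Q - 2))))
    (h' : ∀ n t, 0 < t → volume.restrict Ω {x | t ≤ ‖V n x - G x‖}
      ≤ ENNReal.ofReal ((K n / t) ^ (Q / (Q - 1)))) :
    ApproxConv Ω Q v V u G := by
  have : IsFiniteMeasure (volume.restrict Ω) := ⟨by simpa using hΩb.measure_lt_top⟩
  have hK' : Tendsto (fun n => ENNReal.ofReal (K n)) atTop (𝓝 0) := by
    simpa using ENNReal.tendsto_ofReal hK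
  refine ⟨?_, fun s hs1 hs2 => ?_, fun q hq1 hq2 => ?_⟩
  · exact tendsto_of_tendsto_of_tendsto_of_le_of_le tendsto_const_nhds hK' (fun _ => zero_le)
      fun n => marNorm_le (div_pos (by linarith) (by linarith)) (hK0 n) (h n)
  · obtain ⟨B, hB, hBle⟩ := exists_eLpNorm_le_of_meas_ge_le (E := ℝ) (μ := volume.restrict Ω)
      (zero_lt_one.trans_le hs1) hs2
    exact tendsto_of_tendsto_of_tendsto_of_le_of_le tendsto_const_nhds
      (by simpa using ENNReal.Tendsto.const_mul hK' (Or.inr hB)) (fun _ => zero_le)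
      fun n => hBle _ _ ((hv n).sub hu) (hK0 n) (h n)
  · obtain ⟨B, hB, hBle⟩ := exists_eLpNorm_le_of_meas_ge_le (E := EuclideanSpace ℝ (Fin m))
      (μ := volume.restrict Ω) (zero_lt_one.trans_le hq1) hq2
    exact tendsto_of_tendsto_of_tendsto_of_le_of_le tendsto_const_nhds
      (by simpa using ENNReal.Tendsto.const_mul hK' (Or.inr hB)) (fun _ => zero_le)
      fun n => hBle _ _ ((hV n).sub hG) (hK0 n) (h' n)

/-! ### Approximating sequences of data -/

theorem IsApproxSeq.integrable (hΩb : Bornology.IsBounded Ω) (hQ : 2 < Q)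
    {f : EuclideanSpace ℝ (Fin N) → ℝ} {g : ℕ → EuclideanSpace ℝ (Fin N) → ℝ}
    (h : IsApproxSeq Ω Q f g) (n : ℕ) : Integrable (g n) (volume.restrict Ω) := by
  have : IsFiniteMeasure (volume.restrict Ω) := ⟨by simpa using hΩb.measure_lt_top⟩
  refine (h.1 n).integrable ?_
  rw [ENNReal.one_le_ofReal, le_div_iff₀ (by linarith)]
  linarith

/-- The `L¹` errors of an approximating sequence, made positive. -/
theorem IsApproxSeq.exists_error (hΩb : Bornology.IsBounded Ω) (hQ : 2 < Q)
    {f : EuclideanSpace ℝ (Fin N) → ℝ} (hf : Integrable f (volume.restrict Ω))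
    {g : ℕ → EuclideanSpace ℝ (Fin N) → ℝ} (h : IsApproxSeq Ω Q f g) :
    ∃ δ : ℕ → ℝ, (∀ n, 0 < δ n) ∧ Tendsto δ atTop (𝓝 0) ∧ ∀ n, ∫ x in Ω, |g n x - f x| ≤ δ n := by
  have hint : ∀ n, ∫ x in Ω, |g n x - f x|
      = (eLpNorm (fun x => g n x - f x) 1 (volume.restrict Ω)).toReal := fun n => by
    rw [eLpNorm_one_eq_lintegral_enorm]
    exact integral_norm_eq_lintegral_enorm ((h.integrable hΩb hQ n).sub hf).1
  have hpos : ∀ n : ℕ, 0 < 1 / ((n : ℝ) + 1) := fun n => Nat.one_div_pos_of_nat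
  -- A null sequence of positive numbers is added because the weak-type estimates are stated for a
  -- positive bound on the datum.
  refine ⟨fun n => (∫ x in Ω, |g n x - f x|) + 1 / ((n : ℝ) + 1), fun n => ?_, ?_, fun n => ?_⟩
  · exact add_pos_of_nonneg_of_pos (integral_nonneg fun _ => abs_nonneg _) (hpos n)
  · have h1 := (ENNReal.tendsto_toReal ENNReal.zero_ne_top).comp h.2
    simp only [hint]
    simpa using h1.add tendsto_one_div_add_atTop_nhds_zero_nat
  · exact le_add_of_nonneg_right (hpos n).le

theorem integral_abs_sub_le {f g g' : EuclideanSpace ℝ (Fin N) → ℝ}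
    (hf : Integrable f (volume.restrict Ω)) (hg : Integrable g (volume.restrict Ω))
    (hg' : Integrable g' (volume.restrict Ω)) {a b : ℝ} (h : ∫ x in Ω, |g x - f x| ≤ a)
    (h' : ∫ x in Ω, |g' x - f x| ≤ b) : ∫ x in Ω, |g x - g' x| ≤ a + b := by
  have h1 : Integrable (fun x => |g x - f x|) (volume.restrict Ω) := (hg.sub hf).abs
  have h2 : Integrable (fun x => |g' x - f x|) (volume.restrict Ω) := (hg'.sub hf).abs
  refine le_trans ?_ (add_le_add h h')
  rw [← integral_add h1 h2]
  refine integral_mono (hg.sub hg').abs (h1.add h2) fun x => ?_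
  have := abs_sub_le (g x) (f x) (g' x)
  rwa [abs_sub_comm (f x)] at this

theorem abs_trunc_le {k : ℝ} (hk : 0 ≤ k) (s : ℝ) : |trunc k s| ≤ k := by
  rw [abs_le, trunc]
  exact ⟨le_max_left _ _, max_le (by linarith) (min_le_right _ _)⟩

theorem trunc_of_abs_le {k s : ℝ} (h : |s| ≤ k) : trunc k s = s := by
  rw [abs_le] at h
  rw [trunc, min_eq_left h.2, max_eq_right h.1]

theorem abs_trunc_le_abs {k : ℝ} (hk : 0 ≤ k) (s : ℝ) : |trunc k s| ≤ |s| := by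
  rcases le_total |s| k with h | h
  · rw [trunc_of_abs_le h]
  · exact (abs_trunc_le hk s).trans h

theorem continuous_trunc (k : ℝ) : Continuous (trunc k) := by
  unfold trunc; fun_prop

theorem tendsto_trunc (s : ℝ) : Tendsto (fun n : ℕ => trunc n s) atTop (𝓝 s) := by
  refine tendsto_const_nhds.congr' ?_
  filter_upwards [eventually_ge_atTop ⌈|s|⌉₊] with n hn
  exact (trunc_of_abs_le (Nat.ceil_le.1 hn)).symm

theorem isApproxSeq_trunc (hΩb : Bornology.IsBounded Ω) {f : EuclideanSpace ℝ (Fin N) → ℝ}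
    (hf : Integrable f (volume.restrict Ω)) : IsApproxSeq Ω Q f (fun n x => trunc n (f x)) := by
  have : IsFiniteMeasure (volume.restrict Ω) := ⟨by simpa using hΩb.measure_lt_top⟩
  have hm : ∀ n : ℕ, AEStronglyMeasurable (fun x => trunc n (f x)) (volume.restrict Ω) :=
    fun n => (continuous_trunc n).comp_aestronglyMeasurable hf.1
  refine ⟨fun n => MemLp.of_bound (hm n) n (ae_of_all _ fun x => abs_trunc_le n.cast_nonneg _), ?_⟩
  refine tendsto_eLpNorm_zero_of_dominated (g := fun x => 2 * |f x|) one_ne_zero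
    ENNReal.one_ne_top (fun n => (hm n).sub hf.1)
    (memLp_one_iff_integrable.2 (hf.abs.const_mul 2)) (fun n => ae_of_all _ fun x => ?_)
    (ae_of_all _ fun x => ?_)
  · refine (norm_sub_le _ _).trans ?_
    simp only [Real.norm_eq_abs]
    linarith [abs_trunc_le_abs (n.cast_nonneg (α := ℝ)) (f x)]
  · simpa using (tendsto_trunc (f x)).sub_const (f x)

end

section
variable {m N : ℕ} {c : VFields m N} {Ω : Set (EuclideanSpace ℝ (Fin N))} {Q : ℝ}
variable {A : EuclideanSpace ℝ (Fin N) → Matrix (Fin m) (Fin m) ℝ} {α β C : ℝ}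

/-- The limit of the approximating solutions. -/
theorem exists_approxConv (hQ : 2 < Q) (hc : ∀ j, Continuous (c j))
    (hΩb : Bornology.IsBounded Ω) (hα : 0 < α) (hA : IsElliptic Ω α β A) (hC0 : 0 < C)
    (hC : ∀ φ, IsTest ⊤ Ω φ → eLpNorm φ (ENNReal.ofReal (2 * Q / (Q - 2))) (volume.restrict Ω)
      ≤ ENNReal.ofReal C * eLpNorm (xGrad c φ) 2 (volume.restrict Ω))
    {f : EuclideanSpace ℝ (Fin N) → ℝ} (hf : Integrable f (volume.restrict Ω)) :
    ∃ u G, MemLp u 1 (volume.restrict Ω) ∧ MemLp G 1 (volume.restrict Ω) ∧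
      ∀ g v V, IsApproxSeq Ω Q f g → (∀ n, IsWeakSol c Ω A (g n) (v n) (V n)) →
        ApproxConv Ω Q v V u G := by
  have : IsFiniteMeasure (volume.restrict Ω) := ⟨by simpa using hΩb.measure_lt_top⟩
  obtain ⟨D, hD, hDle⟩ := exists_weak_type_bounds hQ hc hΩb hα hA hC0 hC
  have hτ := isApproxSeq_trunc (Q := Q) hΩb hf
  set τ : ℕ → EuclideanSpace ℝ (Fin N) → ℝ := fun n x => trunc n (f x) with hτdef
  obtain ⟨ε, hε0, hε, hεle⟩ := hτ.exists_error hΩb hQ hf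
  choose v₀ V₀ hsol₀ using fun n => exists_isWeakSol hQ hc hΩb hα hA hC0 hC (hτ.1 n)
  -- The a priori estimate for the difference of two solutions with truncated data, which lie within
  -- `ε n + ε k` of each other in `L¹`.
  have hbd : ∀ n k t, 0 < t →
      volume.restrict Ω {x | t ≤ ‖v₀ n x - v₀ k x‖}
        ≤ ENNReal.ofReal ((D * (ε n + ε k) / t) ^ (Q / (Q - 2))) ∧
      volume.restrict Ω {x | t ≤ ‖V₀ n x - V₀ k x‖}
        ≤ ENNReal.ofReal ((D * (ε n + ε k) / t) ^ (Q / (Q - 1))) := fun n k =>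
    hDle _ _ _ _ ((hsol₀ n).sub hc hΩb (hsol₀ k))
      ((hτ.integrable hΩb hQ n).sub (hτ.integrable hΩb hQ k)) (add_pos (hε0 n) (hε0 k))
      (integral_abs_sub_le hf (hτ.integrable hΩb hQ n) (hτ.integrable hΩb hQ k) (hεle n) (hεle k))
  have hpos : ∀ n k, 0 < D * (ε n + ε k) := fun n k => mul_pos hD (add_pos (hε0 n) (hε0 k))
  have hsplit : ∀ (B : ℝ≥0∞) n k, B * ENNReal.ofReal (D * (ε n + ε k))
      = B * ENNReal.ofReal (D * ε n) + B * ENNReal.ofReal (D * ε k) := fun B n k => by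
    rw [mul_add, ENNReal.ofReal_add (mul_pos hD (hε0 n)).le (mul_pos hD (hε0 k)).le, mul_add]
  have hlim : ∀ {B : ℝ≥0∞}, B ≠ ⊤ →
      Tendsto (fun n => B * ENNReal.ofReal (D * ε n)) atTop (𝓝 0) := fun {B} hB => by
    have h1 : Tendsto (fun n => ENNReal.ofReal (D * ε n)) atTop (𝓝 0) := by
      simpa using ENNReal.tendsto_ofReal (hε.const_mul D)
    simpa using ENNReal.Tendsto.const_mul h1 (Or.inr hB)
  have hmv : ∀ {g v : EuclideanSpace ℝ (Fin N) → ℝ} {V}, IsWeakSol c Ω A g v V →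
      MemLp v 1 (volume.restrict Ω) ∧ MemLp V 1 (volume.restrict Ω) := fun h =>
    ⟨h.1.1.mono_exponent one_le_two, h.1.2.1.mono_exponent one_le_two⟩
  obtain ⟨B₁, hB₁, hB₁le⟩ := exists_eLpNorm_le_of_meas_ge_le (E := ℝ) (μ := volume.restrict Ω)
    zero_lt_one (show 1 < Q / (Q - 2) by rw [lt_div_iff₀ (by linarith)]; linarith)
  obtain ⟨B₂, hB₂, hB₂le⟩ := exists_eLpNorm_le_of_meas_ge_le (E := EuclideanSpace ℝ (Fin m))
    (μ := volume.restrict Ω)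
    zero_lt_one (show 1 < Q / (Q - 1) by rw [lt_div_iff₀ (by linarith)]; linarith)
  rw [ENNReal.ofReal_one] at hB₁le hB₂le
  -- Both weak-type exponents exceed `1`, so the solutions and their `X`-gradients are Cauchy in
  -- `L¹`; this fixes `u` and `G` once and for all.
  obtain ⟨u, hu, hvu⟩ := exists_tendsto_eLpNorm_of_le (p := 1) (fun n => (hmv (hsol₀ n)).1)
    (hlim hB₁) fun n k => (hB₁le _ _ ((hmv (hsol₀ n)).1.sub (hmv (hsol₀ k)).1).1 (hpos n k)
      fun t ht => (hbd n k t ht).1).trans_eq (hsplit B₁ n k)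
  obtain ⟨G, hG, hVG⟩ := exists_tendsto_eLpNorm_of_le (p := 1) (fun n => (hmv (hsol₀ n)).2)
    (hlim hB₂) fun n k => (hB₂le _ _ ((hmv (hsol₀ n)).2.sub (hmv (hsol₀ k)).2).1 (hpos n k)
      fun t ht => (hbd n k t ht).2).trans_eq (hsplit B₂ n k)
  refine ⟨u, G, hu, hG, fun g v V hg hsol => ?_⟩
  obtain ⟨δ, hδ0, hδ, hδle⟩ := hg.exists_error hΩb hQ hf
  -- A solution of any approximating sequence is compared with those for the truncated data. For
  -- fixed `n` and all large `k` the data differ by at most `δ n + ε k ≤ 2 δ n`, a bound that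
  -- survives `k → ∞`.
  have hbd' : ∀ n, ∀ᶠ k in atTop, ∀ t, 0 < t →
      volume.restrict Ω {x | t ≤ ‖v n x - v₀ k x‖}
        ≤ ENNReal.ofReal ((D * (2 * δ n) / t) ^ (Q / (Q - 2))) ∧
      volume.restrict Ω {x | t ≤ ‖V n x - V₀ k x‖}
        ≤ ENNReal.ofReal ((D * (2 * δ n) / t) ^ (Q / (Q - 1))) := fun n => by
    filter_upwards [hε.eventually_lt_const (hδ0 n)] with k hk
    refine hDle _ _ _ _ ((hsol n).sub hc hΩb (hsol₀ k))
      ((hg.integrable hΩb hQ n).sub (hτ.integrable hΩb hQ k)) (by linarith [hδ0 n]) ?_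
    refine (integral_abs_sub_le hf (hg.integrable hΩb hQ n) (hτ.integrable hΩb hQ k)
      (hδle n) (hεle k)).trans ?_
    linarith
  have hin : ∀ {F : Type} [NormedAddCommGroup F] (w : EuclideanSpace ℝ (Fin N) → F)
      {z : ℕ → EuclideanSpace ℝ (Fin N) → F} {y : EuclideanSpace ℝ (Fin N) → F},
      AEStronglyMeasurable w (volume.restrict Ω) →
      (∀ k, AEStronglyMeasurable (z k) (volume.restrict Ω)) →
      AEStronglyMeasurable y (volume.restrict Ω) →
      Tendsto (fun k => eLpNorm (fun x => z k x - y x) 1 (volume.restrict Ω)) atTop (𝓝 0) →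
      TendstoInMeasure (volume.restrict Ω) (fun k x => w x - z k x) atTop
        (fun x => w x - y x) := by
    intro F _ w z y hw hz hy h
    refine tendstoInMeasure_of_tendsto_eLpNorm one_ne_zero (fun k => hw.sub (hz k)) (hw.sub hy)
      (h.congr fun k => ?_)
    rw [← eLpNorm_neg]
    congr 1
    ext1 x
    simp
  -- The outer factor `2` is the loss in passing the weak-type bound to the limit in measure, the
  -- inner one comes from `δ n + ε k ≤ 2 δ n`.
  refine approxConv_of_meas_ge_le (K := fun n => 2 * (D * (2 * δ n))) hΩb hQ
    (fun n => (hmv (hsol n)).1.1) (fun n => (hmv (hsol n)).2.1) hu.1 hG.1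
    (fun n => by have := hδ0 n; positivity) ?_ (fun n t ht => ?_) (fun n t ht => ?_)
  · simpa using ((hδ.const_mul 2).const_mul D).const_mul 2
  · exact meas_ge_le_of_tendstoInMeasure (hin (v n) (hmv (hsol n)).1.1
      (fun k => (hmv (hsol₀ k)).1.1) hu.1 hvu)
      ((hbd' n).mono fun k hk t ht => (hk t ht).1) ht
  · exact meas_ge_le_of_tendstoInMeasure (hin (V n) (hmv (hsol n)).2.1
      (fun k => (hmv (hsol₀ k)).2.1) hG.1 hVG)
      ((hbd' n).mono fun k hk t ht => (hk t ht).2) ht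

theorem MeasureTheory.MemLp.of_tendsto_eLpNorm {X E : Type*} [MeasurableSpace X] {μ : Measure X}
    [NormedAddCommGroup E] {p : ℝ≥0∞} {f : ℕ → X → E} {u : X → E}
    (hf : ∀ n, MemLp (f n) p μ) (hu : AEStronglyMeasurable u μ)
    (h : Tendsto (fun n => eLpNorm (fun x => f n x - u x) p μ) atTop (𝓝 0)) : MemLp u p μ := by
  obtain ⟨n, hn⟩ := (h.eventually_lt_const zero_lt_one).exists
  have h1 : MemLp (fun x => f n x - u x) p μ := ⟨(hf n).1.sub hu, hn.trans ENNReal.one_lt_top⟩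
  simpa [Pi.sub_def] using (hf n).sub h1

/-- Since `q < Q/(Q-1) < 2` and also `q < Q/(Q-2)`, the approximants lie in `W^{1,q}_0` and converge
there together with their `X`-gradients; the space is closed. -/
theorem ApproxConv.memW0 (hQ : 2 < Q) (hc : ∀ j, Continuous (c j))
    (hΩb : Bornology.IsBounded Ω) {v : ℕ → EuclideanSpace ℝ (Fin N) → ℝ}
    {V : ℕ → EuclideanSpace ℝ (Fin N) → EuclideanSpace ℝ (Fin m)}
    {u : EuclideanSpace ℝ (Fin N) → ℝ}
    {G : EuclideanSpace ℝ (Fin N) → EuclideanSpace ℝ (Fin m)}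
    (h : ApproxConv Ω Q v V u G) (hv : ∀ n, MemW0 c Ω 2 (v n) (V n))
    (hu : AEStronglyMeasurable u (volume.restrict Ω))
    (hG : AEStronglyMeasurable G (volume.restrict Ω))
    {q : ℝ} (hq : 1 ≤ q) (hqQ : q < Q / (Q - 1)) : MemW0 c Ω (ENNReal.ofReal q) u G := by
  have hq1 : 1 ≤ ENNReal.ofReal q := ENNReal.one_le_ofReal.2 hq
  have hq2 : ENNReal.ofReal q ≤ 2 := by
    rw [← ENNReal.ofReal_ofNat]
    refine ENNReal.ofReal_le_ofReal (hqQ.le.trans ?_)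
    rw [div_le_iff₀ (by linarith)]
    linarith
  have hqs : q < Q / (Q - 2) := hqQ.trans_le
    (div_le_div_of_nonneg_left (by linarith) (by linarith) (by linarith))
  have hvq : ∀ n, MemW0 c Ω (ENNReal.ofReal q) (v n) (V n) := fun n =>
    (hv n).mono_exponent hc hΩb (zero_lt_one.trans_le hq1).ne' hq2
  have h1 := h.lebesgue q hq hqs
  have h2 := h.gradient q hq hqQ
  exact MemW0.of_tendsto hc hΩb hq1 hvq (MemLp.of_tendsto_eLpNorm (fun n => (hvq n).1) hu h1)
    (MemLp.of_tendsto_eLpNorm (fun n => (hvq n).2.1) hG h2) h1 h2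

/-- The test function and its `X`-gradient are bounded on `Ω`, so convergence in `L¹` of the
`X`-gradients and of the data carries the weak equation over to the limit. -/
theorem ApproxConv.isDistribSol (hΩ : IsOpen Ω) (hQ : 2 < Q) (hc : ∀ j, Continuous (c j))
    (hΩb : Bornology.IsBounded Ω) (hA : IsElliptic Ω α β A)
    {f : EuclideanSpace ℝ (Fin N) → ℝ} (hf : Integrable f (volume.restrict Ω))
    {g v : ℕ → EuclideanSpace ℝ (Fin N) → ℝ}
    {V : ℕ → EuclideanSpace ℝ (Fin N) → EuclideanSpace ℝ (Fin m)}
    {u : EuclideanSpace ℝ (Fin N) → ℝ}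
    {G : EuclideanSpace ℝ (Fin N) → EuclideanSpace ℝ (Fin m)}
    (h : ApproxConv Ω Q v V u G) (hg : IsApproxSeq Ω Q f g)
    (hv : ∀ n, IsWeakSol c Ω A (g n) (v n) (V n))
    (hu : MemW0 c Ω 1 u G) : IsDistribSol c Ω A f u G := by
  have : IsFiniteMeasure (volume.restrict Ω) := ⟨by simpa using hΩb.measure_lt_top⟩
  refine ⟨hu, fun φ hφ => ?_⟩
  have hφt := hφ.memLp hΩb ⊤
  have hXt := hφ.memLp_xGrad le_rfl hc hΩb ⊤
  have hbound : ∀ {F : Type} [NormedAddCommGroup F] {H : EuclideanSpace ℝ (Fin N) → F},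
      MemLp H ⊤ (volume.restrict Ω) → ∃ B, ∀ᵐ x ∂(volume.restrict Ω), ‖H x‖ ≤ B := by
    intro F _ H hH
    refine ⟨(eLpNorm H ⊤ (volume.restrict Ω)).toReal, ?_⟩
    rw [eLpNorm_exponent_top]
    filter_upwards [ae_le_eLpNormEssSup (f := H) (μ := volume.restrict Ω)] with x hx
    rw [← toReal_enorm]
    exact ENNReal.toReal_mono (by simpa using hH.2.ne) hx
  obtain ⟨B₁, hB₁⟩ := hbound hφt
  obtain ⟨B₂, hB₂⟩ := hbound hXt
  have hfφ : ∀ {w : EuclideanSpace ℝ (Fin N) → ℝ}, Integrable w (volume.restrict Ω) →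
      Integrable (fun x => w x * φ x) (volume.restrict Ω) := fun hw =>
    (memLp_one_iff_integrable.2 hw).integrable_mul hφt
  refine ⟨hA.integrable hu.2.1 hXt, hfφ hf, ?_⟩
  have hV1 : Tendsto (fun n => eLpNorm (fun x => V n x - G x) 1 (volume.restrict Ω)) atTop
      (𝓝 0) := by
    simpa using h.gradient 1 le_rfl (by rw [lt_div_iff₀ (by linarith)]; linarith)
  have h1 := hA.tendsto_integral (fun n => (hv n).1.2.1.mono_exponent one_le_two) hu.2.1
    hXt.1 hB₂ hV1
  have h2 : Tendsto (fun n => ∫ x in Ω, g n x * φ x) atTop (𝓝 (∫ x in Ω, f x * φ x)) := by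
    refine tendsto_integral_of_L1' _ (hfφ hf).aestronglyMeasurable
      (Eventually.of_forall fun n => hfφ (hg.integrable hΩb hQ n)) ?_
    refine tendsto_of_tendsto_of_tendsto_of_le_of_le tendsto_const_nhds
      (by simpa using ENNReal.Tendsto.const_mul hg.2 (Or.inr (ENNReal.ofReal_ne_top (r := B₁))))
      (fun _ => zero_le) fun n => ?_
    refine eLpNorm_le_mul_eLpNorm_of_ae_le_mul ?_ 1
    filter_upwards [hB₁] with x hx
    rw [Pi.sub_apply, ← sub_mul, norm_mul, mul_comm]
    exact mul_le_mul_of_nonneg_right hx (norm_nonneg _)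
  refine tendsto_nhds_unique h1 (h2.congr fun n => ?_)
  exact ((hv n).2 _ _ (hφ.memW0_of_one hΩ hc hΩb two_ne_zero ENNReal.ofNat_ne_top)).2.2.symm

end

end

/-! ### The main theorem -/

theorem theorem3p2 {N m : ℕ} (hN : 2 ≤ N)
    (Ω : Set (EuclideanSpace ℝ (Fin N))) (hΩ : IsOpen Ω) (hΩb : Bornology.IsBounded Ω)
    (c : VFields m N) (hc : ∀ j, LocallyLipschitz (c j))
    (hconn : XConnected c Ω) (hcont : CCContinuous c Ω)
    (Q : ℝ) (hQ : 2 < Q) (hdoubling : CCDoubling c Ω Q) (hpoincare : CCPoincare c Ω)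
    (A : EuclideanSpace ℝ (Fin N) → Matrix (Fin m) (Fin m) ℝ)
    (α β : ℝ) (hα : 0 < α) (hαβ : α < β) (hA : IsElliptic Ω α β A)
    (f : EuclideanSpace ℝ (Fin N) → ℝ) (hf : IntegrableOn f Ω) :
    -- the approximating problems have a unique weak solution
    (∀ g, MemLp g (ENNReal.ofReal (2 * Q / (Q + 2))) (volume.restrict Ω) →
      ∃ v V, IsWeakSol c Ω A g v V ∧ ∀ v' V', IsWeakSol c Ω A g v' V' →
        v' =ᵐ[volume.restrict Ω] v ∧ V' =ᵐ[volume.restrict Ω] V) ∧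
    IsApproxSeq Ω Q f (fun n x => trunc n (f x)) ∧
    ∃ u G,
      IsDistribSol c Ω A f u G ∧
      (∀ q : ℝ, 1 ≤ q → q < Q / (Q - 1) → MemW0 c Ω (ENNReal.ofReal q) u G) ∧
      -- the solutions with the truncated data converge to `u`
      (∃ v V, (∀ n : ℕ, IsWeakSol c Ω A (fun x => trunc n (f x)) (v n) (V n)) ∧
        ApproxConv Ω Q v V u G) ∧
      -- so do the solutions for every other approximating sequence
      (∀ g v V, IsApproxSeq Ω Q f g → (∀ n, IsWeakSol c Ω A (g n) (v n) (V n)) →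
        ApproxConv Ω Q v V u G) ∧
      -- `u` is the only solution found by approximation
      IsSolByApprox c Ω Q A f u ∧
      ∀ w, IsSolByApprox c Ω Q A f w → w =ᵐ[volume.restrict Ω] u := by
  have hcc : ∀ j, Continuous (c j) := fun j => (hc j).continuous
  obtain ⟨C, hC0, hC⟩ := exists_sobolev hN hΩ hΩb hc hconn hcont hQ hdoubling hpoincare
  have hτ := isApproxSeq_trunc (Q := Q) hΩb hf
  obtain ⟨u, G, hu, hG, hconv⟩ := exists_approxConv hQ hcc hΩb hα hA hC0 hC hf
  choose v V hv using fun n => exists_isWeakSol hQ hcc hΩb hα hA hC0 hC (hτ.1 n)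
  have hvc := hconv _ v V hτ hv
  have hmem : ∀ q : ℝ, 1 ≤ q → q < Q / (Q - 1) → MemW0 c Ω (ENNReal.ofReal q) u G :=
    fun q => hvc.memW0 hQ hcc hΩb (fun n => (hv n).1) hu.1 hG.1
  have hQ1 : 1 < Q / (Q - 1) := by rw [lt_div_iff₀ (by linarith)]; linarith
  have hQ2 : 1 < Q / (Q - 2) := by rw [lt_div_iff₀ (by linarith)]; linarith
  refine ⟨fun g hg => ?_, hτ, u, G, ?_, hmem, ⟨v, V, hv, hvc⟩, hconv,
    ⟨_, v, V, hτ, hv, hu, by simpa using hvc.lebesgue 1 le_rfl hQ2⟩, ?_⟩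
  · obtain ⟨w, W, hw⟩ := exists_isWeakSol hQ hcc hΩb hα hA hC0 hC hg
    exact ⟨w, W, hw, fun w' W' hw' => hw'.unique hQ hcc hΩb hα hA hC hw⟩
  · exact hvc.isDistribSol hΩ hQ hcc hΩb hA hf hτ hv (by simpa using hmem 1 le_rfl hQ1)
  -- The function `w` and `u` are limits in `L¹` of the same sequence of weak solutions.
  · rintro w ⟨g, v', V', hg, hsol, hw, hlim⟩
    exact AEEq_of_tendsto_eLpNorm le_rfl (fun n => (hsol n).1.1.1) hw.1 hu.1 hlim
      (by simpa using (hconv g v' V' hg hsol).lebesgue 1 le_rfl hQ2)
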